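/- **Setting.** For an integer $n\ge 0$ let $U_{-n}\subset\mathbb{R}^3$ be the union of all unit lattice cubes $[i,i+1]\times[j,j+1]\times[k,k+1]$, $(i,j,k)\in\mathbb{Z}^3$, that are contained in $\{x\le 0,\ y\le 0,\ z\le 0,\ x+y+z\le -n\}$. Its boundary $\partial U_{-n}$ is a union of unit lattice squares. The *associated graph* $\Gamma(U_{-n})$ is obtained from the dual graph of the $1$-skeleton of $\partial U_{-n}$ by replacing each vertex by a small quadrilateral: its vertices are the pairs $(F,e)$ with $F$ a lattice square of $\partial U_{-n}$ and $e$ a side of $F$; $(F,e)$ and $(F,e')$ are joined when $e,e'$ are consecutive sides of $F$ (facing their common corner), and $(F,e)$ and $(F',e)$ are joined by an edge, called a leg, when $F\neq F'$ share the side $e$. A *dimer cover* is a perfect matching, and a *double-dimer configuration* is a union of two dimer covers; its connected components are doubled edges, (nontrivial) loops and bi-infinite paths. For a configuration $m$, let $c(m)$ be the number of its nontrivial loops, that is, of finite components that are not doubled edges. The *initial configuration* $m_0$ on $\Gamma(U_0)$ uses every leg, and in the small quadrilateral of each square $F$ it uses the two edges facing the two corners of $F$ that are neither the nearest to nor the farthest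 from the origin. A double-dimer configuration $m$ on $\Gamma(U_{-n})$ is *taut* if it has the same boundary connections as $m_0$: there are a finite set $K$ of vertices such that $m$ and $m_0$ have the same edges at every vertex outside $K$, and a bijection between the bi-infinite paths of $m$ and those of $m_0$ such that corresponding paths have the same vertices outside $K$. **Corollary.** For every integer $n\ge 0$, the graph $\Gamma(U_{-n})$ has only finitely many taut double-dimer configurations $m$, each of them has finitely many loops, and $$\sum_{m\ \text{taut on}\ \Gamma(U_{-n})}2^{c(m)}\;=\;14^{\frac n2\left(\frac n2+1\right)+\frac14\delta_{\mathrm{odd}}(n)},$$ where $\delta_{\mathrm{odd}}(n)=1$ if $n$ is odd and $0$ if $n$ is even. -/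

import Mathlib

namespace DoubleDimer

/-- Points of `ℤ³`. -/
abbrev Pt := Fin 3 → ℤ

/-- A stepped solid is a union of unit lattice cubes that is closed under translating a cube by
negative amounts in the coordinates. The cube `∏ i, [c i, c i + 1]` is recorded by its corner `c`,
so a stepped solid is a lower set of `ℤ³`. -/
abbrev SteppedSolid := LowerSet Pt

/-- The unit lattice square through `base`, orthogonal to the coordinate direction `normal`,
with vertices `base`, `base + e_j`, `base + e_k`, `base + e_j + e_k` where
`{j, k, normal} = {0, 1, 2}`. -/
@[ext]
structure LatticeSquare where
  base : Pt
  normal : Fin 3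

/-- The unit lattice segment from `base` to `base + e_dir`. -/
@[ext]
structure LatticeEdge where
  base : Pt
  dir : Fin 3

/-- `e` is one of the four sides of the square `F`: it starts at `F.base`, or at
`F.base + e_k` where `k` is the direction in the plane of `F` orthogonal to `e`. -/
def LatticeEdge.IsSide (e : LatticeEdge) (F : LatticeSquare) : Prop :=
  e.dir ≠ F.normal ∧
    (e.base = F.base ∨
      ∃ k : Fin 3, k ≠ F.normal ∧ k ≠ e.dir ∧ e.base = F.base + Pi.single k 1)

/-- The square `F` lies on the stepped surface `∂U`: of the two cubes that contain `F`, the one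
below belongs to `U` and the one above does not (the reverse is impossible for a lower set). -/
def SteppedSolid.HasSquare (U : SteppedSolid) (F : LatticeSquare) : Prop :=
  F.base - Pi.single F.normal 1 ∈ U ∧ F.base ∉ U

/-- A vertex of an associated graph is a corner of the small quadrilateral placed in a square `F`.
It points to a side `e` of `F`, and is recorded as the pair `(F, e)`. -/
abbrev Vertex := LatticeSquare × LatticeEdge

/-- The vertices of `Γ(U)`: pairs of a square of `∂U` and a side of it. -/
def vertices (U : SteppedSolid) : Set Vertex :=
  {p | U.HasSquare p.1 ∧ p.2.IsSide p.1}

/-- The associated graph `Γ(U)`: the dual graph of the `1`-skeleton of `∂U` with each vertex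
replaced by a small quadrilateral. Its edges are
* the sides of the small quadrilaterals, joining `(F, e)` and `(F, e')` for `e`, `e'`
  non-parallel (that is, consecutive) sides of `F`;
* the legs, joining `(F, e)` and `(F', e)` for distinct squares `F`, `F'` with common side `e`.

All these graphs live on the common type `Vertex`; elements outside `vertices U` are isolated and
are not vertices of `Γ(U)`. -/
def assocGraph (U : SteppedSolid) : SimpleGraph Vertex where
  Adj p q := p ∈ vertices U ∧ q ∈ vertices U ∧
    ((p.1 = q.1 ∧ p.2.dir ≠ q.2.dir) ∨ (p.1 ≠ q.1 ∧ p.2 = q.2))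
  symm := ⟨fun _ _ h => ⟨h.2.1, h.1,
    h.2.2.imp (fun h => ⟨h.1.symm, h.2.symm⟩) (fun h => ⟨h.1.symm, h.2.symm⟩)⟩⟩
  loopless := ⟨fun _ h => h.2.2.elim (fun h => h.2 rfl) (fun h => h.1 rfl)⟩

/-- The solid `U₀`: all cubes in the closed negative orthant. -/
def orthantSolid : SteppedSolid where
  carrier := {c | ∀ i, c i + 1 ≤ 0}
  lower' := fun _ _ hba ha i => (add_le_add_left (hba i) 1).trans (ha i)

/-- The solid `U₋ₙ`: all cubes of `U₀` lying entirely in the half-space `x + y + z ≤ -n`,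
i.e. whose top corner `c + (1, 1, 1)` lies in it. -/
def truncatedSolid (n : ℕ) : SteppedSolid where
  carrier := {c | c ∈ orthantSolid ∧ ∑ i, (c i + 1) ≤ -(n : ℤ)}
  lower' := fun _ _ hba ha => ⟨orthantSolid.lower hba ha.1,
    (Finset.sum_le_sum fun i _ => add_le_add_left (hba i) 1).trans ha.2⟩

/-- A dimer cover (perfect matching) of `Γ(U)`. -/
def IsDimerCover (U : SteppedSolid) (M : (assocGraph U).Subgraph) : Prop :=
  M.IsMatching ∧ M.verts = vertices U

/-- A double-dimer configuration on `Γ(U)` is a union of two dimer covers. Every connected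
component of the union is a doubled edge (a component with two vertices), a loop (a finite
component with more than two vertices), or a bi-infinite path (an infinite component); components
consisting of an isolated point outside `vertices U` play no role. -/
def IsDoubleDimer (U : SteppedSolid) (m : SimpleGraph Vertex) : Prop :=
  ∃ M₁ M₂ : (assocGraph U).Subgraph, IsDimerCover U M₁ ∧ IsDimerCover U M₂ ∧
    m = M₁.spanningCoe ⊔ M₂.spanningCoe

/-- The bi-infinite paths of a double-dimer configuration. -/
abbrev InfinitePath (m : SimpleGraph Vertex) :=
  {C : m.ConnectedComponent // C.supp.Infinite}

/-- The nontrivial loops of a double-dimer configuration (doubled edges are not counted). -/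
def loops (m : SimpleGraph Vertex) : Set m.ConnectedComponent :=
  {C | C.supp.Finite ∧ 2 < C.supp.ncard}

/-- The initial configuration `m₀` on the cubic corner graph `Γ(U₀)`. It uses every leg, and in the
small quadrilateral of each square `F` it uses the two edges facing the corners of `F`
that are neither the nearest to nor the farthest from the origin. (Such a corner is `base + e_j`;
of the two sides of `F` meeting there exactly one starts at `F.base`.) -/
def initialConfig : SimpleGraph Vertex where
  Adj p q := (assocGraph orthantSolid).Adj p q ∧
    (p.1 = q.1 → (p.2.base = p.1.base ↔ q.2.base ≠ q.1.base))
  symm := ⟨fun _ _ h => ⟨h.1.symm, fun e => by have := h.2 e.symm; tauto⟩⟩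
  loopless := ⟨fun _ h => h.1.ne rfl⟩

/-- A double-dimer configuration `m` on `Γ(U)` is taut if, off some finite set `K` of vertices, it
is identical to `m₀`, and there is a bijection between its bi-infinite paths and those of `m₀`
under which corresponding paths coincide off `K`. -/
def IsTaut (U : SteppedSolid) (m : SimpleGraph Vertex) : Prop :=
  IsDoubleDimer U m ∧ ∃ K : Set Vertex, K.Finite ∧
    (∀ p q, p ∉ K → (m.Adj p q ↔ initialConfig.Adj p q)) ∧
    ∃ φ : InfinitePath m ≃ InfinitePath initialConfig,
      ∀ C : InfinitePath m, C.1.supp \ K = (φ C).1.supp \ K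

end DoubleDimer

/-! The count is carried from the truncated solid to the full orthant by adding cubes one at a time,
with weights on some squares that absorb the effect of each move.

Adding a cube replaces the three squares around its lower corner by the three around its upper
corner, inside the same boundary hexagon. The associated graph changes only in twelve inner
vertices, and six legs leave the region. Fix the multiplicities of these legs and the pattern of
connections between the used ones inside. Then the sum of `2 ^ (inner loops)` over unweighted local
configurations on one side equals the same sum on the other side with weighted squares: a
quadrilateral edge has weight `1 / 3` if it faces the nearest or farthest corner and `√14 / 3` if it
faces a middle corner, and each square has the factor `(729 / 196) ^ (1 / 3)`. This is
`regionSum_eq`; it rests on the enumeration `checkStates_eq_true`.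

Two configurations with the same outside and the same pattern have the same connections between
outside vertices, hence the same ends and equally many loops that meet the outside
(`Glue.reachable_iff`, `Glue.exists_bijOn_outerLoops`). So the weighted sum over taut configurations
survives a cube move that exchanges light and heavy squares (`SitePair.transfer`,
`AddsCube.hasCount`). Since the lower squares lie one level of the coordinate sum below the upper
ones, making every other level heavy achieves this exchange. The surface of the truncated solid has
no heavy square, so there the weighted sum is the desired one.

On the orthant the initial configuration is the only taut one (`isTaut_orthant_iff`). Its paths
follow the diagonals of the coordinate planes. The legs that leave the outer part of a plane lie on
distinct paths, and each of these paths must still cross in a taut configuration. An injective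
self-map of these legs that moves only finitely many is surjective, so every leg is used, by
distinct infinite paths (`gates_used`); this determines the quadrilateral edges. The initial
configuration has no loops, three heavy squares together weigh `(729 / 196) * (14 / 9) ^ 3 = 14`,
and there are `3 * heavyCount n` of them, where `heavyCount n` is the required exponent. -/

namespace DoubleDimer

/-! ### Local configurations in a hexagon of three squares -/

/-- The inner vertices of a hexagonal region made of three squares: `(j, σ, b)` points to a side in
direction `j`, has colour `σ`, and `b` tells whether this side is on the boundary hexagon. -/
abbrev LocVertex := Fin 3 × Bool × Bool

/-- Multiplicities of the six legs that leave the region. -/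
abbrev LegState := Fin 3 → Bool → ℕ

/-- Vertex conditions for multiplicities `x` of the edges of the quadrilaterals and `y` of the
inner legs. -/
def LocalEqs (δ : Fin 3) (s : LegState) (x : Fin 3 → Bool → Bool → ℕ) (y : Fin 3 → ℕ) : Prop :=
  ∀ j, y j + x j false false + x j false true = 2 ∧ s j true + x j true false + x j true true = 2 ∧
    y (j + δ) + x j false false + x j true false = 2 ∧
    s (j + δ) false + x j false true + x j true true = 2

/-- The multiplicity function on the inner vertices. -/
def locMult (δ : Fin 3) (x : Fin 3 → Bool → Bool → ℕ) (y : Fin 3 → ℕ) :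
    LocVertex → LocVertex → ℕ
  | (j, true, b), (k, false, b') =>
    if k = j + δ then x j b b' else if k = j ∧ b = false ∧ b' = false then y j else 0
  | (k, false, b'), (j, true, b) =>
    if k = j + δ then x j b b' else if k = j ∧ b = false ∧ b' = false then y j else 0
  | _, _ => 0

theorem locMult_comm (δ : Fin 3) (x : Fin 3 → Bool → Bool → ℕ) (y : Fin 3 → ℕ)
    (u v : LocVertex) : locMult δ x y u v = locMult δ x y v u := by
  obtain ⟨j, _ | _, b⟩ := u <;> obtain ⟨k, _ | _, b'⟩ := v <;> rfl

theorem locMult_self (δ : Fin 3) (x : Fin 3 → Bool → Bool → ℕ) (y : Fin 3 → ℕ)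
    (u : LocVertex) : locMult δ x y u u = 0 := by
  obtain ⟨j, _ | _, b⟩ := u <;> rfl

/-- The graph of a local configuration. -/
def locGraph (δ : Fin 3) (x : Fin 3 → Bool → Bool → ℕ) (y : Fin 3 → ℕ) : SimpleGraph LocVertex where
  Adj u v := locMult δ x y u v ≠ 0
  symm := ⟨fun u v h => by rwa [locMult_comm]⟩
  loopless := ⟨fun u h => h (locMult_self ..)⟩

/-- A local configuration is encoded by the multiplicities `y j` and `x j false false`. -/
abbrev Param := Σ _ : ℕ × ℕ × ℕ, ℕ × ℕ × ℕ

def tri (t : ℕ × ℕ × ℕ) (j : Fin 3) : ℕ :=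
  if j = 0 then t.1 else if j = 1 then t.2.1 else t.2.2

def yOf (p : Param) (j : Fin 3) : ℕ := tri p.1 j

/-- These values solve the vertex equations one after the other. The subtractions are truncated;
they are genuine for the parameters that pass `fOk`. -/
def xOf (δ : Fin 3) (s : LegState) (p : Param) (j : Fin 3) : Bool → Bool → ℕ
  | false, false => tri p.2 j
  | false, true => 2 - (tri p.1 j + tri p.2 j)
  | true, false => 2 - (tri p.1 (j + δ) + tri p.2 j)
  | true, true => 2 - (s j true + (2 - (tri p.1 (j + δ) + tri p.2 j)))

def paramOf (x : Fin 3 → Bool → Bool → ℕ) (y : Fin 3 → ℕ) : Param :=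
  ⟨(y 0, y 1, y 2), (x 0 false false, x 1 false false, x 2 false false)⟩

theorem yOf_paramOf (x : Fin 3 → Bool → Bool → ℕ) (y : Fin 3 → ℕ) : yOf (paramOf x y) = y := by
  funext j; fin_cases j <;> rfl

theorem xOf_paramOf {δ : Fin 3} {s : LegState} {x : Fin 3 → Bool → Bool → ℕ} {y : Fin 3 → ℕ}
    (h : LocalEqs δ s x y) : xOf δ s (paramOf x y) = x := by
  have hy : ∀ j, tri (paramOf x y).1 j = y j := fun j => by fin_cases j <;> rfl
  have hx : ∀ j, tri (paramOf x y).2 j = x j false false := fun j => by fin_cases j <;> rfl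
  funext j b b'
  have := h j
  rcases b with _ | _ <;> rcases b' with _ | _ <;> simp only [xOf, hx, hy] <;> omega

theorem paramOf_xOf (δ : Fin 3) (s : LegState) (p : Param) : paramOf (xOf δ s p) (yOf p) = p := by
  obtain ⟨⟨a, b, c⟩, d, e, f⟩ := p; rfl

def fins : List (Fin 3) := [0, 1, 2]

/-- Both sides equal four minus the number of edges in one quadrilateral: its two vertices of either
colour see the same four edges. This is the one equation that `xOf` does not solve. -/
def yOk (δ : Fin 3) (s : LegState) (y : ℕ × ℕ × ℕ) : Bool :=
  fins.all fun j => Nat.beq (tri y j + s j true) (tri y (j + δ) + s (j + δ) false)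

def fOk (δ : Fin 3) (s : LegState) (y : ℕ × ℕ × ℕ) (j : Fin 3) (f : ℕ) : Bool :=
  Nat.ble (tri y j + f) 2 && Nat.ble (tri y (j + δ) + f) 2 &&
    Nat.ble (s j true + (2 - (tri y (j + δ) + f))) 2 && Nat.ble (s j true) (tri y (j + δ) + f)

def upTo2 : List ℕ := [0, 1, 2]

def fOpts (δ : Fin 3) (s : LegState) (y : ℕ × ℕ × ℕ) (j : Fin 3) : List ℕ :=
  upTo2.filter (fOk δ s y j)

/-- All local configurations with given leg multiplicities. -/
def cands (δ : Fin 3) (s : LegState) : List Param :=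
  ((upTo2 ×ˢ (upTo2 ×ˢ upTo2)).filter (yOk δ s)).sigma fun y =>
    fOpts δ s y 0 ×ˢ (fOpts δ s y 1 ×ˢ fOpts δ s y 2)

theorem nodup_cands (δ : Fin 3) (s : LegState) : (cands δ s).Nodup := by
  have h : upTo2.Nodup := by decide
  have h' : ∀ y j, (fOpts δ s y j).Nodup := fun y j => h.filter _
  exact ((h.product (h.product h)).filter _).sigma fun y =>
    (h' y 0).product ((h' y 1).product (h' y 2))

theorem mem_upTo2 {n : ℕ} : n ∈ upTo2 ↔ n ≤ 2 := by
  simp only [upTo2, List.mem_cons, List.not_mem_nil, or_false]; omega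

theorem mem_cands {δ : Fin 3} (hδ : δ ≠ 0) {s : LegState} {p : Param} :
    p ∈ cands δ s ↔ LocalEqs δ s (xOf δ s p) (yOf p) := by
  obtain ⟨⟨a, b, c⟩, d, e, f⟩ := p
  have h0 : ∀ P : Fin 3 → Prop, (∀ j, P j) ↔ P 0 ∧ P 1 ∧ P 2 := fun P => by
    simp [Fin.forall_fin_succ]
  simp only [cands, List.mem_sigma, List.mem_filter, List.mem_product, mem_upTo2, fOpts, yOk,
    fOk, fins, LocalEqs, List.all_cons, List.all_nil, Bool.and_eq_true, Nat.ble_eq, Nat.beq_eq,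
    h0, xOf, yOf]
  have : δ = 1 ∨ δ = 2 := by omega
  rcases this with rfl | rfl <;> simp [tri] <;> omega

def LocVertex.idx (u : LocVertex) : ℕ :=
  4 * u.1.val + (bif u.2.1 then 2 else 0) + (bif u.2.2 then 1 else 0)

def bools : List Bool := [false, true]

def locVertices : List LocVertex := fins ×ˢ (bools ×ˢ bools)

theorem mem_fins (j : Fin 3) : j ∈ fins := by fin_cases j <;> simp [fins]
theorem mem_bools (b : Bool) : b ∈ bools := by cases b <;> simp [bools]
theorem mem_locVertices (u : LocVertex) : u ∈ locVertices := by
  obtain ⟨j, a, b⟩ := u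
  simp [locVertices, List.mem_product, mem_fins, mem_bools]

/-- The edges of the local graph. -/
def locEdges (δ : Fin 3) (x : Fin 3 → Bool → Bool → ℕ) (y : Fin 3 → ℕ) :
    List (LocVertex × LocVertex) :=
  ((fins.filter fun j => !Nat.beq (y j) 0).map fun j => ((j, true, false), (j, false, false))) ++
  ((fins ×ˢ (bools ×ˢ bools)).filter fun t => !Nat.beq (x t.1 t.2.1 t.2.2) 0).map
    fun t => ((t.1, true, t.2.1), (t.1 + δ, false, t.2.2))

theorem mem_locEdges {δ : Fin 3} (hδ : δ ≠ 0) {x : Fin 3 → Bool → Bool → ℕ} {y : Fin 3 → ℕ}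
    (u v : LocVertex) :
    (locGraph δ x y).Adj u v ↔ (u, v) ∈ locEdges δ x y ∨ (v, u) ∈ locEdges δ x y := by
  have hb : ∀ n : ℕ, (!Nat.beq n 0) = true ↔ n ≠ 0 := by intro n; cases n <;> simp [Nat.beq]
  have hδ' : ∀ j : Fin 3, j ≠ j + δ := by intro j h; omega
  obtain ⟨j, a, b⟩ := u
  obtain ⟨k, a', b'⟩ := v
  simp only [locGraph, locEdges, List.mem_append, List.mem_map, List.mem_filter, hb, mem_fins,
    true_and, Prod.mk.injEq, Prod.exists, List.mem_product, mem_bools]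
  rcases a with _ | _ <;> rcases a' with _ | _
  · simp [locMult]
  · simp only [locMult]
    by_cases h1 : j = k + δ
    · subst h1
      simp [hδ' k]
    · by_cases h2 : j = k
      · subst h2; simp [hδ' j]; tauto
      · simp [h1, h2]; aesop
  · simp only [locMult]
    by_cases h1 : k = j + δ
    · subst h1
      simp [hδ' j]
    · by_cases h2 : k = j
      · subst h2; simp [hδ' k]; tauto
      · simp [h1, h2]; aesop
  · simp [locMult]

end DoubleDimer

namespace DoubleDimer

/-! ### Connected components computed by labels -/

/-- Apply `k` to `n` after evaluating `n`. -/
def forceNat {α : Type} (n : ℕ) (k : ℕ → α) : α := Nat.rec (k 0) (fun m _ => k (Nat.succ m)) n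

theorem forceNat_eq {α : Type} (n : ℕ) (k : ℕ → α) : forceNat n k = k n := by cases n <;> rfl

/-- Continuation-passing with a recursor on each entry makes the kernel normalize the list before it
is used several times; plain `let` bindings would be recomputed. -/
def forceList {α : Type} : List ℕ → (List ℕ → α) → α
  | [], k => k []
  | a :: l, k => forceNat a fun a => forceList l fun l => k (a :: l)

theorem forceList_eq {α : Type} (l : List ℕ) (k : List ℕ → α) : forceList l k = k l := by
  induction l generalizing k with
  | nil => rfl
  | cons a l ih => simp [forceList, forceNat_eq, ih]

/-- Replace label `a` by label `b`. -/
def relabel (a b : ℕ) (l : List ℕ) : List ℕ := l.map fun t => bif Nat.beq t a then b else t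

def labelAt (l : List ℕ) (u : LocVertex) : ℕ := l.getD u.idx 0

def mergeEdges : List (LocVertex × LocVertex) → List ℕ → List ℕ
  | [], l => l
  | e :: E, l => mergeEdges E (relabel (labelAt l e.1) (labelAt l e.2) l)

def initLabels : List ℕ := [0, 1, 2, 3, 4, 5, 6, 7, 8, 9, 10, 11]

/-- Labels of the connected components of the graph with edge list `E`. -/
def labels (E : List (LocVertex × LocVertex)) : List ℕ := mergeEdges E initLabels

/-- A version of `mergeEdges` that evaluates intermediate results. -/
def mergeForce {α : Type} : List (LocVertex × LocVertex) → List ℕ → (List ℕ → α) → α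
  | [], l, k => k l
  | e :: E, l, k => forceNat (labelAt l e.1) fun a => forceNat (labelAt l e.2) fun b =>
      forceList (relabel a b l) fun l => mergeForce E l k

theorem mergeForce_eq {α : Type} (E : List (LocVertex × LocVertex)) (l : List ℕ)
    (k : List ℕ → α) : mergeForce E l k = k (mergeEdges E l) := by
  induction E generalizing l with
  | nil => rfl
  | cons e E ih => simp [mergeForce, mergeEdges, forceNat_eq, forceList_eq, ih]

theorem idx_lt (u : LocVertex) : u.idx < 12 := by
  obtain ⟨j, a, b⟩ := u
  cases a <;> cases b <;> simp [LocVertex.idx] <;> omega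

theorem idx_injective : Function.Injective LocVertex.idx := by
  rintro ⟨j, a, b⟩ ⟨j', a', b'⟩ h
  cases a <;> cases b <;> cases a' <;> cases b' <;> simp [LocVertex.idx] at h ⊢ <;> omega

theorem labelAt_relabel {l : List ℕ} (hl : l.length = 12) (a b : ℕ) (u : LocVertex) :
    labelAt (relabel a b l) u = if labelAt l u = a then b else labelAt l u := by
  have h := idx_lt u
  have h1 : u.idx < l.length := by omega
  simp only [labelAt, relabel, List.getD_eq_getElem?_getD, List.getElem?_map,
    List.getElem?_eq_getElem h1, Option.map_some, Option.getD_some]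
  by_cases h2 : l[u.idx] = a
  · simp [h2]
  · have : Nat.beq l[u.idx] a = false := by
      rw [Bool.eq_false_iff]; simpa using h2
    simp [h2, this]

theorem length_relabel (a b : ℕ) (l : List ℕ) : (relabel a b l).length = l.length := by
  simp [relabel]

/-- The invariant is that equal labels imply reachability; a relabelling identifies two classes only
along an edge, which joins them. -/
theorem mergeEdges_sound {G : SimpleGraph LocVertex} (E : List (LocVertex × LocVertex))
    (hE : ∀ e ∈ E, G.Adj e.1 e.2) (l : List ℕ) (hl : l.length = 12)
    (h : ∀ u v, labelAt l u = labelAt l v → G.Reachable u v) (u v : LocVertex)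
    (huv : labelAt (mergeEdges E l) u = labelAt (mergeEdges E l) v) : G.Reachable u v := by
  induction E generalizing l with
  | nil => exact h u v huv
  | cons e E ih =>
    refine ih (fun e he => hE e (List.mem_cons_of_mem _ he)) _ (by rw [length_relabel, hl]) ?_ huv
    have he : G.Reachable e.1 e.2 := (hE e List.mem_cons_self).reachable
    intro u v huv
    rw [labelAt_relabel hl, labelAt_relabel hl] at huv
    split_ifs at huv with h1 h2 h2
    · exact h _ _ (h1.trans h2.symm)
    · exact ((h _ _ h1).trans he).trans (h _ _ huv)
    · exact (h _ _ huv).trans (he.symm.trans (h _ _ h2.symm))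
    · exact h _ _ huv

theorem mergeEdges_preserves (E : List (LocVertex × LocVertex)) (l : List ℕ) (hl : l.length = 12)
    (u v : LocVertex) (h : labelAt l u = labelAt l v) :
    labelAt (mergeEdges E l) u = labelAt (mergeEdges E l) v := by
  induction E generalizing l with
  | nil => exact h
  | cons e E ih =>
    refine ih _ (by rw [length_relabel, hl]) ?_
    rw [labelAt_relabel hl, labelAt_relabel hl, h]

/-- The step that processes an edge equates the labels of its ends, and relabelling never separates
equal labels. -/
theorem mergeEdges_complete (E : List (LocVertex × LocVertex)) (l : List ℕ) (hl : l.length = 12)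
    (e : LocVertex × LocVertex) (he : e ∈ E) :
    labelAt (mergeEdges E l) e.1 = labelAt (mergeEdges E l) e.2 := by
  induction E generalizing l with
  | nil => simp at he
  | cons e' E ih =>
    rcases List.mem_cons.1 he with rfl | he
    · refine mergeEdges_preserves E _ (by rw [length_relabel, hl]) _ _ ?_
      rw [labelAt_relabel hl, labelAt_relabel hl]
      simp
    · exact ih _ (by rw [length_relabel, hl]) he

theorem labelAt_initLabels (u : LocVertex) : labelAt initLabels u = u.idx := by
  revert u; decide

/-- The labels of a local configuration. -/
def locLabels (δ : Fin 3) (s : LegState) (p : Param) : List ℕ :=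
  labels (locEdges δ (xOf δ s p) (yOf p))

/-- This is the bridge between connectivity in a graph and a list of numbers that the kernel can
compute. -/
theorem reachable_iff_labelAt {δ : Fin 3} (hδ : δ ≠ 0) (s : LegState) (p : Param)
    (u v : LocVertex) : (locGraph δ (xOf δ s p) (yOf p)).Reachable u v ↔
      labelAt (locLabels δ s p) u = labelAt (locLabels δ s p) v := by
  constructor
  · rw [SimpleGraph.reachable_iff_reflTransGen]
    intro h
    induction h with
    | refl => rfl
    | tail _ h ih =>
      rw [ih]
      rcases (mem_locEdges hδ _ _).1 h with h | h
      · exact mergeEdges_complete _ _ rfl _ h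
      · exact (mergeEdges_complete _ _ rfl _ h).symm
  · refine mergeEdges_sound _ (fun e he => (mem_locEdges hδ _ _).2 (Or.inl he)) _ rfl ?_ u v
    intro u v h
    rw [labelAt_initLabels, labelAt_initLabels] at h
    rw [idx_injective h]

theorem labelAt_mergeEdges_lt (E : List (LocVertex × LocVertex)) (l : List ℕ)
    (h : ∀ a ∈ l, a < 12) (hl : l.length = 12) : ∀ a ∈ mergeEdges E l, a < 12 := by
  induction E generalizing l with
  | nil => exact h
  | cons e E ih =>
    refine ih _ (fun a ha => ?_) (by rw [length_relabel, hl])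
    obtain ⟨t, ht, rfl⟩ := List.mem_map.1 ha
    cases Nat.beq t (labelAt l e.1)
    · exact h t ht
    · have h1 : e.2.idx < l.length := by have := idx_lt e.2; omega
      refine h _ ?_
      simp only [cond_true, labelAt, List.getD_eq_getElem?_getD, List.getElem?_eq_getElem h1,
        Option.getD_some]
      exact List.getElem_mem h1

theorem length_mergeEdges (E : List (LocVertex × LocVertex)) (l : List ℕ) :
    (mergeEdges E l).length = l.length := by
  induction E generalizing l with
  | nil => rfl
  | cons e E ih => rw [mergeEdges, ih, length_relabel]

theorem map_labelAt {l : List ℕ} (hl : l.length = 12) : locVertices.map (labelAt l) = l := by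
  match l, hl with
  | [_, _, _, _, _, _, _, _, _, _, _, _], _ => rfl

/-! ### Connection patterns and inner loops -/

/-- The boundary legs that are present. -/
def usedHexes (s : LegState) : List LocVertex :=
  locVertices.filter fun u => u.2.2 && !Nat.beq (s u.1 u.2.1) 0

def usedIdx (s : LegState) : List ℕ := (usedHexes s).map LocVertex.idx

theorem mem_usedHexes {s : LegState} {u : LocVertex} :
    u ∈ usedHexes s ↔ u.2.2 = true ∧ s u.1 u.2.1 ≠ 0 := by
  have hb : ∀ n : ℕ, (!Nat.beq n 0) = true ↔ n ≠ 0 := by intro n; cases n <;> simp [Nat.beq]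
  rw [usedHexes, List.mem_filter, Bool.and_eq_true, hb]
  simp [mem_locVertices]

theorem beq_eq_decide (a b : ℕ) : Nat.beq a b = decide (a = b) := by
  by_cases h : a = b
  · simp [h]
  · rw [decide_eq_false h, Bool.eq_false_iff]; simpa using h

/-- The labels at the positions `h`. -/
def labelsAt (h l : List ℕ) : List ℕ := h.map fun i => l.getD i 0

/-- Which of the labels in a list agree. -/
def agreement (m : List ℕ) : List ℕ :=
  (m ×ˢ m).map fun t => bif Nat.beq t.1 t.2 then 1 else 0

/-- The connection pattern of the used boundary legs. -/
def pattern (s : LegState) (l : List ℕ) : List ℕ := agreement (labelsAt (usedIdx s) l)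

theorem pattern_eq (s : LegState) (l : List ℕ) : pattern s l =
    (usedHexes s ×ˢ usedHexes s).map fun t =>
      bif Nat.beq (labelAt l t.1) (labelAt l t.2) then 1 else 0 := by
  have : ∀ L M : List LocVertex, (L.map (labelAt l) ×ˢ M.map (labelAt l)) =
      (L ×ˢ M).map fun t => (labelAt l t.1, labelAt l t.2) := by
    intro L M
    induction L with
    | nil => rfl
    | cons a L ih => simp [List.product_cons, ih, Function.comp_def]
  have h1 : labelsAt (usedIdx s) l = (usedHexes s).map (labelAt l) := by
    simp [labelsAt, usedIdx, Function.comp_def, labelAt]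
  rw [pattern, agreement, h1, this, List.map_map]
  rfl

/-- The labels themselves are arbitrary representatives. Recording only their agreement makes the
patterns of a region and of its reversal comparable. -/
theorem pattern_eq_iff (s : LegState) (l l' : List ℕ) : pattern s l = pattern s l' ↔
    ∀ u ∈ usedHexes s, ∀ v ∈ usedHexes s,
      (labelAt l u = labelAt l v ↔ labelAt l' u = labelAt l' v) := by
  have hc : ∀ P Q : Prop, [Decidable P] → [Decidable Q] →
      ((bif decide P then 1 else 0 : ℕ) = (bif decide Q then 1 else 0) ↔ (P ↔ Q)) := by
    intro P Q _ _
    by_cases h1 : P <;> by_cases h2 : Q <;> simp [h1, h2]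
  simp only [pattern_eq, List.map_inj_left, beq_eq_decide, hc]
  exact ⟨fun h u hu v hv => h (u, v) (List.mem_product.2 ⟨hu, hv⟩),
    fun h t ht => h t.1 (List.mem_product.1 ht).1 t.2 (List.mem_product.1 ht).2⟩

/-- The number of labels that occur more than twice in `l` and do not occur in `m`. -/
def countLoops (m l : List ℕ) : ℕ :=
  (initLabels.filter fun a => Nat.ble 3 (l.filter (Nat.beq a)).length &&
    m.all fun b => !Nat.beq a b).length

/-- The number of inner loops: components that contain no used boundary leg and more than two
vertices. -/
def innerLoops (s : LegState) (l : List ℕ) : ℕ := countLoops (labelsAt (usedIdx s) l) l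

theorem card_filter_toFinset {α : Type*} [DecidableEq α] {l : List α} (hl : l.Nodup)
    (P : α → Prop) [DecidablePred P] :
    (l.toFinset.filter P).card = (l.filter fun a => decide (P a)).length := by
  rw [← List.toFinset_card_of_nodup (hl.filter _)]
  congr 1
  ext a
  simp

theorem innerLoops_eq (s : LegState) {l : List ℕ} (hl : l.length = 12) : innerLoops s l =
    ((Finset.range 12).filter fun a => 2 < (Finset.univ.filter fun u => labelAt l u = a).card ∧
      ∀ u ∈ usedHexes s, labelAt l u ≠ a).card := by
  have h0 : Finset.range 12 = initLabels.toFinset := by decide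
  have hn : locVertices.Nodup := by decide
  have hu : locVertices.toFinset = Finset.univ := by
    ext u; simp [mem_locVertices]
  rw [h0, card_filter_toFinset (by decide), innerLoops, countLoops]
  congr 1
  refine List.filter_congr fun a _ => ?_
  have h1 : (l.filter (Nat.beq a)).length = (Finset.univ.filter fun u => labelAt l u = a).card := by
    rw [← hu, card_filter_toFinset hn]
    conv_lhs => rw [← map_labelAt hl]
    rw [List.filter_map, List.length_map]
    congr 1
    refine List.filter_congr fun u _ => ?_
    simp [beq_eq_decide, eq_comm]
  rw [h1, Bool.eq_iff_iff]
  simp only [Bool.and_eq_true, Nat.ble_eq, List.all_eq_true, labelsAt, usedIdx, List.map_map,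
    List.mem_map, decide_eq_true_eq, beq_eq_decide]
  refine and_congr Iff.rfl ⟨fun h u hu h' => ?_, fun h b hb => ?_⟩
  · have := h _ ⟨u, hu, rfl⟩
    simp only [Bool.not_eq_true', decide_eq_false_iff_not] at this
    exact this h'.symm
  · obtain ⟨u, hu, rfl⟩ := hb
    simp only [Bool.not_eq_true', decide_eq_false_iff_not]
    exact fun h' => h u hu h'.symm

/-! ### Finite verification of the local identity -/

def sumX (x : Fin 3 → Bool → Bool → ℕ) (j : Fin 3) : ℕ :=
  x j false false + x j false true + x j true false + x j true true

/-- Number of edges in the quadrilaterals. -/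
def quadEdges (x : Fin 3 → Bool → Bool → ℕ) : ℕ := sumX x 0 + sumX x 1 + sumX x 2

/-- Number of quadrilateral edges that face a middle corner. -/
def midEdges (x : Fin 3 → Bool → Bool → ℕ) : ℕ :=
  x 0 false true + x 0 true false + (x 1 false true + x 1 true false) +
    (x 2 false true + x 2 true false)

/-- For the configurations that occur this is `3 ^ 12` times the product of the edge weights `1 / 3`
and `√14 / 3`: `parityOk` tests that there are at most twelve edges and an even number of middle
ones. -/
def heavyWeight (x : Fin 3 → Bool → Bool → ℕ) : ℕ :=
  3 ^ (12 - quadEdges x) * 14 ^ (midEdges x / 2)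

/-- The contribution of the configurations in `ps` with connection pattern `k`. -/
def patternSum (δ : Fin 3) (s : LegState) (w : Param → ℕ) (ps : List Param) (k : List ℕ) : ℕ :=
  ((ps.filter fun p => pattern s (locLabels δ s p) = k).map fun p =>
    2 ^ innerLoops s (locLabels δ s p) * w p).sum

abbrev Entry := List ℕ × ℕ × ℕ

/-- The pattern of a configuration, and its contributions without and with `heavyWeight`. -/
def entryOf (δ : Fin 3) (s : LegState) (p : Param) : Entry :=
  (pattern s (locLabels δ s p), 2 ^ innerLoops s (locLabels δ s p) * 1,
    2 ^ innerLoops s (locLabels δ s p) * heavyWeight (xOf δ s p))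

/-- Evaluate the entries of a list of configurations, given `h = usedIdx s`. -/
def entries {α : Type} (δ : Fin 3) (s : LegState) (h : List ℕ) :
    List Param → (List Entry → α) → α
  | [], k => k []
  | p :: ps, k => mergeForce (locEdges δ (xOf δ s p) (yOf p)) initLabels fun l =>
      forceList (labelsAt h l) fun m => forceList (agreement m) fun q =>
        forceNat (2 ^ countLoops m l) fun n =>
          forceNat (heavyWeight (xOf δ s p)) fun w =>
            entries δ s h ps fun es => k ((q, n * 1, n * w) :: es)

theorem entries_eq {α : Type} (δ : Fin 3) (s : LegState) (ps : List Param)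
    (k : List Entry → α) : entries δ s (usedIdx s) ps k = k (ps.map (entryOf δ s)) := by
  induction ps generalizing k with
  | nil => rfl
  | cons p ps ih =>
    simp only [entries, mergeForce_eq, forceList_eq, forceNat_eq, ih, List.map_cons]; rfl

def eqList : List ℕ → List ℕ → Bool
  | [], [] => true
  | a :: l, b :: l' => Nat.beq a b && eqList l l'
  | _, _ => false

theorem eqList_iff (l l' : List ℕ) : eqList l l' = true ↔ l = l' := by
  induction l generalizing l' with
  | nil => cases l' <;> simp [eqList]
  | cons a l ih => cases l' <;> simp [eqList, ih]

def sumAt (f : ℕ × ℕ → ℕ) (es : List Entry) (k : List ℕ) : ℕ :=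
  es.foldr (fun e n => bif eqList e.1 k then f e.2 + n else n) 0

theorem sumAt_map_entryOf (f : ℕ × ℕ → ℕ) (δ : Fin 3) (s : LegState) (w : Param → ℕ)
    (ps : List Param)
    (hf : ∀ p, f (entryOf δ s p).2 = 2 ^ innerLoops s (locLabels δ s p) * w p) (k : List ℕ) :
    sumAt f (ps.map (entryOf δ s)) k = patternSum δ s w ps k := by
  induction ps with
  | nil => rfl
  | cons p ps ih =>
    simp only [List.map_cons, sumAt, List.foldr_cons] at ih ⊢
    rw [ih]
    by_cases h : pattern s (locLabels δ s p) = k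
    · have h' : eqList (entryOf δ s p).1 k = true := (eqList_iff _ _).2 h
      rw [h', cond_true, hf]
      simp [patternSum, h]
    · have h' : eqList (entryOf δ s p).1 k = false :=
        Bool.eq_false_iff.2 (fun h' => h ((eqList_iff _ _).1 h'))
      rw [h', cond_false]
      simp [patternSum, h]

def parityOk (δ : Fin 3) (s : LegState) : Bool :=
  (cands δ s).all fun p => Nat.ble (quadEdges (xOf δ s p)) 12 &&
    Nat.beq (midEdges (xOf δ s p) % 2) 0

/-- The quotient `729 / 196` normalizes three heavy squares, and `3 ^ 12` is the denominator cleared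
in `heavyWeight`. Both assignments of light and heavy to the two orientations are compared. -/
def compareSums (es es' : List Entry) (k : List ℕ) : Bool :=
  Nat.beq (196 * 3 ^ 12 * sumAt Prod.fst es k) (729 * sumAt Prod.snd es' k) &&
    Nat.beq (196 * 3 ^ 12 * sumAt Prod.fst es' k) (729 * sumAt Prod.snd es k)

def checkState (s : LegState) : Bool :=
  parityOk 1 s && parityOk 2 s &&
  forceList (usedIdx s) fun h => entries 1 s h (cands 1 s) fun es =>
    entries 2 s h (cands 2 s) fun es' => (es ++ es').all fun e => compareSums es es' e.1

def mkState (a b c d e f : ℕ) (j : Fin 3) (t : Bool) : ℕ :=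
  bif t then tri (a, b, c) j else tri (d, e, f) j

def checkStates (a b c : ℕ) : Bool :=
  upTo2.all fun d => upTo2.all fun e => upTo2.all fun f => checkState (mkState a b c d e f)

end DoubleDimer

namespace DoubleDimer

/-- There are `3 ^ 6` leg states. For each of them the kernel lists the local configurations of both
orientations and compares the sums pattern by pattern. -/
theorem checkStates_eq_true :
    (upTo2.all fun a => upTo2.all fun b => upTo2.all fun c => checkStates a b c) = true := by
  decide +kernel

end DoubleDimer

namespace DoubleDimer

theorem checkState_eq_true {s : LegState} (hs : ∀ j t, s j t ≤ 2) : checkState s = true := by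
  have h := checkStates_eq_true
  simp only [checkStates, List.all_eq_true] at h
  have e : s = mkState (s 0 true) (s 1 true) (s 2 true) (s 0 false) (s 1 false) (s 2 false) := by
    funext j t
    fin_cases j <;> cases t <;> rfl
  rw [e]
  exact h _ (mem_upTo2.2 (hs ..)) _ (mem_upTo2.2 (hs ..)) _ (mem_upTo2.2 (hs ..)) _
    (mem_upTo2.2 (hs ..)) _ (mem_upTo2.2 (hs ..)) _ (mem_upTo2.2 (hs ..))

theorem patternSum_eq_zero {δ : Fin 3} {s : LegState} {w : Param → ℕ} {ps : List Param}
    {k : List ℕ} (h : ∀ p ∈ ps, pattern s (locLabels δ s p) ≠ k) :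
    patternSum δ s w ps k = 0 := by
  have : (ps.filter fun p => pattern s (locLabels δ s p) = k) = [] := by
    rw [List.filter_eq_nil_iff]
    intro p hp
    simpa using h p hp
  rw [patternSum, this]
  rfl

theorem compareSums_eq_true {s : LegState} (hs : ∀ j t, s j t ≤ 2) (k : List ℕ) :
    196 * 3 ^ 12 * patternSum 1 s (fun _ => 1) (cands 1 s) k =
      729 * patternSum 2 s (fun p => heavyWeight (xOf 2 s p)) (cands 2 s) k ∧
    196 * 3 ^ 12 * patternSum 2 s (fun _ => 1) (cands 2 s) k =
      729 * patternSum 1 s (fun p => heavyWeight (xOf 1 s p)) (cands 1 s) k := by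
  have h := checkState_eq_true hs
  rw [checkState, Bool.and_eq_true, forceList_eq, entries_eq, entries_eq] at h
  have h2 := h.2
  simp only [List.all_eq_true, List.mem_append, List.mem_map] at h2
  have key : ∀ p, (p ∈ cands 1 s ∧ pattern s (locLabels 1 s p) = k) ∨
      (p ∈ cands 2 s ∧ pattern s (locLabels 2 s p) = k) →
      compareSums ((cands 1 s).map (entryOf 1 s)) ((cands 2 s).map (entryOf 2 s)) k = true := by
    rintro p (⟨hp, rfl⟩ | ⟨hp, rfl⟩)
    · exact h2 (entryOf 1 s p) (Or.inl ⟨p, hp, rfl⟩)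
    · exact h2 (entryOf 2 s p) (Or.inr ⟨p, hp, rfl⟩)
  by_cases hk : ∃ p, (p ∈ cands 1 s ∧ pattern s (locLabels 1 s p) = k) ∨
      (p ∈ cands 2 s ∧ pattern s (locLabels 2 s p) = k)
  · obtain ⟨p, hp⟩ := hk
    have := key p hp
    rw [compareSums, Bool.and_eq_true, Nat.beq_eq, Nat.beq_eq] at this
    rwa [sumAt_map_entryOf Prod.fst 1 s (fun _ => 1) _ (fun _ => rfl),
      sumAt_map_entryOf Prod.fst 2 s (fun _ => 1) _ (fun _ => rfl),
      sumAt_map_entryOf Prod.snd 1 s (fun p => heavyWeight (xOf 1 s p)) _ (fun _ => rfl),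
      sumAt_map_entryOf Prod.snd 2 s (fun p => heavyWeight (xOf 2 s p)) _ (fun _ => rfl)] at this
  -- A pattern that occurs for neither orientation was not tested, but both of its sums are empty.
  · push Not at hk
    have h1 : ∀ w, patternSum 1 s w (cands 1 s) k = 0 := fun w =>
      patternSum_eq_zero fun p hp => (hk p).1 hp
    have h2 : ∀ w, patternSum 2 s w (cands 2 s) k = 0 := fun w =>
      patternSum_eq_zero fun p hp => (hk p).2 hp
    simp [h1, h2]

/-- The local identity behind the cube move. -/
theorem patternSum_identity {δ : Fin 3} (hδ : δ ≠ 0) {s : LegState} (hs : ∀ j t, s j t ≤ 2)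
    (k : List ℕ) : 196 * 3 ^ 12 * patternSum δ s (fun _ => 1) (cands δ s) k =
      729 * patternSum (-δ) s (fun p => heavyWeight (xOf (-δ) s p)) (cands (-δ) s) k := by
  have : δ = 1 ∨ δ = 2 := by omega
  rcases this with rfl | rfl
  · exact (compareSums_eq_true hs k).1
  · exact (compareSums_eq_true hs k).2

theorem quadEdges_le_and_even_midEdges {δ : Fin 3} (hδ : δ ≠ 0) {s : LegState}
    (hs : ∀ j t, s j t ≤ 2) {p : Param} (hp : p ∈ cands δ s) :
    quadEdges (xOf δ s p) ≤ 12 ∧ 2 ∣ midEdges (xOf δ s p) := by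
  have h := checkState_eq_true hs
  rw [checkState, Bool.and_eq_true, Bool.and_eq_true] at h
  have : δ = 1 ∨ δ = 2 := by omega
  have h' : parityOk δ s = true := by
    rcases this with rfl | rfl
    exacts [h.1.1, h.1.2]
  have := List.all_eq_true.1 h' p hp
  rw [Bool.and_eq_true, Nat.ble_eq, Nat.beq_eq] at this
  exact ⟨this.1, Nat.dvd_of_mod_eq_zero this.2⟩

/-! ### Real weights of heavy squares -/

/-- The weight of the edges of a quadrilateral in a heavy square; `b = b'` for the edges that face
the corners nearest to and farthest from the origin. -/
noncomputable def edgeWeight (b b' : Bool) : ℝ := if b = b' then 1 / 3 else √14 / 3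

/-- The normalization of a heavy square. -/
noncomputable def heavyConst : ℝ := (729 / 196 : ℝ) ^ (1 / 3 : ℝ)

theorem heavyConst_pow : heavyConst ^ 3 = 729 / 196 := by
  rw [heavyConst, ← Real.rpow_natCast, ← Real.rpow_mul (by norm_num)]
  norm_num

theorem heavyConst_pos : 0 < heavyConst := by rw [heavyConst]; positivity

theorem edgeWeight_pos (b b' : Bool) : 0 < edgeWeight b b' := by
  rw [edgeWeight]; split_ifs <;> positivity

/-- The weight of a heavy square. -/
noncomputable def squareWeight (q : Bool → Bool → ℕ) : ℝ :=
  heavyConst * ∏ b, ∏ b', edgeWeight b b' ^ q b b'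

theorem squareWeight_pos (q : Bool → Bool → ℕ) : 0 < squareWeight q :=
  mul_pos heavyConst_pos (Finset.prod_pos fun _ _ => Finset.prod_pos fun _ _ =>
    pow_pos (edgeWeight_pos _ _) _)

theorem squareWeight_eq (q : Bool → Bool → ℕ) : squareWeight q =
    heavyConst * ((1 / 3) ^ (q false false + q false true + q true false + q true true) *
      √14 ^ (q false true + q true false)) := by
  simp only [squareWeight, Fintype.prod_bool, edgeWeight]
  simp only [if_true, Bool.true_eq_false, Bool.false_eq_true, if_false, div_pow, pow_add]
  ring

/-- The first hypothesis allows the powers of `1 / 3` to be cleared with `3 ^ 12`; the second turns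
the power of `√14` into a power of `14`. -/
theorem prod_squareWeight {x : Fin 3 → Bool → Bool → ℕ} (h : quadEdges x ≤ 12)
    (h2 : 2 ∣ midEdges x) :
    ∏ j, squareWeight (x j) = 729 / (196 * 3 ^ 12) * heavyWeight x := by
  obtain ⟨r, hr⟩ := h2
  have e : ∏ j, squareWeight (x j) =
      heavyConst ^ 3 * ((1 / 3) ^ quadEdges x * √14 ^ midEdges x) := by
    simp only [Fin.prod_univ_three, squareWeight_eq, quadEdges, midEdges, sumX, pow_add]
    ring
  have h3 : (1 / 3 : ℝ) ^ quadEdges x = 3 ^ (12 - quadEdges x) / 3 ^ 12 := by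
    rw [pow_sub₀ _ (by norm_num) h]
    field_simp
    simp
  rw [e, heavyConst_pow, h3, hr, pow_mul, Real.sq_sqrt (by norm_num), heavyWeight, hr,
    Nat.mul_div_cancel_left _ (by norm_num)]
  push_cast
  ring

/-- The weight of the three squares of a region, which are all heavy or all light. -/
noncomputable def regionWeight (heavy : Prop) [Decidable heavy] (x : Fin 3 → Bool → Bool → ℕ) : ℝ :=
  if heavy then ∏ j, squareWeight (x j) else 1

theorem regionWeight_pos (heavy : Prop) [Decidable heavy] (x : Fin 3 → Bool → Bool → ℕ) :
    0 < regionWeight heavy x := by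
  rw [regionWeight]
  split_ifs
  exacts [Finset.prod_pos fun _ _ => squareWeight_pos _, one_pos]

/-- The total weight of the local configurations with a given connection pattern. -/
noncomputable def regionSum (heavy : Prop) [Decidable heavy] (δ : Fin 3) (s : LegState)
    (k : List ℕ) : ℝ :=
  ∑ p ∈ (cands δ s).toFinset with pattern s (locLabels δ s p) = k,
    2 ^ innerLoops s (locLabels δ s p) * regionWeight heavy (xOf δ s p)

theorem cast_patternSum (δ : Fin 3) (s : LegState) (w : Param → ℕ) (k : List ℕ) :
    (patternSum δ s w (cands δ s) k : ℝ) =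
      ∑ p ∈ (cands δ s).toFinset with pattern s (locLabels δ s p) = k,
        2 ^ innerLoops s (locLabels δ s p) * (w p : ℝ) := by
  have h : ((cands δ s).toFinset.filter fun p => pattern s (locLabels δ s p) = k) =
      ((cands δ s).filter fun p => pattern s (locLabels δ s p) = k).toFinset := by
    ext; simp
  rw [h, List.sum_toFinset _ ((nodup_cands δ s).filter _), patternSum]
  simp [Function.comp_def]

theorem regionSum_light (δ : Fin 3) (s : LegState) (k : List ℕ) {heavy : Prop} [Decidable heavy]
    (h : ¬heavy) : regionSum heavy δ s k = patternSum δ s (fun _ => 1) (cands δ s) k := by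
  rw [cast_patternSum, regionSum]
  simp [regionWeight, h]

theorem regionSum_heavy {δ : Fin 3} (hδ : δ ≠ 0) {s : LegState} (hs : ∀ j t, s j t ≤ 2)
    (k : List ℕ) {heavy : Prop} [Decidable heavy]
    (h : heavy) : regionSum heavy δ s k = 729 / (196 * 3 ^ 12) *
      patternSum δ s (fun p => heavyWeight (xOf δ s p)) (cands δ s) k := by
  rw [cast_patternSum, regionSum, Finset.mul_sum]
  refine Finset.sum_congr rfl fun p hp => ?_
  have hp' := quadEdges_le_and_even_midEdges hδ hs (List.mem_toFinset.1 (Finset.mem_filter.1 hp).1)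
  rw [regionWeight, if_pos h, prod_squareWeight hp'.1 hp'.2]
  ring

/-- Exchanging light and heavy squares compensates for reversing the region. -/
theorem regionSum_eq {δ : Fin 3} (hδ : δ ≠ 0) {s : LegState} (hs : ∀ j t, s j t ≤ 2)
    (k : List ℕ) {heavy heavy' : Prop} [Decidable heavy] [Decidable heavy']
    (h : heavy' ↔ ¬heavy) : regionSum heavy δ s k = regionSum heavy' (-δ) s k := by
  have hδ' : -δ ≠ 0 := neg_ne_zero.2 hδ
  by_cases hh : heavy
  · rw [regionSum_heavy hδ hs k hh, regionSum_light _ _ _ (by tauto)]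
    have := patternSum_identity hδ' hs k
    rw [neg_neg] at this
    have : (196 * 3 ^ 12 * (patternSum (-δ) s (fun _ => 1) (cands (-δ) s) k : ℝ)) =
      729 * patternSum δ s (fun p => heavyWeight (xOf δ s p)) (cands δ s) k := by
      exact_mod_cast this
    rw [div_mul_eq_mul_div, div_eq_iff (by norm_num)]
    linarith
  · rw [regionSum_light _ _ _ hh, regionSum_heavy hδ' hs k (h.2 hh)]
    have : (196 * 3 ^ 12 * (patternSum δ s (fun _ => 1) (cands δ s) k : ℝ)) =
      729 * patternSum (-δ) s (fun p => heavyWeight (xOf (-δ) s p)) (cands (-δ) s) k := by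
      exact_mod_cast patternSum_identity hδ hs k
    rw [div_mul_eq_mul_div, eq_div_iff (by norm_num)]
    linarith

end DoubleDimer

namespace DoubleDimer

/-! ### Double-dimer configurations as edge multiplicities -/

section Abstract
variable {V : Type*}

/-- `μ` gives the edge multiplicities of a double-dimer configuration on the graph `G` with vertex
set `S`: the total multiplicity of the edges at every vertex of `S` is two. -/
structure IsMult (G : SimpleGraph V) (S : Set V) (μ : V → V → ℕ) : Prop where
  symm : ∀ p q, μ p q = μ q p
  adj : ∀ p q, μ p q ≠ 0 → G.Adj p q
  two : ∀ p ∈ S, ∃ a b, ∀ q, μ p q = Set.indicator {a} 1 q + Set.indicator {b} 1 q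

/-- The graph `m` has edge multiplicities `μ`. -/
def Supports (m : SimpleGraph V) (μ : V → V → ℕ) : Prop := ∀ p q, m.Adj p q ↔ μ p q ≠ 0

open Classical in
/-- The edge multiplicities of a double-dimer configuration: an edge is doubled if its ends have no
other neighbours. -/
noncomputable def mult (m : SimpleGraph V) (p q : V) : ℕ :=
  if m.Adj p q then if ∃ r, r ≠ q ∧ m.Adj p r then 1 else 2 else 0

theorem indicator_singleton_ne_zero {a q : V} : Set.indicator {a} (1 : V → ℕ) q ≠ 0 ↔ q = a := by
  simp

theorem IsMult.two_ne_zero {G : SimpleGraph V} {S : Set V} {μ : V → V → ℕ} (h : IsMult G S μ)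
    {p : V} (hp : p ∈ S) : ∃ a b, (∀ q, μ p q ≠ 0 ↔ q = a ∨ q = b) ∧
      (a = b → μ p a = 2) ∧ (a ≠ b → μ p a = 1 ∧ μ p b = 1) := by
  obtain ⟨a, b, hab⟩ := h.two p hp
  refine ⟨a, b, fun q => ?_, fun e => ?_, fun e => ?_⟩
  · rw [hab, ← indicator_singleton_ne_zero, ← indicator_singleton_ne_zero (a := b)]
    omega
  · subst e; simp [hab]
  · simp [hab, e, e.symm]

/-- The total multiplicity at a vertex is two, so an edge is doubled exactly when its end has no
other neighbour. Hence the graph alone determines the multiplicities. -/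
theorem IsMult.mult_eq {G : SimpleGraph V} {S : Set V} {μ : V → V → ℕ} (h : IsMult G S μ)
    (hS : ∀ p q, G.Adj p q → p ∈ S) {m : SimpleGraph V} (hm : Supports m μ) : mult m = μ := by
  funext p q
  by_cases hpq : m.Adj p q
  · have hpS : p ∈ S := hS p q (h.adj p q ((hm p q).1 hpq))
    obtain ⟨a, b, hab, h2, h1⟩ := h.two_ne_zero hpS
    rw [mult, if_pos hpq]
    have hadj : ∀ q, m.Adj p q ↔ q = a ∨ q = b := fun q => by rw [hm, hab]
    rw [hadj] at hpq
    by_cases e : a = b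
    · subst e
      rw [or_self] at hpq
      subst hpq
      rw [if_neg (fun ⟨r, h3, h4⟩ => h3 (by simpa using (hadj r).1 h4)), h2 rfl]
    · rcases hpq with rfl | rfl
      · rw [if_pos ⟨b, fun e' => e e'.symm, (hadj _).2 (Or.inr rfl)⟩, (h1 e).1]
      · rw [if_pos ⟨a, e, (hadj _).2 (Or.inl rfl)⟩, (h1 e).2]
  · rw [mult, if_neg hpq]
    rw [hm] at hpq
    omega

theorem Supports.ext {m m' : SimpleGraph V} {μ : V → V → ℕ} (h : Supports m μ)
    (h' : Supports m' μ) : m = m' := by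
  ext p q; rw [h, h']

/-- The graph with given multiplicities. -/
def graphOf {G : SimpleGraph V} {S : Set V} {μ : V → V → ℕ} (h : IsMult G S μ) :
    SimpleGraph V where
  Adj p q := μ p q ≠ 0
  symm := ⟨fun p q e => by rwa [h.symm]⟩
  loopless := ⟨fun p e => (h.adj p p e).ne rfl⟩

theorem supports_graphOf {G : SimpleGraph V} {S : Set V} {μ : V → V → ℕ} (h : IsMult G S μ) :
    Supports (graphOf h) μ := fun _ _ => Iff.rfl

/-! ### Splitting a double-dimer configuration into two dimer covers -/

/-- The darts of a graph all of whose vertices have two neighbours or one can be oriented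
consistently. The hypothesis gives for every dart `(u, v)` the next one. -/
theorem exists_orientation {D : Type*} (next : Equiv.Perm D) (rev : D → D)
    (hrev : ∀ d, rev (rev d) = d) (hne : ∀ d, rev d ≠ d) (hnext : ∀ d, next d ≠ rev d)
    (hconj : ∀ d, next (rev (next d)) = rev d) :
    ∃ P : Set D, (∀ d, next d ∈ P ↔ d ∈ P) ∧ ∀ d, rev d ∈ P ↔ d ∉ P := by
  have hrn : ∀ d, rev (next d) = next.symm (rev d) := fun d => by
    rw [Equiv.eq_symm_apply, hconj]
  have hrp : ∀ (k : ℕ) d, rev ((next ^ k) d) = (next ^ (-(k : ℤ))) (rev d) := by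
    intro k
    induction k with
    | zero => intro d; simp
    | succ k ih =>
      intro d
      rw [pow_succ', Equiv.Perm.mul_apply, hrn, ih, ← Equiv.Perm.inv_def, ← Equiv.Perm.mul_apply,
        ← zpow_neg_one, ← zpow_add]
      congr 2
      push_cast
      ring
  have hrz : ∀ (k : ℤ) d, rev ((next ^ k) d) = (next ^ (-k)) (rev d) := by
    intro k d
    obtain ⟨n, rfl | rfl⟩ := k.eq_nat_or_neg
    · rw [zpow_natCast, hrp]
    · have := hrp n ((next ^ (-(n : ℤ))) d)
      rw [← zpow_natCast, ← Equiv.Perm.mul_apply, ← zpow_add, add_neg_cancel, zpow_zero,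
        Equiv.Perm.one_apply] at this
      rw [this, ← Equiv.Perm.mul_apply, ← zpow_add]
      simp
  let o : D → Quotient (Equiv.Perm.SameCycle.setoid next) := fun d => Quotient.mk _ d
  have ho : ∀ d d', o d = o d' ↔ next.SameCycle d d' := fun d d' => Quotient.eq
  -- If `rev d = next ^ k d`, then halfway along the orbit there is a dart equal to its own reverse
  -- for even `k`, or a dart whose successor is its reverse for odd `k`. Both are excluded.
  have hno : ∀ d, o (rev d) ≠ o d := by
    intro d h
    obtain ⟨k, hk⟩ := (ho _ _).1 h.symm
    obtain ⟨l, rfl | rfl⟩ := Int.even_or_odd' k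
    · refine hne ((next ^ l) d) ?_
      rw [hrz, ← hk, ← Equiv.Perm.mul_apply, ← zpow_add]
      congr 2
      ring
    · refine hnext ((next ^ l) d) ?_
      rw [hrz, ← hk, ← Equiv.Perm.mul_apply, ← Equiv.Perm.mul_apply, ← zpow_add, ← zpow_one_add]
      congr 2
      ring
  classical
  -- An arbitrary order on the orbits selects one of the two orbits that reversal exchanges.
  let _ : LinearOrder (Quotient (Equiv.Perm.SameCycle.setoid next)) :=
    linearOrderOfSTO WellOrderingRel
  refine ⟨{d | o d < o (rev d)}, fun d => ?_, fun d => ?_⟩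
  · have h1 : o (next d) = o d := (ho _ _).2 (Equiv.Perm.sameCycle_apply_left.2 (.refl _ _))
    have h2 : o (rev (next d)) = o (rev d) := by
      rw [hrn]
      exact (ho _ _).2 (Equiv.Perm.sameCycle_symm_apply_left.2 (.refl _ _))
    simp only [Set.mem_ofPred_eq, h1, h2]
  · simp only [Set.mem_ofPred_eq, hrev, not_lt]
    exact ⟨le_of_lt, fun h => lt_of_le_of_ne h (hno d)⟩

theorem IsMult.exists_other {G : SimpleGraph V} {S : Set V} {μ : V → V → ℕ} (h : IsMult G S μ)
    {p q : V} (hp : p ∈ S) (hq : μ p q = 1) :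
    ∃ r, r ≠ q ∧ μ p r = 1 ∧ ∀ r', μ p r' ≠ 0 → r' = q ∨ r' = r := by
  obtain ⟨a, b, hab, h2, h1⟩ := h.two_ne_zero hp
  have hq' := (hab q).1 (by omega)
  by_cases e : a = b
  · subst e
    rw [or_self] at hq'
    subst hq'
    have := h2 rfl
    omega
  · rcases hq' with rfl | rfl
    · exact ⟨b, fun e' => e e'.symm, (h1 e).2, fun r hr => (hab r).1 hr⟩
    · exact ⟨a, e, (h1 e).1, fun r hr => ((hab r).1 hr).symm⟩

/-- The edges of multiplicity one can be oriented such that every vertex on them has one incoming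
and one outgoing edge. -/
theorem IsMult.exists_oriented {G : SimpleGraph V} {S : Set V} {μ : V → V → ℕ}
    (h : IsMult G S μ) (hS : ∀ p q, G.Adj p q → p ∈ S) :
    ∃ P : V → V → Prop, (∀ p q, μ p q = 1 → (P q p ↔ ¬P p q)) ∧
      ∀ p q r, μ p q = 1 → μ q r = 1 → p ≠ r → (P p q ↔ P q r) := by
  have hS' : ∀ p q, μ p q = 1 → p ∈ S := fun p q e => hS p q (h.adj p q (by omega))
  have hsy : ∀ p q, μ p q = 1 → μ q p = 1 := fun p q e => by rw [h.symm, e]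
  choose other hne hone huniq using
    fun (d : {d : V × V // μ d.1 d.2 = 1}) => h.exists_other (hS' _ _ d.2) d.2
  have hoo : ∀ d, other ⟨(d.1.1, other d), hone d⟩ = d.1.2 := fun d =>
    ((huniq ⟨(d.1.1, other d), hone d⟩ d.1.2 (by rw [d.2]; exact one_ne_zero)).resolve_left
      (hne d).symm).symm
  let rev : {d : V × V // μ d.1 d.2 = 1} → {d : V × V // μ d.1 d.2 = 1} :=
    fun d => ⟨(d.1.2, d.1.1), hsy _ _ d.2⟩
  let swing : {d : V × V // μ d.1 d.2 = 1} → {d : V × V // μ d.1 d.2 = 1} :=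
    fun d => ⟨(d.1.1, other d), hone d⟩
  have hss : ∀ d, swing (swing d) = d := fun d => by
    apply Subtype.ext
    exact Prod.ext rfl (hoo d)
  have hrr : ∀ d, rev (rev d) = d := fun d => rfl
  let next : Equiv.Perm {d : V × V // μ d.1 d.2 = 1} :=
    ⟨fun d => swing (rev d), fun d => rev (swing d), fun d => by simp only [hss, hrr],
      fun d => by simp only [hss, hrr]⟩
  obtain ⟨P, hP1, hP2⟩ := exists_orientation next rev hrr
    (fun d e => (h.adj d.1.1 d.1.2 (by rw [d.2]; exact one_ne_zero)).ne
      (congrArg (fun d => d.1.2) e))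
    (fun d e => hne (rev d) (congrArg (fun d => d.1.2) e))
    (fun d => by
      change swing (rev (rev (swing (rev d)))) = rev d
      rw [hrr, hss])
  refine ⟨fun p q => ∃ e : μ p q = 1, (⟨(p, q), e⟩ : {d : V × V // μ d.1 d.2 = 1}) ∈ P,
    fun p q e => ?_, fun p q r e e' hpr => ?_⟩
  · have := hP2 ⟨(p, q), e⟩
    simp only [e, hsy _ _ e, exists_true_left]
    exact this
  · have h1 : next ⟨(p, q), e⟩ = ⟨(q, r), e'⟩ := by
      apply Subtype.ext
      refine Prod.ext rfl ?_
      exact ((huniq (rev ⟨(p, q), e⟩) r (by rw [e']; exact one_ne_zero)).resolve_left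
        hpr.symm).symm
    have := hP1 ⟨(p, q), e⟩
    rw [h1] at this
    simp only [e, e', exists_true_left]
    exact this.symm

/-- A double-dimer configuration on a bipartite graph, given by its multiplicities, contains at
every vertex one edge of a first and one edge of a second matching. -/
theorem IsMult.exists_matchings {G : SimpleGraph V} {S : Set V} {μ : V → V → ℕ}
    (h : IsMult G S μ) (hS : ∀ p q, G.Adj p q → p ∈ S) (col : V → Prop)
    (hcol : ∀ p q, G.Adj p q → (col q ↔ ¬col p)) :
    ∃ M : Bool → V → V → Prop, (∀ i p q, M i p q → M i q p) ∧
      (∀ p q, μ p q ≠ 0 ↔ M true p q ∨ M false p q) ∧ ∀ i, ∀ p ∈ S, ∃! q, M i p q := by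
  obtain ⟨P, hP1, hP2⟩ := h.exists_oriented hS
  have hsy : ∀ p q, μ p q = 1 → μ q p = 1 := fun p q e => by rw [h.symm, e]
  -- Doubled edges belong to both matchings. A single edge belongs to the matching `true` if it is
  -- oriented from `col` to its complement and to `false` otherwise; one incoming and one outgoing
  -- edge at each vertex then go to different matchings.
  refine ⟨fun i p q => μ p q = 2 ∨ μ p q = 1 ∧ (P p q ↔ (col p ↔ i = true)), ?_, ?_, ?_⟩
  · rintro i p q (e | ⟨e, e'⟩)
    · exact Or.inl (by rw [h.symm, e])
    · refine Or.inr ⟨hsy _ _ e, ?_⟩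
      rw [hP1 _ _ e, hcol p q (h.adj _ _ (by omega))]
      tauto
  · intro p q
    have h3 : μ p q ≠ 0 ↔ μ p q = 2 ∨ μ p q = 1 := by
      constructor
      · intro e
        obtain ⟨a, b, hab, h2, h1⟩ := h.two_ne_zero (hS _ _ (h.adj _ _ e))
        have := (hab q).1 e
        by_cases e' : a = b
        · subst e'
          rw [or_self] at this
          subst this
          exact Or.inl (h2 rfl)
        · rcases this with rfl | rfl
          exacts [Or.inr (h1 e').1, Or.inr (h1 e').2]
      · omega
    rw [h3]
    simp only [Bool.false_eq_true, iff_false, iff_true]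
    tauto
  · intro i p hp
    obtain ⟨a, b, hab, h2, h1⟩ := h.two_ne_zero hp
    by_cases e : a = b
    · subst e
      refine ⟨a, Or.inl (h2 rfl), fun q hq => ?_⟩
      have := (hab q).1 (by omega)
      tauto
    · obtain ⟨ha, hb⟩ := h1 e
      have hPP : P p a ↔ ¬P p b := by
        rw [← hP2 a p b (hsy _ _ ha) hb e, hP1 _ _ ha, not_not]
      have hq : ∀ q, (μ p q = 2 ∨ μ p q = 1 ∧ (P p q ↔ (col p ↔ i = true))) →
          (q = a ∨ q = b) ∧ (P p q ↔ (col p ↔ i = true)) := by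
        rintro q (e' | ⟨e', e''⟩)
        · rcases (hab q).1 (by omega) with rfl | rfl <;> omega
        · exact ⟨(hab q).1 (by omega), e''⟩
      by_cases hc : P p a ↔ (col p ↔ i = true)
      · refine ⟨a, Or.inr ⟨ha, hc⟩, fun q hq' => ?_⟩
        obtain ⟨rfl | rfl, h3⟩ := hq q hq'
        · rfl
        · tauto
      · refine ⟨b, Or.inr ⟨hb, by tauto⟩, fun q hq' => ?_⟩
        obtain ⟨rfl | rfl, h3⟩ := hq q hq'
        · tauto
        · rfl

end Abstract

/-! ### Double-dimer configurations on associated graphs -/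

theorem assocGraph_mem {U : SteppedSolid} {p q : Vertex} (h : (assocGraph U).Adj p q) :
    p ∈ vertices U := h.1

theorem IsDoubleDimer.exists_isMult {U : SteppedSolid} {m : SimpleGraph Vertex}
    (h : IsDoubleDimer U m) : ∃ μ, IsMult (assocGraph U) (vertices U) μ ∧ Supports m μ := by
  classical
  obtain ⟨M₁, M₂, ⟨h1, v1⟩, ⟨h2, v2⟩, rfl⟩ := h
  refine ⟨fun p q => (if M₁.Adj p q then 1 else 0) + (if M₂.Adj p q then 1 else 0),
    ⟨fun p q => by simp only [M₁.adj_comm p q, M₂.adj_comm p q], fun p q e => ?_,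
      fun p hp => ?_⟩, fun p q => ?_⟩
  · by_cases e1 : M₁.Adj p q
    · exact e1.adj_sub
    · by_cases e2 : M₂.Adj p q
      · exact e2.adj_sub
      · simp [e1, e2] at e
  · obtain ⟨a, ha, ha'⟩ := h1 (v1 ▸ hp)
    obtain ⟨b, hb, hb'⟩ := h2 (v2 ▸ hp)
    refine ⟨a, b, fun q => ?_⟩
    have e1 : M₁.Adj p q ↔ q = a := ⟨ha' q, fun e => e ▸ ha⟩
    have e2 : M₂.Adj p q ↔ q = b := ⟨hb' q, fun e => e ▸ hb⟩
    simp only [e1, e2, Set.indicator_apply, Set.mem_singleton_iff, Pi.one_apply]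
  · simp only [SimpleGraph.sup_adj, SimpleGraph.Subgraph.spanningCoe_adj]
    by_cases e1 : M₁.Adj p q <;> by_cases e2 : M₂.Adj p q <;> simp [e1, e2]

/-- The bipartition is what excludes odd loops, which are not unions of two matchings. -/
theorem isDoubleDimer_of_isMult {U : SteppedSolid} {m : SimpleGraph Vertex}
    (col : Vertex → Prop) (hcol : ∀ p q, (assocGraph U).Adj p q → (col q ↔ ¬col p))
    {μ : Vertex → Vertex → ℕ} (h : IsMult (assocGraph U) (vertices U) μ) (hm : Supports m μ) :
    IsDoubleDimer U m := by
  obtain ⟨M, hM1, hM2, hM3⟩ := h.exists_matchings (fun _ _ => assocGraph_mem) col hcol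
  have hM4 : ∀ i p q, M i p q → (assocGraph U).Adj p q := fun i p q e =>
    h.adj p q ((hM2 p q).2 (by cases i; exacts [Or.inr e, Or.inl e]))
  let N : Bool → (assocGraph U).Subgraph := fun i =>
    { verts := vertices U
      Adj := M i
      adj_sub := hM4 i _ _
      edge_vert := fun e => assocGraph_mem (hM4 i _ _ e)
      symm := ⟨fun p q e => hM1 i p q e⟩ }
  refine ⟨N true, N false, ⟨fun p hp => hM3 true p hp, rfl⟩, ⟨fun p hp => hM3 false p hp, rfl⟩, ?_⟩
  ext p q
  rw [hm, hM2]
  rfl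

end DoubleDimer

namespace DoubleDimer

/-! ### Boundary connections -/

/-- Two graphs agree off a finite set, and so do their infinite components. -/
def SameEnds (m m' : SimpleGraph Vertex) : Prop :=
  ∃ K : Set Vertex, K.Finite ∧ (∀ p q, p ∉ K → (m.Adj p q ↔ m'.Adj p q)) ∧
    ∃ φ : InfinitePath m ≃ InfinitePath m', ∀ C : InfinitePath m, C.1.supp \ K = (φ C).1.supp \ K

theorem isTaut_iff {U : SteppedSolid} {m : SimpleGraph Vertex} :
    IsTaut U m ↔ IsDoubleDimer U m ∧ SameEnds m initialConfig := Iff.rfl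

theorem SameEnds.symm {m m' : SimpleGraph Vertex} (h : SameEnds m m') : SameEnds m' m := by
  obtain ⟨K, hK, h1, φ, h2⟩ := h
  refine ⟨K, hK, fun p q hp => (h1 p q hp).symm, φ.symm, fun C => ?_⟩
  have := h2 (φ.symm C)
  rw [φ.apply_symm_apply] at this
  exact this.symm

theorem SameEnds.trans {m m' m'' : SimpleGraph Vertex} (h : SameEnds m m')
    (h' : SameEnds m' m'') : SameEnds m m'' := by
  obtain ⟨K, hK, h1, φ, h2⟩ := h
  obtain ⟨K', hK', h1', φ', h2'⟩ := h'
  refine ⟨K ∪ K', hK.union hK', fun p q hp => ?_, φ.trans φ', fun C => ?_⟩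
  · rw [Set.mem_union, not_or] at hp
    rw [h1 p q hp.1, h1' p q hp.2]
  · have e1 := h2 C
    have e2 := h2' (φ C)
    ext p
    have e1 := Set.ext_iff.1 e1 p
    have e2 := Set.ext_iff.1 e2 p
    simp only [Set.mem_sdiff, Set.mem_union, Equiv.trans_apply] at e1 e2 ⊢
    tauto

theorem SameEnds.refl (m : SimpleGraph Vertex) : SameEnds m m :=
  ⟨∅, Set.finite_empty, fun _ _ _ => Iff.rfl, Equiv.refl _, fun _ => rfl⟩

theorem component_eq_of_mem {m : SimpleGraph Vertex} {C C' : m.ConnectedComponent} {p : Vertex}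
    (h : p ∈ C.supp) (h' : p ∈ C'.supp) : C = C' := by
  rw [SimpleGraph.ConnectedComponent.mem_supp_iff] at h h'
  rw [← h, ← h']

/-- An infinite component keeps vertices outside the finite set `K` and is determined by any one of
them, so the equal traces outside `K` define the bijection. -/
theorem sameEnds_of_reachable_iff {m m' : SimpleGraph Vertex} {K : Set Vertex} (hK : K.Finite)
    (h : ∀ p q, p ∉ K → (m.Adj p q ↔ m'.Adj p q))
    (hr : ∀ p q, p ∉ K → q ∉ K → (m.Reachable p q ↔ m'.Reachable p q)) : SameEnds m m' := by
  have key : ∀ {m m' : SimpleGraph Vertex},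
      (∀ p q, p ∉ K → q ∉ K → (m.Reachable p q ↔ m'.Reachable p q)) →
      ∃ f : InfinitePath m → InfinitePath m', ∀ C, C.1.supp \ K = (f C).1.supp \ K := by
    intro m m' hr
    have : ∀ C : InfinitePath m, ∃ C' : InfinitePath m', C.1.supp \ K = C'.1.supp \ K := by
      intro C
      obtain ⟨p, hp, hpK⟩ := (C.2.sdiff hK).nonempty
      have e : C.1.supp \ K = (m'.connectedComponentMk p).supp \ K := by
        rw [SimpleGraph.ConnectedComponent.mem_supp_iff] at hp
        ext q
        simp only [Set.mem_sdiff, ← hp, SimpleGraph.ConnectedComponent.mem_supp_iff,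
          SimpleGraph.ConnectedComponent.eq]
        exact ⟨fun ⟨h1, h2⟩ => ⟨(hr q p h2 hpK).1 h1, h2⟩, fun ⟨h1, h2⟩ => ⟨(hr q p h2 hpK).2 h1, h2⟩⟩
      exact ⟨⟨m'.connectedComponentMk p, (e ▸ C.2.sdiff hK).mono Set.sdiff_subset⟩, e⟩
    choose f hf using this
    exact ⟨f, hf⟩
  have uniq : ∀ {m : SimpleGraph Vertex} (C C' : InfinitePath m),
      C.1.supp \ K = C'.1.supp \ K → C = C' := by
    intro m C C' e
    obtain ⟨p, hp⟩ := (C.2.sdiff hK).nonempty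
    exact Subtype.ext (component_eq_of_mem hp.1 (e ▸ hp : p ∈ C'.1.supp \ K).1)
  obtain ⟨f, hf⟩ := key hr
  obtain ⟨g, hg⟩ := key (fun p q hp hq => (hr p q hp hq).symm)
  exact ⟨K, hK, h, ⟨f, g, fun C => uniq _ _ (by rw [← hg, ← hf]),
    fun C => uniq _ _ (by rw [← hf, ← hg])⟩, hf⟩

theorem reachable_iff_eq_of_isolated {V : Type*} {m : SimpleGraph V} {p : V}
    (h : ∀ q, ¬m.Adj p q) (q : V) : m.Reachable p q ↔ p = q := by
  refine ⟨fun hr => ?_, fun e => e ▸ .refl _⟩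
  rw [SimpleGraph.reachable_iff_reflTransGen] at hr
  rcases hr.cases_head with e | ⟨r, h', _⟩
  · exact e
  · exact (h r h').elim

/-! ### Replacing a configuration in a finite region -/

/-- The leg state `used` at an inner vertex: the vertex is joined to the outside. -/
def UsedAt (m : SimpleGraph Vertex) (O : Set Vertex) (ι : LocVertex → Vertex) (u : LocVertex) :
    Prop := ∃ p ∈ O, m.Adj p (ι u)

/-- The graphs `m` and `m'` agree on the outside `O` and have the same connections inside, where
the inside is embedded by `ι` and `ι'`, respectively. -/
structure Glue (m m' : SimpleGraph Vertex) (O : Set Vertex) (ι ι' : LocVertex → Vertex) :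
    Prop where
  cover : ∀ p q, m.Adj p q → p ∈ O ∨ p ∈ Set.range ι
  cover' : ∀ p q, m'.Adj p q → p ∈ O ∨ p ∈ Set.range ι'
  notMem : ∀ u, ι u ∉ O
  notMem' : ∀ u, ι' u ∉ O
  inj : Function.Injective ι
  inj' : Function.Injective ι'
  out : ∀ p ∈ O, ∀ q ∈ O, (m.Adj p q ↔ m'.Adj p q)
  leg : ∀ p ∈ O, ∀ u, (m.Adj p (ι u) ↔ m'.Adj p (ι' u))
  conn : ∀ u v, UsedAt m O ι u → UsedAt m O ι v →
    ((m.comap ι).Reachable u v ↔ (m'.comap ι').Reachable u v)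

variable {m m' : SimpleGraph Vertex} {O : Set Vertex} {ι ι' : LocVertex → Vertex}

theorem Glue.usedAt_iff (h : Glue m m' O ι ι') (u : LocVertex) :
    UsedAt m O ι u ↔ UsedAt m' O ι' u :=
  exists_congr fun p => and_congr_right fun hp => h.leg p hp u

theorem Glue.symm (h : Glue m m' O ι ι') : Glue m' m O ι' ι :=
  ⟨h.cover', h.cover, h.notMem', h.notMem, h.inj', h.inj, fun p hp q hq => (h.out p hp q hq).symm,
    fun p hp u => (h.leg p hp u).symm, fun u v hu hv =>
      (h.conn u v ((h.usedAt_iff u).2 hu) ((h.usedAt_iff v).2 hv)).symm⟩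

theorem reachable_of_comap {u v : LocVertex} (h : (m.comap ι).Reachable u v) :
    m.Reachable (ι u) (ι v) :=
  h.map (SimpleGraph.Hom.comap ι m)

/-- A walk in `m` is copied to `m'` step by step. The second clause remembers the vertex `v` through
which the current visit to the inside began; when the walk leaves again, `conn` supplies the inner
part in `m'`. -/
theorem Glue.reachable_aux (h : Glue m m' O ι ι') {p x : Vertex} (hp : p ∈ O)
    (hx : m.Reachable p x) : (x ∈ O → m'.Reachable p x) ∧ ∀ u, x = ι u →
      ∃ v, UsedAt m O ι v ∧ m'.Reachable p (ι' v) ∧ (m.comap ι).Reachable v u := by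
  rw [SimpleGraph.reachable_iff_reflTransGen] at hx
  induction hx with
  | refl => exact ⟨fun _ => .refl _, fun u e => (h.notMem u (e ▸ hp)).elim⟩
  | @tail x y _ hxy ih =>
    rcases h.cover x y hxy with hx | ⟨u, rfl⟩
    · refine ⟨fun hy => (ih.1 hx).trans ((h.out x hx y hy).1 hxy).reachable, ?_⟩
      rintro u rfl
      exact ⟨u, ⟨x, hx, hxy⟩, (ih.1 hx).trans ((h.leg x hx u).1 hxy).reachable, .refl _⟩
    · obtain ⟨v, hv, h1, h2⟩ := ih.2 u rfl
      refine ⟨fun hy => ?_, ?_⟩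
      · have hu : UsedAt m O ι u := ⟨y, hy, hxy.symm⟩
        exact h1.trans ((reachable_of_comap ((h.conn v u hv hu).1 h2)).trans
          ((h.leg y hy u).1 hxy.symm).symm.reachable)
      · rintro w rfl
        exact ⟨v, hv, h1, h2.trans (SimpleGraph.Adj.reachable (G := m.comap ι) hxy)⟩

theorem Glue.reachable_iff (h : Glue m m' O ι ι') {p q : Vertex} (hp : p ∈ O) (hq : q ∈ O) :
    m.Reachable p q ↔ m'.Reachable p q :=
  ⟨fun e => (h.reachable_aux hp e).1 hq, fun e => (h.symm.reachable_aux hp e).1 hq⟩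

theorem Glue.sameEnds (h : Glue m m' O ι ι') (hT : {p | p ∈ O ∧ ∃ u, m.Adj p (ι u)}.Finite) :
    SameEnds m m' := by
  -- The outer ends of the legs belong to `K` too, since their inner neighbours differ in the two
  -- graphs.
  set K := (Set.range ι ∪ Set.range ι') ∪ {p | p ∈ O ∧ ∃ u, m.Adj p (ι u)} with hK
  have hKf : K.Finite := ((Set.finite_range _).union (Set.finite_range _)).union hT
  have hn : ∀ p, p ∉ K → p ∉ O → (∀ q, ¬m.Adj p q) ∧ ∀ q, ¬m'.Adj p q := by
    intro p hp hpO
    simp only [hK, Set.mem_union, not_or] at hp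
    exact ⟨fun q e => (h.cover p q e).elim hpO hp.1.1, fun q e => (h.cover' p q e).elim hpO hp.1.2⟩
  refine sameEnds_of_reachable_iff hKf (fun p q hp => ?_) (fun p q hp hq => ?_)
  · by_cases hpO : p ∈ O
    · have hp2 : ∀ u, ¬m.Adj p (ι u) := fun u e => hp (Or.inr ⟨hpO, u, e⟩)
      constructor
      · intro e
        rcases h.cover q p e.symm with hq | ⟨u, rfl⟩
        · exact (h.out p hpO q hq).1 e
        · exact (hp2 u e).elim
      · intro e
        rcases h.cover' q p e.symm with hq | ⟨u, rfl⟩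
        · exact (h.out p hpO q hq).2 e
        · exact (hp2 u ((h.leg p hpO u).2 e)).elim
    · have := hn p hp hpO
      exact ⟨fun e => (this.1 q e).elim, fun e => (this.2 q e).elim⟩
  · by_cases hpO : p ∈ O
    · by_cases hqO : q ∈ O
      · exact h.reachable_iff hpO hqO
      · have := hn q hq hqO
        rw [SimpleGraph.reachable_comm, reachable_iff_eq_of_isolated this.1,
          SimpleGraph.reachable_comm (G := m'), reachable_iff_eq_of_isolated this.2]
    · have := hn p hp hpO
      rw [reachable_iff_eq_of_isolated this.1, reachable_iff_eq_of_isolated this.2]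

/-! ### Counting loops -/

theorem exists_adj_of_one_lt_ncard {V : Type*} {m : SimpleGraph V} {C : m.ConnectedComponent}
    (hC : 1 < C.supp.ncard) {p : V} (hp : p ∈ C.supp) : ∃ q, m.Adj p q := by
  by_contra! h
  have : C.supp ⊆ {p} := by
    intro q hq
    rw [SimpleGraph.ConnectedComponent.mem_supp_iff] at hp hq
    have := SimpleGraph.ConnectedComponent.exact (hp.trans hq.symm)
    rw [reachable_iff_eq_of_isolated h] at this
    exact this.symm
  have := Set.ncard_le_ncard this
  simp at this
  omega

/-- A finite component of a double-dimer configuration is a loop if and only if a given vertex of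
it has two neighbours. -/
theorem IsMult.two_lt_ncard_iff {V : Type*} {m : SimpleGraph V} {G : SimpleGraph V} {S : Set V}
    {μ : V → V → ℕ}
    (h : IsMult G S μ) (hS : ∀ p q, G.Adj p q → p ∈ S) (hm : Supports m μ)
    {C : m.ConnectedComponent} (hf : C.supp.Finite) {p : V} (hp : p ∈ C.supp) (hpS : p ∈ S) :
    2 < C.supp.ncard ↔ ∃ a b, a ≠ b ∧ m.Adj p a ∧ m.Adj p b := by
  have hadj : ∀ {q r}, q ∈ C.supp → m.Adj q r → r ∈ C.supp := fun hq e =>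
    (SimpleGraph.ConnectedComponent.mem_supp_congr_adj C e).1 hq
  constructor
  · intro hC
    obtain ⟨a, b, hab, h2, h1⟩ := h.two_ne_zero hpS
    refine ⟨a, b, fun e => ?_, (hm _ _).2 ((hab a).2 (Or.inl rfl)),
      (hm _ _).2 ((hab b).2 (Or.inr rfl))⟩
    subst e
    have hpa := h2 rfl
    have haS : a ∈ S := hS a p (h.adj _ _ (by rw [h.symm, hpa]; omega))
    have hap : ∀ q, m.Adj a q → q = p := by
      intro q hq
      obtain ⟨c, d, hcd, h4, h3⟩ := h.two_ne_zero haS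
      have e1 : p = c ∨ p = d := (hcd p).1 (by rw [h.symm, hpa]; omega)
      have e2 := (hcd q).1 ((hm _ _).1 hq)
      have : c = d := by
        by_contra e
        have := h3 e
        rw [h.symm] at hpa
        rcases e1 with rfl | rfl <;> omega
      subst this
      rw [or_self] at e1 e2
      rw [e1, e2]
    have hsub : C.supp ⊆ {p, a} := by
      intro q hq
      rw [SimpleGraph.ConnectedComponent.mem_supp_iff] at hp hq
      have hr := SimpleGraph.ConnectedComponent.exact (hp.trans hq.symm)
      rw [SimpleGraph.reachable_iff_reflTransGen] at hr
      clear hq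
      induction hr with
      | refl => simp
      | tail _ hxy ih =>
        rcases ih with rfl | rfl
        · right; simpa using (hab _).1 ((hm _ _).1 hxy)
        · left; exact hap _ hxy
    have := Set.ncard_le_ncard hsub
    have := Set.ncard_insert_le p {a}
    simp only [Set.ncard_singleton] at this
    omega
  · rintro ⟨a, b, hab, ha, hb⟩
    rw [Set.two_lt_ncard_iff hf]
    exact ⟨p, a, b, hp, hadj hp ha, hadj hp hb, ha.ne, hb.ne, hab⟩

/-- The loops that meet `O`. -/
def outerLoops (m : SimpleGraph Vertex) (O : Set Vertex) : Set m.ConnectedComponent :=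
  {C | C ∈ loops m ∧ ∃ p ∈ O, p ∈ C.supp}

/-- Components are matched through their common vertices in `O`. The number of their vertices may
change inside, so whether a finite component is a loop is tested by two distinct neighbours of one
vertex in `O`. -/
theorem Glue.exists_bijOn_outerLoops (h : Glue m m' O ι ι')
    {G G' : SimpleGraph Vertex} {S S' : Set Vertex} {μ μ' : Vertex → Vertex → ℕ}
    (hμ : IsMult G S μ) (hμ' : IsMult G' S' μ') (hS : ∀ p q, G.Adj p q → p ∈ S)
    (hS' : ∀ p q, G'.Adj p q → p ∈ S') (hm : Supports m μ) (hm' : Supports m' μ')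
    (hO : O ⊆ S) (hO' : O ⊆ S') :
    ∃ f, Set.BijOn f (outerLoops m O) (outerLoops m' O) := by
  classical
  have two : ∀ {m m' : SimpleGraph Vertex} {ι ι' : LocVertex → Vertex} (h : Glue m m' O ι ι')
      (p), p ∈ O → (∃ a b, a ≠ b ∧ m.Adj p a ∧ m.Adj p b) →
        ∃ a b, a ≠ b ∧ m'.Adj p a ∧ m'.Adj p b := by
    rintro m m' ι ι' h p hp ⟨a, b, hab, ha, hb⟩
    rcases h.cover a p ha.symm with haO | ⟨u, rfl⟩ <;>
      rcases h.cover b p hb.symm with hbO | ⟨v, rfl⟩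
    · exact ⟨a, b, hab, (h.out _ hp _ haO).1 ha, (h.out _ hp _ hbO).1 hb⟩
    · exact ⟨a, ι' v, fun e => h.notMem' v (e ▸ haO), (h.out _ hp _ haO).1 ha, (h.leg _ hp _).1 hb⟩
    · exact ⟨ι' u, b, fun e => h.notMem' u (e ▸ hbO), (h.leg _ hp _).1 ha, (h.out _ hp _ hbO).1 hb⟩
    · exact ⟨ι' u, ι' v, fun e => hab (congrArg ι (h.inj' e)), (h.leg _ hp _).1 ha,
        (h.leg _ hp _).1 hb⟩
  have fin : ∀ {m m' : SimpleGraph Vertex} {ι ι' : LocVertex → Vertex} (h : Glue m m' O ι ι')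
      (p), p ∈ O → (m.connectedComponentMk p).supp.Finite →
        (m'.connectedComponentMk p).supp.Finite := by
    intro m m' ι ι' h p hp hf
    refine (hf.union (Set.finite_range ι')).subset fun q hq => ?_
    rw [SimpleGraph.ConnectedComponent.mem_supp_iff, SimpleGraph.ConnectedComponent.eq] at hq
    by_cases hqp : q = p
    · subst hqp; exact Or.inl rfl
    · have : q ∈ O ∨ q ∈ Set.range ι' := by
        by_contra! hc
        have hiso : ∀ r, ¬m'.Adj q r := fun r e => (h.cover' q r e).elim hc.1 hc.2
        exact hqp ((reachable_iff_eq_of_isolated hiso p).1 hq)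
      rcases this with hqO | hq'
      · left
        rw [SimpleGraph.ConnectedComponent.mem_supp_iff, SimpleGraph.ConnectedComponent.eq]
        exact (h.reachable_iff hqO hp).2 hq
      · exact Or.inr hq'
  let f : m.ConnectedComponent → m'.ConnectedComponent := fun C =>
    if hC : ∃ p ∈ O, p ∈ C.supp then m'.connectedComponentMk hC.choose
    else m'.connectedComponentMk C.nonempty_supp.choose
  have hf : ∀ p ∈ O, f (m.connectedComponentMk p) = m'.connectedComponentMk p := by
    intro p hp
    have hC : ∃ q ∈ O, q ∈ (m.connectedComponentMk p).supp := ⟨p, hp, rfl⟩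
    have h1 := hC.choose_spec
    simp only [f, dif_pos hC]
    rw [SimpleGraph.ConnectedComponent.mem_supp_iff, SimpleGraph.ConnectedComponent.eq] at h1
    rw [SimpleGraph.ConnectedComponent.eq]
    exact (h.reachable_iff h1.1 hp).1 h1.2
  have form : ∀ {m : SimpleGraph Vertex} {C : m.ConnectedComponent} {p}, p ∈ C.supp →
    C = m.connectedComponentMk p := fun hp => hp.symm
  have key : ∀ p ∈ O, (m.connectedComponentMk p ∈ outerLoops m O ↔
      m'.connectedComponentMk p ∈ outerLoops m' O) := by
    intro p hp
    constructor
    · rintro ⟨⟨h1, h2⟩, -⟩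
      have h1' := fin h p hp h1
      refine ⟨⟨h1', ?_⟩, p, hp, rfl⟩
      rw [hμ.two_lt_ncard_iff hS hm h1 rfl (hO hp)] at h2
      rw [hμ'.two_lt_ncard_iff hS' hm' h1' rfl (hO' hp)]
      exact two h p hp h2
    · rintro ⟨⟨h1, h2⟩, -⟩
      have h1' := fin h.symm p hp h1
      refine ⟨⟨h1', ?_⟩, p, hp, rfl⟩
      rw [hμ'.two_lt_ncard_iff hS' hm' h1 rfl (hO' hp)] at h2
      rw [hμ.two_lt_ncard_iff hS hm h1' rfl (hO hp)]
      exact two h.symm p hp h2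
  refine ⟨f, ?_, ?_, ?_⟩
  · intro C hC
    obtain ⟨p, hp, hpC⟩ := hC.2
    rw [form hpC] at hC ⊢
    rw [hf p hp]
    exact (key p hp).1 hC
  · intro C hC D hD e
    obtain ⟨p, hp, hpC⟩ := hC.2
    obtain ⟨q, hq, hqD⟩ := hD.2
    rw [form hpC, form hqD] at e ⊢
    rw [hf p hp, hf q hq, SimpleGraph.ConnectedComponent.eq] at e
    rw [SimpleGraph.ConnectedComponent.eq]
    exact (h.reachable_iff hp hq).2 e
  · intro C hC
    obtain ⟨p, hp, hpC⟩ := hC.2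
    refine ⟨m.connectedComponentMk p, (key p hp).2 (form hpC ▸ hC), ?_⟩
    rw [hf p hp, ← form hpC]

/-- The loops of a local configuration that do not reach the boundary. -/
def localLoops (κ : SimpleGraph LocVertex) (used : LocVertex → Prop) :
    Set κ.ConnectedComponent :=
  {C | (∀ u ∈ C.supp, ¬used u) ∧ 2 < C.supp.ncard}

/-- An inner component without a used boundary leg cannot be left, so it is a full component of `m`.
-/
theorem supp_map_comap (hcov : ∀ p q, m.Adj p q → p ∈ O ∨ p ∈ Set.range ι)
    (C : (m.comap ι).ConnectedComponent) (hC : ∀ u ∈ C.supp, ¬UsedAt m O ι u) :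
    (C.map (SimpleGraph.Hom.comap ι m)).supp = ι '' C.supp := by
  induction C using SimpleGraph.ConnectedComponent.ind with
  | _ u =>
    ext x
    rw [SimpleGraph.ConnectedComponent.map_mk, SimpleGraph.ConnectedComponent.mem_supp_iff,
      SimpleGraph.ConnectedComponent.eq, SimpleGraph.reachable_comm]
    constructor
    · intro hx
      rw [SimpleGraph.reachable_iff_reflTransGen] at hx
      induction hx with
      | refl => exact ⟨u, rfl, rfl⟩
      | @tail x y _ hxy ih =>
        obtain ⟨v, hv, rfl⟩ := ih
        rcases hcov y _ hxy.symm with hy | ⟨w, rfl⟩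
        · exact (hC v hv ⟨y, hy, hxy.symm⟩).elim
        · exact ⟨w, (SimpleGraph.ConnectedComponent.mem_supp_congr_adj _
            (show (m.comap ι).Adj v w from hxy)).1 hv, rfl⟩
    · rintro ⟨v, hv, rfl⟩
      rw [SimpleGraph.ConnectedComponent.mem_supp_iff, SimpleGraph.ConnectedComponent.eq] at hv
      exact reachable_of_comap hv.symm

theorem bijOn_localLoops (hcov : ∀ p q, m.Adj p q → p ∈ O ∨ p ∈ Set.range ι)
    (hO : ∀ u, ι u ∉ O) (hinj : Function.Injective ι) :
    Set.BijOn (fun C => C.map (SimpleGraph.Hom.comap ι m))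
      (localLoops (m.comap ι) (UsedAt m O ι)) (loops m \ outerLoops m O) := by
  refine ⟨?_, ?_, ?_⟩
  · rintro C ⟨h1, h2⟩
    have e := supp_map_comap hcov C h1
    refine ⟨⟨?_, ?_⟩, ?_⟩
    · rw [e]; exact (Set.toFinite _).image _
    · rwa [e, Set.ncard_image_of_injective _ hinj]
    · rintro ⟨-, p, hp, hpC⟩
      rw [e] at hpC
      obtain ⟨u, -, rfl⟩ := hpC
      exact hO u hp
  · rintro C ⟨h1, -⟩ D ⟨h2, -⟩ e
    have e : (C.map (SimpleGraph.Hom.comap ι m)).supp =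
      (D.map (SimpleGraph.Hom.comap ι m)).supp := congrArg _ e
    rw [supp_map_comap hcov C h1, supp_map_comap hcov D h2] at e
    exact SimpleGraph.ConnectedComponent.supp_injective (Set.image_injective.2 hinj e)
  · rintro C ⟨⟨h1, h2⟩, h3⟩
    have hno : ∀ p ∈ C.supp, p ∉ O := fun p hp hpO => h3 ⟨⟨h1, h2⟩, p, hpO, hp⟩
    obtain ⟨p, hp⟩ := C.nonempty_supp
    obtain ⟨q, hpq⟩ := exists_adj_of_one_lt_ncard (by omega) hp
    obtain ⟨u, rfl⟩ := (hcov p q hpq).resolve_left (hno p hp)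
    have e : ((m.comap ι).connectedComponentMk u).map (SimpleGraph.Hom.comap ι m) = C := hp
    have h4 : ∀ v ∈ ((m.comap ι).connectedComponentMk u).supp, ¬UsedAt m O ι v := by
      rintro v hv ⟨r, hr, hrv⟩
      refine hno r ?_ hr
      rw [SimpleGraph.ConnectedComponent.mem_supp_iff, SimpleGraph.ConnectedComponent.eq] at hv
      rw [← e, SimpleGraph.ConnectedComponent.mem_supp_iff, SimpleGraph.ConnectedComponent.map_mk,
        SimpleGraph.ConnectedComponent.eq]
      exact hrv.reachable.trans (reachable_of_comap hv)
    refine ⟨(m.comap ι).connectedComponentMk u, ⟨h4, ?_⟩, e⟩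
    have := supp_map_comap hcov _ h4
    rw [e] at this
    rwa [this, Set.ncard_image_of_injective _ hinj] at h2

theorem ncard_loops (hcov : ∀ p q, m.Adj p q → p ∈ O ∨ p ∈ Set.range ι)
    (hO : ∀ u, ι u ∉ O) (hinj : Function.Injective ι) (hf : (outerLoops m O).Finite) :
    (loops m).Finite ∧ (loops m).ncard =
      (outerLoops m O).ncard + (localLoops (m.comap ι) (UsedAt m O ι)).ncard := by
  have hb := bijOn_localLoops (O := O) hcov hO hinj
  have h1 : (loops m \ outerLoops m O).Finite := hb.finite_iff_finite.1 (Set.toFinite _)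
  have h2 : outerLoops m O ⊆ loops m := fun C hC => hC.1
  have h3 : (loops m).Finite := (h1.union hf).subset fun C hC => by
    by_cases h : C ∈ outerLoops m O
    exacts [Or.inr h, Or.inl ⟨hC, h⟩]
  refine ⟨h3, ?_⟩
  rw [← Set.ncard_sdiff_add_ncard_of_subset h2 h3, ← hb.image_eq, Set.InjOn.ncard_image hb.injOn,
    add_comm]

/-- The number of loops computed from labels. -/
theorem ncard_localLoops {δ : Fin 3} (hδ : δ ≠ 0) (s : LegState) (p : Param) :
    (localLoops (locGraph δ (xOf δ s p) (yOf p)) (· ∈ usedHexes s)).ncard =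
      innerLoops s (locLabels δ s p) := by
  have hl : (locLabels δ s p).length = 12 := length_mergeEdges _ _
  have hr := reachable_iff_labelAt hδ s p
  set κ := locGraph δ (xOf δ s p) (yOf p)
  set l := locLabels δ s p
  have hlt : ∀ u, labelAt l u < 12 := fun u => by
    refine labelAt_mergeEdges_lt (locEdges δ (xOf δ s p) (yOf p)) initLabels (by decide) rfl _ ?_
    have : labelAt l u ∈ locVertices.map (labelAt l) := List.mem_map_of_mem (mem_locVertices u)
    rwa [map_labelAt hl] at this
  let f : κ.ConnectedComponent → ℕ := fun C => C.lift (labelAt l) fun u v w _ =>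
    (hr u v).1 w.reachable
  have hfm : ∀ u, f (κ.connectedComponentMk u) = labelAt l u := fun u => rfl
  have hsupp : ∀ u, (κ.connectedComponentMk u).supp = {v | labelAt l v = labelAt l u} := by
    intro u
    ext v
    rw [SimpleGraph.ConnectedComponent.mem_supp_iff, SimpleGraph.ConnectedComponent.eq, hr]
    rfl
  have hcard : ∀ a, {v | labelAt l v = a}.ncard =
      (Finset.univ.filter fun u => labelAt l u = a).card := fun a => by
    rw [← Set.ncard_coe_finset]
    congr 1
    ext v
    simp
  have hb : Set.BijOn f (localLoops κ (· ∈ usedHexes s)) ((Finset.range 12).filter fun a =>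
      2 < (Finset.univ.filter fun u => labelAt l u = a).card ∧
        ∀ u ∈ usedHexes s, labelAt l u ≠ a : Finset ℕ) := by
    have key : ∀ u, κ.connectedComponentMk u ∈ localLoops κ (· ∈ usedHexes s) ↔
        (2 < (Finset.univ.filter fun v => labelAt l v = labelAt l u).card ∧
        ∀ v ∈ usedHexes s, labelAt l v ≠ labelAt l u) := by
      intro u
      change _ ∧ _ ↔ _
      rw [hsupp, hcard, and_comm]
      exact and_congr_right fun _ => ⟨fun h v hv e => h v e hv, fun h v e hv => h v hv e⟩
    refine ⟨fun C hC => ?_, fun C hC D hD e => ?_, fun a ha => ?_⟩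
    · induction C using SimpleGraph.ConnectedComponent.ind with
      | _ u =>
        rw [hfm, Finset.mem_coe, Finset.mem_filter]
        exact ⟨Finset.mem_range.2 (hlt u), (key u).1 hC⟩
    · induction C using SimpleGraph.ConnectedComponent.ind with
      | _ u =>
        induction D using SimpleGraph.ConnectedComponent.ind with
        | _ v => exact SimpleGraph.ConnectedComponent.sound ((hr u v).2 e)
    · rw [Finset.mem_coe, Finset.mem_filter] at ha
      obtain ⟨u, hu⟩ := Finset.card_pos.1 (lt_trans two_pos ha.2.1)
      obtain rfl := (Finset.mem_filter.1 hu).2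
      exact ⟨κ.connectedComponentMk u, (key u).2 ha.2, rfl⟩
  rw [innerLoops_eq s hl, ← Set.ncard_coe_finset, ← hb.image_eq, Set.InjOn.ncard_image hb.injOn]

end DoubleDimer

namespace DoubleDimer

/-! ### Regions of three squares inside a graph -/

/-- A double-dimer configuration, with doubled edges recognized by `mult`. -/
def IsConfig (G : SimpleGraph Vertex) (S : Set Vertex) (m : SimpleGraph Vertex) : Prop :=
  IsMult G S (mult m) ∧ Supports m (mult m)

theorem IsMult.isConfig {G : SimpleGraph Vertex} {S : Set Vertex} {μ : Vertex → Vertex → ℕ}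
    (h : IsMult G S μ) (hS : ∀ p q, G.Adj p q → p ∈ S) {m : SimpleGraph Vertex}
    (hm : Supports m μ) : IsConfig G S m := by
  rw [IsConfig, h.mult_eq hS hm]; exact ⟨h, hm⟩

/-- A region of three squares in the graph `G` on `S`: the inner vertices are given by `ι`, the
other vertices form `O`, and `t j a` is the outer end of the leg at `ι (j, a, true)`. -/
structure Site (G : SimpleGraph Vertex) (S O : Set Vertex) (δ : Fin 3) (ι : LocVertex → Vertex)
    (t : Fin 3 → Bool → Vertex) : Prop where
  ne_zero : δ ≠ 0
  inj : Function.Injective ι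
  notMem : ∀ u, ι u ∉ O
  cover : S = O ∪ Set.range ι
  mem : ∀ j a, t j a ∈ O
  adj_mem : ∀ p q, G.Adj p q → p ∈ S
  adj_true : ∀ j b q, G.Adj (ι (j, true, b)) q ↔ (∃ b', q = ι (j + δ, false, b')) ∨
    (b = false ∧ q = ι (j, false, false)) ∨ (b = true ∧ q = t j true)
  adj_false : ∀ j b q, G.Adj (ι (j, false, b)) q ↔ (∃ b', q = ι (j - δ, true, b')) ∨
    (b = false ∧ q = ι (j, true, false)) ∨ (b = true ∧ q = t j false)

/-- Multiplicities of the legs that leave a region. -/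
noncomputable def legState (ι : LocVertex → Vertex) (t : Fin 3 → Bool → Vertex)
    (m : SimpleGraph Vertex) : LegState :=
  fun j a => mult m (ι (j, a, true)) (t j a)

/-- Multiplicities of the quadrilateral edges in a region. -/
noncomputable def quadState (δ : Fin 3) (ι : LocVertex → Vertex)
    (m : SimpleGraph Vertex) (j : Fin 3) (b b' : Bool) : ℕ :=
  mult m (ι (j, true, b)) (ι (j + δ, false, b'))

/-- Multiplicities of the inner legs of a region. -/
noncomputable def innerState (ι : LocVertex → Vertex) (m : SimpleGraph Vertex) (j : Fin 3) : ℕ :=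
  mult m (ι (j, true, false)) (ι (j, false, false))

noncomputable def paramAt (δ : Fin 3) (ι : LocVertex → Vertex) (m : SimpleGraph Vertex) : Param :=
  paramOf (quadState δ ι m) (innerState ι m)

/-- The connection pattern of a configuration in a region. -/
noncomputable def patternAt (δ : Fin 3) (ι : LocVertex → Vertex) (t : Fin 3 → Bool → Vertex)
    (m : SimpleGraph Vertex) : List ℕ :=
  pattern (legState ι t m) (locLabels δ (legState ι t m) (paramAt δ ι m))

section Sum
variable {V : Type*}

/-- Every inner vertex of a region has three neighbours; this turns the condition `IsMult.two` there
into one of the equations in `LocalEqs`. -/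
theorem sum_three_eq_two_iff {f : V → ℕ} {a b c : V} (hab : a ≠ b) (hac : a ≠ c) (hbc : b ≠ c)
    (h : ∀ q, f q ≠ 0 → q = a ∨ q = b ∨ q = c) :
    (∃ x y, ∀ q, f q = Set.indicator {x} 1 q + Set.indicator {y} 1 q) ↔ f a + f b + f c = 2 := by
  constructor
  · rintro ⟨x, y, hxy⟩
    have hx := h x (by rw [hxy]; simp)
    have hy := h y (by rw [hxy]; simp)
    rw [hxy a, hxy b, hxy c]
    rcases hx with rfl | rfl | rfl <;> rcases hy with rfl | rfl | rfl <;>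
      simp [hab, hac, hbc, hab.symm, hac.symm, hbc.symm]
  · intro hs
    have main : ∀ x y, f a = Set.indicator {x} 1 a + Set.indicator {y} 1 a →
        f b = Set.indicator {x} 1 b + Set.indicator {y} 1 b →
        f c = Set.indicator {x} 1 c + Set.indicator {y} 1 c →
        (x = a ∨ x = b ∨ x = c) → (y = a ∨ y = b ∨ y = c) →
        ∃ x y, ∀ q, f q = Set.indicator {x} 1 q + Set.indicator {y} 1 q := by
      intro x y h1 h2 h3 hx hy
      refine ⟨x, y, fun q => ?_⟩
      by_cases hq : q = a ∨ q = b ∨ q = c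
      · rcases hq with rfl | rfl | rfl <;> assumption
      · have h0 : f q = 0 := by
          by_contra h0; exact hq (h q h0)
        have hqx : q ∉ ({x} : Set V) := by rintro rfl; exact hq hx
        have hqy : q ∉ ({y} : Set V) := by rintro rfl; exact hq hy
        rw [h0, Set.indicator_of_notMem hqx, Set.indicator_of_notMem hqy, add_zero]
    have hc : (f a = 2 ∧ f b = 0 ∧ f c = 0) ∨ (f a = 0 ∧ f b = 2 ∧ f c = 0) ∨
        (f a = 0 ∧ f b = 0 ∧ f c = 2) ∨ (f a = 1 ∧ f b = 1 ∧ f c = 0) ∨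
        (f a = 1 ∧ f b = 0 ∧ f c = 1) ∨ (f a = 0 ∧ f b = 1 ∧ f c = 1) := by omega
    rcases hc with ⟨h1, h2, h3⟩ | ⟨h1, h2, h3⟩ | ⟨h1, h2, h3⟩ | ⟨h1, h2, h3⟩ | ⟨h1, h2, h3⟩ |
      ⟨h1, h2, h3⟩
    · apply main a a <;> simp [hab.symm, hac.symm, h1, h2, h3]
    · apply main b b <;> simp [hab, hbc.symm, h1, h2, h3]
    · apply main c c <;> simp [hac, hbc, h1, h2, h3]
    · apply main a b <;> simp [hab, hac, hbc, hab.symm, hac.symm, hbc.symm, h1, h2, h3]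
    · apply main a c <;> simp [hab, hac, hbc, hab.symm, hac.symm, hbc.symm, h1, h2, h3]
    · apply main b c <;> simp [hab, hac, hbc, hab.symm, hac.symm, hbc.symm, h1, h2, h3]

end Sum

variable {G G' : SimpleGraph Vertex} {S S' O : Set Vertex} {δ δ' : Fin 3}
  {ι ι' : LocVertex → Vertex} {t : Fin 3 → Bool → Vertex} {m m' : SimpleGraph Vertex}

theorem IsConfig.adj_iff (h : IsConfig G S m) (p q : Vertex) : m.Adj p q ↔ mult m p q ≠ 0 := h.2 p q

theorem IsConfig.mult_eq_zero (h : IsConfig G S m) {p q : Vertex} (hpq : ¬G.Adj p q) :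
    mult m p q = 0 := by
  by_contra h0; exact hpq (h.1.adj p q h0)

theorem IsConfig.ext (h : IsConfig G S m) (h' : IsConfig G' S' m') (e : mult m = mult m') :
    m = m' := h.2.ext (e ▸ h'.2)

theorem Site.mem_S (h : Site G S O δ ι t) (u : LocVertex) : ι u ∈ S := by
  rw [h.cover]; exact Or.inr ⟨u, rfl⟩

theorem Site.subset (h : Site G S O δ ι t) : O ⊆ S := by
  rw [h.cover]; exact Set.subset_union_left

theorem Site.ne_t (h : Site G S O δ ι t) (u : LocVertex) (j : Fin 3) (a : Bool) : ι u ≠ t j a :=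
  fun e => h.notMem u (e ▸ h.mem j a)

theorem Site.vertex_true (h : Site G S O δ ι t) {f : Vertex → ℕ} (j : Fin 3) (b : Bool)
    (hf : ∀ q, f q ≠ 0 → G.Adj (ι (j, true, b)) q) :
    (∃ x y, ∀ q, f q = Set.indicator {x} 1 q + Set.indicator {y} 1 q) ↔
      f (ι (j + δ, false, false)) + f (ι (j + δ, false, true)) +
        f (if b then t j true else ι (j, false, false)) = 2 := by
  have h0 : j + δ ≠ j := fun e => h.ne_zero (by simpa using e)
  refine sum_three_eq_two_iff (fun e => by simpa using h.inj e) ?_ ?_ fun q hq => ?_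
  · split_ifs
    · exact h.ne_t _ _ _
    · intro e; simpa [h0] using h.inj e
  · split_ifs
    · exact h.ne_t _ _ _
    · intro e; simpa [h0] using h.inj e
  · rcases (h.adj_true j b q).1 (hf q hq) with ⟨b', rfl⟩ | ⟨rfl, rfl⟩ | ⟨rfl, rfl⟩
    · cases b' <;> simp
    · simp
    · simp

theorem Site.vertex_false (h : Site G S O δ ι t) {f : Vertex → ℕ} (j : Fin 3) (b : Bool)
    (hf : ∀ q, f q ≠ 0 → G.Adj (ι (j, false, b)) q) :
    (∃ x y, ∀ q, f q = Set.indicator {x} 1 q + Set.indicator {y} 1 q) ↔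
      f (ι (j - δ, true, false)) + f (ι (j - δ, true, true)) +
        f (if b then t j false else ι (j, true, false)) = 2 := by
  have h0 : j - δ ≠ j := fun e => h.ne_zero (by simpa using e)
  refine sum_three_eq_two_iff (fun e => by simpa using h.inj e) ?_ ?_ fun q hq => ?_
  · split_ifs
    · exact h.ne_t _ _ _
    · intro e; simpa [h0] using h.inj e
  · split_ifs
    · exact h.ne_t _ _ _
    · intro e; simpa [h0] using h.inj e
  · rcases (h.adj_false j b q).1 (hf q hq) with ⟨b', rfl⟩ | ⟨rfl, rfl⟩ | ⟨rfl, rfl⟩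
    · cases b' <;> simp
    · simp
    · simp

theorem Site.localEqs (h : Site G S O δ ι t) (hm : IsConfig G S m) :
    LocalEqs δ (legState ι t m) (quadState δ ι m) (innerState ι m) := by
  have ht : ∀ j b, _ := fun j b =>
    (h.vertex_true j b (fun q => hm.1.adj _ q)).1 (hm.1.two _ (h.mem_S _))
  have hf : ∀ j b, _ := fun j b =>
    (h.vertex_false j b (fun q => hm.1.adj _ q)).1 (hm.1.two _ (h.mem_S _))
  intro j
  have h1 := ht j false
  have h2 := ht j true
  have h3 := hf (j + δ) false
  have h4 := hf (j + δ) true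
  simp only [add_sub_cancel_right, Bool.false_eq_true, if_false, if_true] at h1 h2 h3 h4
  rw [hm.1.symm (ι (j + δ, false, false)), hm.1.symm (ι (j + δ, false, false)),
    hm.1.symm (ι (j + δ, false, false))] at h3
  rw [hm.1.symm (ι (j + δ, false, true)), hm.1.symm (ι (j + δ, false, true))] at h4
  simp only [legState, quadState, innerState]
  omega

theorem Site.mult_eq (h : Site G S O δ ι t) (hm : IsConfig G S m) (u v : LocVertex) :
    mult m (ι u) (ι v) = locMult δ (quadState δ ι m) (innerState ι m) u v := by
  have key : ∀ j b k b', mult m (ι (j, true, b)) (ι (k, false, b')) =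
      locMult δ (quadState δ ι m) (innerState ι m) (j, true, b) (k, false, b') := by
    intro j b k b'
    simp only [locMult]
    split_ifs with h1 h2
    · subst h1; rfl
    · obtain ⟨rfl, rfl, rfl⟩ := h2; rfl
    · refine hm.mult_eq_zero fun e => ?_
      rcases (h.adj_true _ _ _).1 e with ⟨b'', e⟩ | ⟨e', e⟩ | ⟨_, e⟩
      · have := h.inj e
        simp only [Prod.mk.injEq] at this
        exact h1 this.1
      · have := h.inj e
        simp only [Prod.mk.injEq] at this
        exact h2 ⟨this.1, e', this.2.2⟩
      · exact h.ne_t _ _ _ e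
  obtain ⟨j, _ | _, b⟩ := u <;> obtain ⟨k, _ | _, b'⟩ := v
  · refine hm.mult_eq_zero fun e => ?_
    rcases (h.adj_false _ _ _).1 e with ⟨b'', e⟩ | ⟨e', e⟩ | ⟨_, e⟩
    · simpa using h.inj e
    · simpa using h.inj e
    · exact h.ne_t _ _ _ e
  · rw [hm.1.symm, locMult_comm, key]
  · exact key j b k b'
  · refine hm.mult_eq_zero fun e => ?_
    rcases (h.adj_true _ _ _).1 e with ⟨b'', e⟩ | ⟨e', e⟩ | ⟨_, e⟩
    · simpa using h.inj e
    · simpa using h.inj e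
    · exact h.ne_t _ _ _ e

theorem Site.comap_eq (h : Site G S O δ ι t) (hm : IsConfig G S m) :
    m.comap ι = locGraph δ (quadState δ ι m) (innerState ι m) := by
  ext u v
  rw [SimpleGraph.comap_adj, hm.adj_iff, h.mult_eq hm]
  rfl

theorem Site.comap_eq' (h : Site G S O δ ι t) (hm : IsConfig G S m) :
    m.comap ι = locGraph δ (xOf δ (legState ι t m) (paramAt δ ι m)) (yOf (paramAt δ ι m)) := by
  rw [h.comap_eq hm, paramAt, xOf_paramOf (h.localEqs hm), yOf_paramOf]

theorem Site.paramAt_mem (h : Site G S O δ ι t) (hm : IsConfig G S m) :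
    paramAt δ ι m ∈ cands δ (legState ι t m) := by
  rw [mem_cands h.ne_zero, paramAt, xOf_paramOf (h.localEqs hm), yOf_paramOf]
  exact h.localEqs hm

theorem Site.adj_out (h : Site G S O δ ι t) {p : Vertex} (hp : p ∈ O) (u : LocVertex) :
    G.Adj p (ι u) ↔ u.2.2 = true ∧ p = t u.1 u.2.1 := by
  have hn : ∀ v, p ≠ ι v := fun v e => h.notMem v (e ▸ hp)
  rw [G.adj_comm]
  obtain ⟨j, _ | _, b⟩ := u
  · rw [h.adj_false]; simp [hn]
  · rw [h.adj_true]; simp [hn]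

theorem Site.usedAt_iff (h : Site G S O δ ι t) (hm : IsConfig G S m) (u : LocVertex) :
    UsedAt m O ι u ↔ u ∈ usedHexes (legState ι t m) := by
  rw [mem_usedHexes, legState]
  constructor
  · rintro ⟨p, hp, e⟩
    rw [hm.adj_iff] at e
    obtain ⟨h1, rfl⟩ := (h.adj_out hp u).1 (hm.1.adj _ _ e)
    refine ⟨h1, ?_⟩
    rw [hm.1.symm, ← h1]
    exact e
  · rintro ⟨h1, h2⟩
    refine ⟨t u.1 u.2.1, h.mem _ _, ?_⟩
    rw [hm.adj_iff, hm.1.symm]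
    rwa [← h1] at h2

theorem Site.adj_cover (h : Site G S O δ ι t) (hm : IsConfig G S m) (p q : Vertex)
    (e : m.Adj p q) : p ∈ O ∨ p ∈ Set.range ι := by
  have := h.adj_mem _ _ (hm.1.adj _ _ ((hm.adj_iff p q).1 e))
  rwa [h.cover] at this

theorem Site.mult_le_two (h : Site G S O δ ι t) (hm : IsConfig G S m) (j : Fin 3) (a : Bool) :
    legState ι t m j a ≤ 2 := by
  have h1 := h.localEqs hm j
  have h2 := h.localEqs hm (j - δ)
  rw [sub_add_cancel] at h2
  cases a <;> omega

/-- Two regions with the same outside. -/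
structure SitePair (G G' : SimpleGraph Vertex) (S S' O : Set Vertex) (δ δ' : Fin 3)
    (ι ι' : LocVertex → Vertex) (t : Fin 3 → Bool → Vertex) : Prop where
  site : Site G S O δ ι t
  site' : Site G' S' O δ' ι' t
  neg : δ' = -δ
  disj : ∀ u, ι u ∉ S'
  disj' : ∀ u, ι' u ∉ S
  out : ∀ p ∈ O, ∀ q ∈ O, (G.Adj p q ↔ G'.Adj p q)

theorem SitePair.symm (h : SitePair G G' S S' O δ δ' ι ι' t) :
    SitePair G' G S' S O δ' δ ι' ι t :=
  ⟨h.site', h.site, by rw [h.neg, neg_neg], h.disj', h.disj, fun p hp q hq => (h.out p hp q hq).symm⟩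

/-- Two configurations with the same edges outside of the region. -/
def SameOutside (O : Set Vertex) (ι ι' : LocVertex → Vertex) (t : Fin 3 → Bool → Vertex)
    (m m' : SimpleGraph Vertex) : Prop :=
  (∀ p ∈ O, ∀ q ∈ O, mult m p q = mult m' p q) ∧ legState ι t m = legState ι' t m'

theorem SameOutside.symm (h : SameOutside O ι ι' t m m') : SameOutside O ι' ι t m' m :=
  ⟨fun p hp q hq => (h.1 p hp q hq).symm, h.2.symm⟩

theorem SameOutside.trans {ι'' : LocVertex → Vertex} {m'' : SimpleGraph Vertex}
    (h : SameOutside O ι ι' t m m') (h' : SameOutside O ι' ι'' t m' m'') :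
    SameOutside O ι ι'' t m m'' :=
  ⟨fun p hp q hq => (h.1 p hp q hq).trans (h'.1 p hp q hq), h.2.trans h'.2⟩

/-- Outside edges and legs agree by hypothesis, and the vertex equations recover the remaining inner
multiplicities from the six numbers in the parameter. -/
theorem Site.eq_of_sameOutside (h : Site G S O δ ι t) (hm : IsConfig G S m)
    (hm' : IsConfig G S m') (h1 : SameOutside O ι ι t m m')
    (h2 : paramAt δ ι m = paramAt δ ι m') : m = m' := by
  refine hm.ext hm' ?_
  have hx : quadState δ ι m = quadState δ ι m' := by
    rw [← xOf_paramOf (h.localEqs hm), ← xOf_paramOf (h.localEqs hm'), h1.2]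
    exact congrArg _ h2
  have hy : innerState ι m = innerState ι m' := by
    rw [← yOf_paramOf (quadState δ ι m) (innerState ι m),
      ← yOf_paramOf (quadState δ ι m') (innerState ι m')]
    exact congrArg _ h2
  have hleg : ∀ p ∈ O, ∀ u, mult m p (ι u) = mult m' p (ι u) := by
    intro p hp u
    by_cases e : G.Adj p (ι u)
    · obtain ⟨h3, rfl⟩ := (h.adj_out hp u).1 e
      have := congrFun (congrFun h1.2 u.1) u.2.1
      simp only [legState] at this
      rw [hm.1.symm, hm'.1.symm]
      rw [← h3] at this
      exact this
    · rw [hm.mult_eq_zero e, hm'.mult_eq_zero e]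
  funext p q
  by_cases e : G.Adj p q
  · have hp := h.adj_mem _ _ e
    have hq := h.adj_mem _ _ e.symm
    rw [h.cover] at hp hq
    rcases hp with hp | ⟨u, rfl⟩ <;> rcases hq with hq | ⟨v, rfl⟩
    · exact h1.1 p hp q hq
    · exact hleg p hp v
    · rw [hm.1.symm, hm'.1.symm]; exact hleg q hq u
    · rw [h.mult_eq hm, h.mult_eq hm', hx, hy]
  · rw [hm.mult_eq_zero e, hm'.mult_eq_zero e]

end DoubleDimer

namespace DoubleDimer

variable {G G' : SimpleGraph Vertex} {S S' O : Set Vertex} {δ δ' : Fin 3}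
  {ι ι' : LocVertex → Vertex} {t : Fin 3 → Bool → Vertex} {m m' : SimpleGraph Vertex}

/-! ### Replacing the configuration inside a region -/

/-- A permutation that exchanges the images of two embeddings. -/
theorem exists_exchange (hι : Function.Injective ι) (hι' : Function.Injective ι')
    (hd : ∀ u v, ι u ≠ ι' v) : ∃ τ : Equiv.Perm Vertex, (∀ u, τ (ι u) = ι' u) ∧
      (∀ u, τ (ι' u) = ι u) ∧ (∀ p, p ∉ Set.range ι → p ∉ Set.range ι' → τ p = p) ∧
      ∀ p, τ (τ p) = p := by
  let f : Vertex → Vertex := Function.extend ι ι' (Function.extend ι' ι id)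
  have h1 : ∀ u, f (ι u) = ι' u := fun u => hι.extend_apply _ _ _
  have h2 : ∀ u, f (ι' u) = ι u := fun u => by
    simp only [f]
    rw [Function.extend_apply' _ _ _ (fun ⟨v, hv⟩ => hd v u hv), hι'.extend_apply]
  have h3 : ∀ p, p ∉ Set.range ι → p ∉ Set.range ι' → f p = p := fun p hp hp' => by
    simp only [f]
    rw [Function.extend_apply' _ _ _ hp, Function.extend_apply' _ _ _ hp', id]
  have h4 : ∀ p, f (f p) = p := fun p => by
    by_cases hp : p ∈ Set.range ι
    · obtain ⟨u, rfl⟩ := hp; rw [h1, h2]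
    · by_cases hp' : p ∈ Set.range ι'
      · obtain ⟨u, rfl⟩ := hp'; rw [h2, h1]
      · rw [h3 p hp hp', h3 p hp hp']
  exact ⟨Function.Involutive.toPerm f h4, h1, h2, h3, h4⟩

open Classical in
/-- The multiplicities outside of the region can be combined with any local configuration with the
same leg state. -/
theorem SitePair.exists_replace (h : SitePair G G' S S' O δ δ' ι ι' t) (hm : IsConfig G S m)
    {x : Fin 3 → Bool → Bool → ℕ} {y : Fin 3 → ℕ} (hxy : LocalEqs δ' (legState ι t m) x y) :
    ∃ m', IsConfig G' S' m' ∧ SameOutside O ι ι' t m m' ∧ paramAt δ' ι' m' = paramOf x y := by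
  have hd : ∀ u v, ι u ≠ ι' v := fun u v e => h.disj u (e ▸ h.site'.mem_S v)
  obtain ⟨τ, hτ1, hτ2, hτ3, hτ4⟩ := exists_exchange h.site.inj h.site'.inj hd
  have hτO : ∀ p ∈ O, τ p = p := fun p hp => hτ3 p
    (fun ⟨u, e⟩ => h.site.notMem u (e ▸ hp)) (fun ⟨u, e⟩ => h.site'.notMem u (e ▸ hp))
  have hOn : ∀ p ∈ O, p ∉ Set.range ι' := fun p hp ⟨u, e⟩ => h.site'.notMem u (e ▸ hp)
  have hτS : ∀ p, τ p ∈ S → p ∈ O ∨ p ∈ Set.range ι' := by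
    intro p hp
    rw [h.site.cover] at hp
    rcases hp with hp | ⟨u, hu⟩
    · have := hτO _ hp
      rw [hτ4] at this
      exact Or.inl (this ▸ hp)
    · refine Or.inr ⟨u, ?_⟩
      rw [← hτ1, hu, hτ4]
  let r : Vertex → LocVertex := Function.invFun ι'
  have hr : ∀ u, r (ι' u) = u := Function.leftInverse_invFun h.site'.inj
  -- Inside, the prescribed local multiplicities are used. Everything else is pulled back along the
  -- exchange `τ`, which carries the legs of one region to those of the other and fixes the outside.
  let μ : Vertex → Vertex → ℕ := fun p q =>
    if p ∈ Set.range ι' ∧ q ∈ Set.range ι' then locMult δ' x y (r p) (r q)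
    else mult m (τ p) (τ q)
  have hμin : ∀ u v, μ (ι' u) (ι' v) = locMult δ' x y u v := fun u v => by
    simp only [μ]
    rw [if_pos ⟨⟨u, rfl⟩, ⟨v, rfl⟩⟩, hr, hr]
  have hμl : ∀ p q, p ∉ Set.range ι' → μ p q = mult m (τ p) (τ q) := fun p q hp => by
    simp only [μ]
    rw [if_neg (fun e => hp e.1)]
  have hμsymm : ∀ p q, μ p q = μ q p := by
    intro p q
    simp only [μ]
    by_cases e : p ∈ Set.range ι' ∧ q ∈ Set.range ι'
    · rw [if_pos e, if_pos e.symm, locMult_comm]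
    · rw [if_neg e, if_neg (fun e' => e e'.symm), hm.1.symm]
  have hleg : ∀ p ∈ O, ∀ u, mult m p (ι u) ≠ 0 → G'.Adj p (ι' u) := by
    intro p hp u e
    exact (h.site'.adj_out hp u).2 ((h.site.adj_out hp u).1 (hm.1.adj _ _ e))
  have hadj : ∀ p q, μ p q ≠ 0 → G'.Adj p q := by
    intro p q e
    by_cases e' : p ∈ Set.range ι' ∧ q ∈ Set.range ι'
    · obtain ⟨⟨u, rfl⟩, v, rfl⟩ := e'
      rw [hμin] at e
      have key : ∀ j b k b', locMult δ' x y (j, true, b) (k, false, b') ≠ 0 →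
          G'.Adj (ι' (j, true, b)) (ι' (k, false, b')) := by
        intro j b k b' e
        rw [h.site'.adj_true]
        simp only [locMult] at e
        split_ifs at e with h1 h2
        · subst h1; exact Or.inl ⟨b', rfl⟩
        · obtain ⟨rfl, rfl, rfl⟩ := h2; exact Or.inr (Or.inl ⟨rfl, rfl⟩)
        · exact (e rfl).elim
      obtain ⟨j, _ | _, b⟩ := u <;> obtain ⟨k, _ | _, b'⟩ := v
      · exact (e rfl).elim
      · rw [locMult_comm] at e; exact (key _ _ _ _ e).symm
      · exact key _ _ _ _ e
      · exact (e rfl).elim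
    · have e2 : mult m (τ p) (τ q) ≠ 0 := by simpa only [μ, if_neg e'] using e
      have e3 := hm.1.adj _ _ e2
      rcases hτS p (h.site.adj_mem _ _ e3) with hp | ⟨u, rfl⟩ <;>
        rcases hτS q (h.site.adj_mem _ _ e3.symm) with hq | ⟨v, rfl⟩
      · rw [hτO p hp, hτO q hq] at e3; exact (h.out p hp q hq).1 e3
      · rw [hτO p hp, hτ2] at e2; exact hleg p hp v e2
      · rw [hτO q hq, hτ2, hm.1.symm] at e2; exact (hleg q hq u e2).symm
      · exact (e' ⟨⟨u, rfl⟩, ⟨v, rfl⟩⟩).elim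
  have hμt : ∀ j a, μ (ι' (j, a, true)) (t j a) = legState ι t m j a := fun j a => by
    rw [hμsymm, hμl _ _ (hOn _ (h.site'.mem _ _)), hτO _ (h.site'.mem _ _), hτ2, hm.1.symm]
    rfl
  have hquad : ∀ j b b', μ (ι' (j, true, b)) (ι' (j + δ', false, b')) = x j b b' := fun j b b' => by
    rw [hμin, locMult, if_pos rfl]
  have hinner : ∀ j, μ (ι' (j, true, false)) (ι' (j, false, false)) = y j := fun j => by
    rw [hμin, locMult, if_neg (fun e => h.site'.ne_zero (by simpa using e)), if_pos ⟨rfl, rfl, rfl⟩]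
  have hμ : IsMult G' S' μ := by
    refine ⟨hμsymm, hadj, fun p hp => ?_⟩
    rw [h.site'.cover] at hp
    rcases hp with hp | ⟨⟨j, a, b⟩, rfl⟩
    · obtain ⟨c, d, hcd⟩ := hm.1.two p (h.site.subset hp)
      refine ⟨τ c, τ d, fun q => ?_⟩
      rw [hμl p q (hOn p hp), hτO p hp, hcd]
      have e : ∀ c, (τ q = c) = (q = τ c) := fun c =>
        propext ⟨fun e => by rw [← e, hτ4], fun e => by rw [e, hτ4]⟩
      simp only [Set.indicator_apply, Set.mem_singleton_iff, e, Pi.one_apply]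
    · cases a
      · rw [h.site'.vertex_false j b (fun q => hadj _ q)]
        have h0 := hxy (j - δ')
        have h1 : ∀ c, μ (ι' (j, false, b)) (ι' (j - δ', true, c)) = x (j - δ') c b := fun c => by
          rw [hμsymm]
          have := hquad (j - δ') c b
          rwa [sub_add_cancel] at this
        rw [sub_add_cancel] at h0
        rw [h1, h1]
        cases b
        · rw [if_neg Bool.false_ne_true, hμsymm, hinner]; omega
        · rw [if_pos rfl, hμt]; omega
      · rw [h.site'.vertex_true j b (fun q => hadj _ q), hquad, hquad]
        have h0 := hxy j
        cases b
        · rw [if_neg Bool.false_ne_true, hinner]; omega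
        · rw [if_pos rfl, hμt]; omega
  have hsup := supports_graphOf hμ
  have hme := hμ.mult_eq h.site'.adj_mem hsup
  refine ⟨graphOf hμ, hμ.isConfig h.site'.adj_mem hsup, ⟨fun p hp q hq => ?_, ?_⟩, ?_⟩
  · rw [hme, hμl p q (hOn p hp), hτO p hp, hτO q hq]
  · funext j a
    rw [legState, legState, hme, hμt]; rfl
  · have h1 : quadState δ' ι' (graphOf hμ) = x := by
      funext j b b'; rw [quadState, hme, hquad]
    have h2 : innerState ι' (graphOf hμ) = y := by
      funext j; rw [innerState, hme, hinner]
    rw [paramAt, h1, h2]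

/-- Two configurations that differ only inside the region and have the same connections there. -/
def Related (O : Set Vertex) (δ δ' : Fin 3) (ι ι' : LocVertex → Vertex)
    (t : Fin 3 → Bool → Vertex) (m m' : SimpleGraph Vertex) : Prop :=
  SameOutside O ι ι' t m m' ∧ patternAt δ ι t m = patternAt δ' ι' t m'

theorem Related.symm (h : Related O δ δ' ι ι' t m m') : Related O δ' δ ι' ι t m' m :=
  ⟨h.1.symm, h.2.symm⟩

theorem SitePair.glue (h : SitePair G G' S S' O δ δ' ι ι' t) (hm : IsConfig G S m)
    (hm' : IsConfig G' S' m') (hr : Related O δ δ' ι ι' t m m') : Glue m m' O ι ι' := by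
  refine ⟨h.site.adj_cover hm, h.site'.adj_cover hm', h.site.notMem, h.site'.notMem, h.site.inj,
    h.site'.inj, fun p hp q hq => ?_, fun p hp u => ?_, fun u v hu hv => ?_⟩
  · rw [hm.adj_iff, hm'.adj_iff, hr.1.1 p hp q hq]
  · by_cases e : u.2.2 = true ∧ p = t u.1 u.2.1
    · obtain ⟨h1, rfl⟩ := e
      have := congrFun (congrFun hr.1.2 u.1) u.2.1
      simp only [legState] at this
      rw [← h1] at this
      change mult m (ι u) _ = mult m' (ι' u) _ at this
      rw [hm.adj_iff, hm'.adj_iff, hm.1.symm, hm'.1.symm, this]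
    · constructor
      · intro e'
        exact (e ((h.site.adj_out hp u).1 (hm.1.adj _ _ ((hm.adj_iff _ _).1 e')))).elim
      · intro e'
        exact (e ((h.site'.adj_out hp u).1 (hm'.1.adj _ _ ((hm'.adj_iff _ _).1 e')))).elim
  · rw [h.site.usedAt_iff hm] at hu hv
    rw [h.site.comap_eq' hm, h.site'.comap_eq' hm', reachable_iff_labelAt h.site.ne_zero,
      reachable_iff_labelAt h.site'.ne_zero]
    have := hr.2
    simp only [patternAt, ← hr.1.2] at this
    have := (pattern_eq_iff _ _ _).1 this u hu v hv
    rw [← hr.1.2]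
    exact this

theorem Site.finite_adj (h : Site G S O δ ι t) (hm : IsConfig G S m) :
    {p | p ∈ O ∧ ∃ u, m.Adj p (ι u)}.Finite := by
  refine (Set.finite_range fun u : LocVertex => t u.1 u.2.1).subset ?_
  rintro p ⟨hp, u, e⟩
  exact ⟨u, ((h.adj_out hp u).1 (hm.1.adj _ _ ((hm.adj_iff _ _).1 e))).2.symm⟩

theorem Site.ncard_localLoops (h : Site G S O δ ι t) (hm : IsConfig G S m) :
    (localLoops (m.comap ι) (UsedAt m O ι)).ncard =
      innerLoops (legState ι t m) (locLabels δ (legState ι t m) (paramAt δ ι m)) := by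
  rw [← DoubleDimer.ncard_localLoops h.ne_zero, h.comap_eq' hm]
  congr 2
  ext u
  exact h.usedAt_iff hm u

end DoubleDimer

namespace DoubleDimer

variable {G G' : SimpleGraph Vertex} {S S' O : Set Vertex} {δ δ' : Fin 3}
  {ι ι' : LocVertex → Vertex} {t : Fin 3 → Bool → Vertex} {m m' m₀ : SimpleGraph Vertex}

/-! ### Invariance of the weighted sum -/

theorem SitePair.exists_related (h : SitePair G G' S S' O δ δ' ι ι' t) (hm : IsConfig G S m)
    (he : SameEnds m m₀) {p : Param} (hp : p ∈ cands δ' (legState ι t m))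
    (hk : pattern (legState ι t m) (locLabels δ' (legState ι t m) p) = patternAt δ ι t m) :
    ∃ m', IsConfig G' S' m' ∧ SameEnds m' m₀ ∧ Related O δ δ' ι ι' t m m' ∧
      paramAt δ' ι' m' = p := by
  obtain ⟨m', hm', hs, hp'⟩ := h.exists_replace hm ((mem_cands h.site'.ne_zero).1 hp)
  rw [paramOf_xOf] at hp'
  have hr : Related O δ δ' ι ι' t m m' := ⟨hs, by rw [← hk, patternAt, hp', hs.2]⟩
  exact ⟨m', hm', ((h.glue hm hm' hr).sameEnds (h.site.finite_adj hm)).symm.trans he, hr, hp'⟩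

/-- The part of the weight of a configuration that comes from the region. -/
noncomputable def innerWeight (heavy : Prop) [Decidable heavy] (δ : Fin 3)
    (ι : LocVertex → Vertex) (t : Fin 3 → Bool → Vertex) (m : SimpleGraph Vertex) : ℝ :=
  2 ^ innerLoops (legState ι t m) (locLabels δ (legState ι t m) (paramAt δ ι m)) *
    regionWeight heavy (quadState δ ι m)

-- With the outside fixed, related configurations correspond bijectively to local parameters with
-- the given pattern, so the sum no longer depends on the global graph. All of them have the
-- required ends because gluing preserves ends.
open Classical in
theorem SitePair.sum_related (h : SitePair G G' S S' O δ δ' ι ι' t) (hm : IsConfig G S m)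
    (he : SameEnds m m₀) (heavy : Prop)
    (hfin : {m' | IsConfig G' S' m' ∧ SameEnds m' m₀}.Finite) :
    ∑ m' ∈ hfin.toFinset with Related O δ δ' ι ι' t m m', innerWeight heavy δ' ι' t m' =
      regionSum heavy δ' (legState ι t m) (patternAt δ ι t m) := by
  rw [regionSum]
  refine Finset.sum_bij (fun m' _ => paramAt δ' ι' m') ?_ ?_ ?_ ?_
  · intro m' hm'
    simp only [Finset.mem_filter, Set.Finite.mem_toFinset, Set.mem_ofPred_eq] at hm'
    obtain ⟨⟨h1, -⟩, h2⟩ := hm'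
    simp only [Finset.mem_filter, List.mem_toFinset]
    rw [h2.1.2, h2.2]
    exact ⟨h.site'.paramAt_mem h1, rfl⟩
  · intro m1 hm1 m2 hm2 e
    simp only [Finset.mem_filter, Set.Finite.mem_toFinset, Set.mem_ofPred_eq] at hm1 hm2
    exact h.site'.eq_of_sameOutside hm1.1.1 hm2.1.1 (hm1.2.1.symm.trans hm2.2.1) e
  · intro p hp
    simp only [Finset.mem_filter, List.mem_toFinset] at hp
    obtain ⟨m', h1, h2, h3, h4⟩ := h.exists_related hm he hp.1 hp.2
    refine ⟨m', ?_, h4⟩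
    simp only [Finset.mem_filter, Set.Finite.mem_toFinset, Set.mem_ofPred_eq]
    exact ⟨⟨h1, h2⟩, h3⟩
  · intro m' hm'
    simp only [Finset.mem_filter, Set.Finite.mem_toFinset, Set.mem_ofPred_eq] at hm'
    obtain ⟨⟨h1, -⟩, h2⟩ := hm'
    rw [innerWeight, h2.1.2, paramAt, xOf_paramOf (h.site'.localEqs h1)]

-- Distribute the term of `a` over its partners `b` in proportion to `v' b`; the total of these is
-- `z a`. After exchanging the sums, the terms at `b` add up to `A' b * v' b`, because `A` and `z`
-- agree on related elements.
open Classical in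
theorem sum_transfer {α β : Type*} (T : Finset α) (T' : Finset β) (R : α → β → Prop)
    (A v : α → ℝ) (A' v' : β → ℝ) (z : α → ℝ) (z' : β → ℝ) (hz : ∀ a ∈ T, z a ≠ 0)
    (h1 : ∀ a ∈ T, ∑ b ∈ T' with R a b, v' b = z a)
    (h2 : ∀ b ∈ T', ∑ a ∈ T with R a b, v a = z' b)
    (h3 : ∀ a ∈ T, ∀ b ∈ T', R a b → A a = A' b ∧ z a = z' b)
    (h4 : ∀ b ∈ T', ∃ a ∈ T, R a b) :
    ∑ a ∈ T, A a * v a = ∑ b ∈ T', A' b * v' b := by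
  calc ∑ a ∈ T, A a * v a = ∑ a ∈ T, ∑ b ∈ T' with R a b, A a * v a / z a * v' b := by
        refine Finset.sum_congr rfl fun a ha => ?_
        rw [← Finset.mul_sum, h1 a ha, div_mul_cancel₀ _ (hz a ha)]
    _ = ∑ b ∈ T', ∑ a ∈ T with R a b, A a * v a / z a * v' b := by
        refine Finset.sum_comm' fun a b => ?_
        simp only [Finset.mem_filter]
        tauto
    _ = ∑ b ∈ T', ∑ a ∈ T with R a b, A' b * v' b / z' b * v a := by
        refine Finset.sum_congr rfl fun b hb => Finset.sum_congr rfl fun a ha => ?_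
        rw [Finset.mem_filter] at ha
        obtain ⟨e1, e2⟩ := h3 a ha.1 b hb ha.2
        rw [e1, e2]
        ring
    _ = ∑ b ∈ T', A' b * v' b := by
        refine Finset.sum_congr rfl fun b hb => ?_
        obtain ⟨a, ha, hab⟩ := h4 b hb
        rw [← Finset.mul_sum, h2 b hb, div_mul_cancel₀ _ ((h3 a ha b hb hab).2 ▸ hz a ha)]

/-- A pattern that occurs in a region also occurs in the reversed region. -/
theorem SitePair.exists_param (h : SitePair G G' S S' O δ δ' ι ι' t) (hm : IsConfig G S m) :
    ∃ p ∈ cands δ' (legState ι t m),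
      pattern (legState ι t m) (locLabels δ' (legState ι t m) p) = patternAt δ ι t m := by
  -- All weights are positive, so a pattern occurs exactly when its sum is nonzero, and
  -- `regionSum_eq` transports this to the reversed region.
  have h1 : 0 < regionSum True δ (legState ι t m) (patternAt δ ι t m) :=
    Finset.sum_pos (fun p _ => mul_pos (by positivity) (regionWeight_pos _ _))
      ⟨paramAt δ ι m, by
        rw [Finset.mem_filter, List.mem_toFinset]; exact ⟨h.site.paramAt_mem hm, rfl⟩⟩
  rw [regionSum_eq h.site.ne_zero (h.site.mult_le_two hm) _ (heavy' := False) (by simp),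
    ← h.neg] at h1
  obtain ⟨p, hp⟩ := Finset.nonempty_of_sum_ne_zero h1.ne'
  rw [Finset.mem_filter, List.mem_toFinset] at hp
  exact ⟨p, hp⟩

open Classical in
/-- The weighted count of double-dimer configurations with given ends is invariant under reversing
a region. -/
theorem SitePair.transfer (h : SitePair G G' S S' O δ δ' ι ι' t) {heavy heavy' : Prop}
    (hh : heavy' ↔ ¬heavy) (w : SimpleGraph Vertex → ℝ)
    (hw : ∀ m m', (∀ p ∈ O, ∀ q ∈ O, mult m p q = mult m' p q) → w m = w m')
    (hfin : {m' | IsConfig G' S' m' ∧ SameEnds m' m₀}.Finite)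
    (hl : ∀ m', IsConfig G' S' m' → SameEnds m' m₀ → (loops m').Finite) :
    ∃ hfin' : {m | IsConfig G S m ∧ SameEnds m m₀}.Finite,
      (∀ m, IsConfig G S m → SameEnds m m₀ → (loops m).Finite) ∧
      ∑ m ∈ hfin'.toFinset,
        (2 : ℝ) ^ (loops m).ncard * (w m * regionWeight heavy (quadState δ ι m)) =
      ∑ m ∈ hfin.toFinset,
        (2 : ℝ) ^ (loops m).ncard * (w m * regionWeight heavy' (quadState δ' ι' m)) := by
  have hex : ∀ m, IsConfig G S m → SameEnds m m₀ → ∃ m', IsConfig G' S' m' ∧ SameEnds m' m₀ ∧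
      Related O δ δ' ι ι' t m m' := fun m hm he => by
    obtain ⟨p, hp, hk⟩ := h.exists_param hm
    obtain ⟨m', h1, h2, h3, -⟩ := h.exists_related hm he hp hk
    exact ⟨m', h1, h2, h3⟩
  have hex' : ∀ m', IsConfig G' S' m' → SameEnds m' m₀ → ∃ m, IsConfig G S m ∧ SameEnds m m₀ ∧
      Related O δ δ' ι ι' t m m' := fun m' hm he => by
    obtain ⟨p, hp, hk⟩ := h.symm.exists_param hm
    obtain ⟨m, h1, h2, h3, -⟩ := h.symm.exists_related hm he hp hk
    exact ⟨m, h1, h2, h3.symm⟩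
  -- A configuration is determined by a related one, taken from a finite set, and by one of finitely
  -- many local parameters.
  have hfin' : {m | IsConfig G S m ∧ SameEnds m m₀}.Finite := by
    refine (hfin.biUnion fun m' _ => (List.finite_toSet (cands δ (legState ι' t m'))).biUnion
      (t := fun p => {m | IsConfig G S m ∧ Related O δ δ' ι ι' t m m' ∧ paramAt δ ι m = p})
      fun p _ => Set.Subsingleton.finite ?_).subset ?_
    · rintro m1 ⟨h1, h2, h3⟩ m2 ⟨h1', h2', h3'⟩
      exact h.site.eq_of_sameOutside h1 h1' (h2.1.trans h2'.1.symm) (h3.trans h3'.symm)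
    · rintro m ⟨hm, he⟩
      obtain ⟨m', h1, h2, h3⟩ := hex m hm he
      simp only [Set.mem_iUnion]
      exact ⟨m', ⟨h1, h2⟩, paramAt δ ι m, h3.1.2 ▸ h.site.paramAt_mem hm, hm, h3, rfl⟩
  have hbij : ∀ m m', IsConfig G S m → IsConfig G' S' m' → Related O δ δ' ι ι' t m m' →
      ∃ f, Set.BijOn f (outerLoops m O) (outerLoops m' O) := fun m m' hm hm' hr =>
    (h.glue hm hm' hr).exists_bijOn_outerLoops hm.1 hm'.1 h.site.adj_mem h.site'.adj_mem hm.2 hm'.2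
      h.site.subset h.site'.subset
  have hof' : ∀ m', IsConfig G' S' m' → SameEnds m' m₀ → (outerLoops m' O).Finite :=
    fun m' hm he => (hl m' hm he).subset fun C hC => hC.1
  have hof : ∀ m, IsConfig G S m → SameEnds m m₀ → (outerLoops m O).Finite := fun m hm he => by
    obtain ⟨m', h1, h2, h3⟩ := hex m hm he
    obtain ⟨f, hf⟩ := hbij m m' hm h1 h3
    exact hf.finite_iff_finite.2 (hof' m' h1 h2)
  have hn : ∀ m, IsConfig G S m → SameEnds m m₀ → _ := fun m hm he =>
    ncard_loops (h.site.adj_cover hm) h.site.notMem h.site.inj (hof m hm he)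
  have hn' : ∀ m, IsConfig G' S' m → SameEnds m m₀ → _ := fun m hm he =>
    ncard_loops (h.site'.adj_cover hm) h.site'.notMem h.site'.inj (hof' m hm he)
  refine ⟨hfin', fun m hm he => (hn m hm he).1, ?_⟩
  have e1 : ∀ m ∈ hfin'.toFinset,
      (2 : ℝ) ^ (loops m).ncard * (w m * regionWeight heavy (quadState δ ι m)) =
        2 ^ (outerLoops m O).ncard * w m * innerWeight heavy δ ι t m := fun m hm => by
    rw [Set.Finite.mem_toFinset] at hm
    rw [(hn m hm.1 hm.2).2, h.site.ncard_localLoops hm.1, pow_add, innerWeight]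
    ring
  have e2 : ∀ m ∈ hfin.toFinset,
      (2 : ℝ) ^ (loops m).ncard * (w m * regionWeight heavy' (quadState δ' ι' m)) =
        2 ^ (outerLoops m O).ncard * w m * innerWeight heavy' δ' ι' t m := fun m hm => by
    rw [Set.Finite.mem_toFinset] at hm
    rw [(hn' m hm.1 hm.2).2, h.site'.ncard_localLoops hm.1, pow_add, innerWeight]
    ring
  rw [Finset.sum_congr rfl e1, Finset.sum_congr rfl e2]
  -- The outer loops and the outer weight form the factor that related configurations share; inner
  -- loops and region weights form the factor that is resummed.
  refine sum_transfer _ _ (Related O δ δ' ι ι' t) _ _ _ _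
    (fun m => regionSum heavy' δ' (legState ι t m) (patternAt δ ι t m))
    (fun m => regionSum heavy δ (legState ι' t m) (patternAt δ' ι' t m)) ?_ ?_ ?_ ?_ ?_
  · intro m hm
    rw [Set.Finite.mem_toFinset] at hm
    obtain ⟨p, hp, hk⟩ := h.exists_param hm.1
    exact (Finset.sum_pos (fun p _ => mul_pos (by positivity) (regionWeight_pos _ _))
      ⟨p, by rw [Finset.mem_filter, List.mem_toFinset]; exact ⟨hp, hk⟩⟩).ne'
  · intro m hm
    rw [Set.Finite.mem_toFinset] at hm
    exact h.sum_related hm.1 hm.2 heavy' hfin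
  · intro m hm
    rw [Set.Finite.mem_toFinset] at hm
    rw [← h.symm.sum_related hm.1 hm.2 heavy hfin']
    refine Finset.sum_congr (Finset.filter_congr fun m _ => ?_) fun _ _ => rfl
    exact ⟨fun h => h.symm, fun h => h.symm⟩
  · intro m hm m' hm' hr
    rw [Set.Finite.mem_toFinset] at hm hm'
    obtain ⟨f, hf⟩ := hbij m m' hm.1 hm'.1 hr
    refine ⟨?_, ?_⟩
    · rw [hw m m' hr.1.1, ← hf.image_eq, Set.InjOn.ncard_image hf.injOn]
    · rw [← hr.1.2, ← hr.2, h.neg, ← regionSum_eq h.site.ne_zero (h.site.mult_le_two hm.1) _ hh]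
  · intro m hm
    rw [Set.Finite.mem_toFinset] at hm
    obtain ⟨m', h1, h2, h3⟩ := hex' m hm.1 hm.2
    exact ⟨m', by rw [Set.Finite.mem_toFinset]; exact ⟨h1, h2⟩, h3⟩

end DoubleDimer

namespace DoubleDimer

/-! ### The surface of a stepped solid -/

/-- Unit vectors. -/
abbrev unit (i : Fin 3) : Pt := Pi.single i 1

theorem unit_injective : Function.Injective unit := by
  intro i j h
  by_contra hij
  have := congrFun h i
  simp [hij] at this

theorem sum_add_unit (c : Pt) (i : Fin 3) : ∑ k, (c + unit i) k = ∑ k, c k + 1 := by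
  simp [Finset.sum_add_distrib]

theorem le_add_unit (c : Pt) (i : Fin 3) : c ≤ c + unit i := by
  rw [le_add_iff_nonneg_right]
  intro k
  by_cases h : k = i
  · subst h; simp
  · simp [h]

theorem notMem_add_unit {U : SteppedSolid} {c : Pt} (h : c ∉ U) (i : Fin 3) : c + unit i ∉ U :=
  fun h' => h (U.lower (le_add_unit c i) h')

theorem adj_iff {U : SteppedSolid} {p q : Vertex} : (assocGraph U).Adj p q ↔
    p ∈ vertices U ∧ q ∈ vertices U ∧
      ((p.1 = q.1 ∧ p.2.dir ≠ q.2.dir) ∨ (p.1 ≠ q.1 ∧ p.2 = q.2)) := Iff.rfl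

/-- A bipartition of the vertices of an associated graph. -/
def vertexColor (p : Vertex) : Prop := (Odd (∑ k, p.1.base k) ↔ p.2.dir = p.1.normal + 1)

/-- Consecutive sides of a square have different directions, exactly one of which is `normal + 1`.
Across a leg, coplanar squares have base sums of different parity; squares that meet at a fold have
equal base sums, but the common direction is `normal + 1` for exactly one of them. -/
theorem vertexColor_adj {U : SteppedSolid} {p q : Vertex} (h : (assocGraph U).Adj p q) :
    vertexColor q ↔ ¬vertexColor p := by
  obtain ⟨⟨F, e⟩, F', e'⟩ := (⟨p, q⟩ : Vertex × Vertex)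
  obtain ⟨⟨hF, hp⟩, ⟨hF', hq⟩, h⟩ := adj_iff.1 h
  rcases p with ⟨⟨c, i⟩, ⟨d, j⟩⟩
  rcases q with ⟨⟨c', i'⟩, ⟨d', j'⟩⟩
  simp only [LatticeEdge.IsSide, SteppedSolid.HasSquare, LatticeSquare.mk.injEq,
    LatticeEdge.mk.injEq] at hF hF' hp hq h
  simp only [vertexColor]
  rcases h with ⟨⟨rfl, rfl⟩, hj⟩ | ⟨hne, rfl, rfl⟩
  · have : j' = i + 1 ↔ ¬j = i + 1 := by have := hp.1; have := hq.1; omega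
    tauto
  · by_cases hi : i = i'
    · subst hi
      have key : ∀ {c c' : Pt} {k : Fin 3}, c = c' + unit k →
          (Odd (∑ k, c' k) ↔ ¬Odd (∑ k, c k)) := by
        rintro c c' k rfl
        rw [sum_add_unit, Int.not_odd_iff_even, Int.even_add_one, Int.not_even_iff_odd]
      have hc : Odd (∑ k, c' k) ↔ ¬Odd (∑ k, c k) := by
        rcases hp.2 with e1 | ⟨k, hk1, hk2, e1⟩ <;> rcases hq.2 with e2 | ⟨l, hl1, hl2, e2⟩
        · exact (hne (LatticeSquare.ext (e1.symm.trans e2) rfl)).elim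
        · exact key (e1.symm.trans e2)
        · have := key (e2.symm.trans e1); tauto
        · obtain rfl : k = l := by have := hp.1; omega
          exact (hne (LatticeSquare.ext (add_right_cancel (e1.symm.trans e2)) rfl)).elim
      tauto
    · have hc : ∑ k, c' k = ∑ k, c k := by
        rcases hp.2 with e1 | ⟨k, hk1, hk2, e1⟩ <;> rcases hq.2 with e2 | ⟨l, hl1, hl2, e2⟩
        · rw [← e1, ← e2]
        -- This mutual position of the two squares would put the same cube both inside and outside
        -- `U`.
        · obtain rfl : l = i := by have := hp.1; have := hq.1; omega
          refine (hF'.2 ?_).elim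
          rw [e1] at e2
          have := hF.1
          rwa [e2, add_sub_cancel_right] at this
        · obtain rfl : k = i' := by have := hp.1; have := hq.1; omega
          refine (hF.2 ?_).elim
          rw [e2] at e1
          have := hF'.1
          rwa [e1, add_sub_cancel_right] at this
        · have := sum_add_unit c k
          have := sum_add_unit c' l
          rw [← e1] at *
          rw [← e2] at *
          omega
      have : j = i' + 1 ↔ ¬j = i + 1 := by have := hp.1; have := hq.1; omega
      rw [hc]
      tauto

theorem isDoubleDimer_iff {U : SteppedSolid} {m : SimpleGraph Vertex} :
    IsDoubleDimer U m ↔ IsConfig (assocGraph U) (vertices U) m := by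
  constructor
  · intro h
    obtain ⟨μ, hμ, hm⟩ := h.exists_isMult
    exact hμ.isConfig (fun _ _ => assocGraph_mem) hm
  · rintro ⟨hμ, hm⟩
    exact isDoubleDimer_of_isMult vertexColor (fun p q => vertexColor_adj) hμ hm

/-! ### Adding a cube -/

/-- The squares that contain an edge of direction `j` have normals `j + 1` and `j - 1`. The colour
of a local vertex tells which of these is meant. -/
def sgn (a : Bool) : Fin 3 := if a then 1 else -1

/-- The side of the boundary hexagon of a cube in direction `j` next to its lower corner `c`
(shifted in direction `j + sgn a`). -/
def hexEdge (c : Pt) (j : Fin 3) (a : Bool) : LatticeEdge := ⟨c + unit (j + sgn a), j⟩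

/-- Vertices in the three squares at the lower corner of a cube. -/
def lowerVertex (c : Pt) : LocVertex → Vertex
  | (j, a, b) => (⟨c, j - sgn a⟩, bif b then hexEdge c j a else ⟨c, j⟩)

/-- Vertices in the three squares at the upper corner of a cube. -/
def upperVertex (c : Pt) : LocVertex → Vertex
  | (j, a, b) => (⟨c + unit (j + sgn a), j + sgn a⟩,
      bif b then hexEdge c j a else ⟨c + unit (j + sgn a) + unit (j - sgn a), j⟩)

open Classical in
/-- The vertex outside of the boundary hexagon at one of its sides. -/
noncomputable def outerVertex (U : SteppedSolid) (c : Pt) (j : Fin 3) (a : Bool) : Vertex :=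
  (if c + unit (j + sgn a) - unit (j - sgn a) ∈ U then ⟨c + unit (j + sgn a), j - sgn a⟩
    else ⟨c + unit (j + sgn a) - unit (j - sgn a), j + sgn a⟩, hexEdge c j a)

theorem sgn_ne (j : Fin 3) (a : Bool) : j ≠ j - sgn a ∧ j ≠ j + sgn a ∧ j - sgn a ≠ j + sgn a := by
  revert j a; decide

theorem eq_sub_sgn_or {i j : Fin 3} (a : Bool) (h : j ≠ i) : i = j - sgn a ∨ i = j + sgn a := by
  revert i j a; decide

theorem exists_sub_sgn {i j : Fin 3} (h : j ≠ i) : ∃ a, i = j - sgn a := by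
  revert i j; decide

theorem exists_add_sgn {i j : Fin 3} (h : j ≠ i) : ∃ a, i = j + sgn a := by
  revert i j; decide

theorem isSide_iff {e : LatticeEdge} {F : LatticeSquare} {a : Bool}
    (h : F.normal = e.dir - sgn a) :
    e.IsSide F ↔ e.base = F.base ∨ e.base = F.base + unit (e.dir + sgn a) := by
  have h0 := sgn_ne e.dir a
  rw [LatticeEdge.IsSide, h]
  constructor
  · rintro ⟨-, h1 | ⟨k, h1, h2, h3⟩⟩
    · exact Or.inl h1
    · obtain rfl := (eq_sub_sgn_or a h2.symm).resolve_left h1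
      exact Or.inr h3
  · intro h1
    exact ⟨h0.1, h1.imp id fun h1 => ⟨_, h0.2.2.symm, h0.2.1.symm, h1⟩⟩

theorem isSide_iff' {e : LatticeEdge} {F : LatticeSquare} {a : Bool}
    (h : F.normal = e.dir + sgn a) :
    e.IsSide F ↔ e.base = F.base ∨ e.base = F.base + unit (e.dir - sgn a) := by
  have h1 : ∀ a, sgn (!a) = -sgn a := by decide
  rw [isSide_iff (a := !a) (by rw [h, h1, sub_neg_eq_add]), h1, ← sub_eq_add_neg]

/-- The solid `U'` is `U` with the cube `c` added. -/
structure AddsCube (U U' : SteppedSolid) (c : Pt) : Prop where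
  notMem : c ∉ U
  sub_mem : ∀ i, c - unit i ∈ U
  mem_iff : ∀ x, x ∈ U' ↔ x ∈ U ∨ x = c

variable {U U' : SteppedSolid} {c : Pt}

theorem AddsCube.hasSquare (h : AddsCube U U' c) {F : LatticeSquare} (hF : U.HasSquare F)
    (hc : F.base ≠ c) : U'.HasSquare F :=
  ⟨(h.mem_iff _).2 (Or.inl hF.1), fun h' => ((h.mem_iff _).1 h').elim hF.2 hc⟩

theorem AddsCube.hasSquare_or (h : AddsCube U U' c) {F : LatticeSquare} (hF : U'.HasSquare F) :
    U.HasSquare F ∨ F.base = c + unit F.normal := by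
  rcases (h.mem_iff _).1 hF.1 with h1 | h1
  · exact Or.inl ⟨h1, fun h' => hF.2 ((h.mem_iff _).2 (Or.inl h'))⟩
  · right; rw [← h1, sub_add_cancel]

theorem AddsCube.not_hasSquare' (h : AddsCube U U' c) (i : Fin 3) : ¬U'.HasSquare ⟨c, i⟩ :=
  fun hF => hF.2 ((h.mem_iff _).2 (Or.inr rfl))

theorem AddsCube.not_hasSquare (h : AddsCube U U' c) (i : Fin 3) :
    ¬U.HasSquare ⟨c + unit i, i⟩ := fun hF => h.notMem (by
  have := hF.1; rwa [add_sub_cancel_right] at this)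

theorem AddsCube.hasSquare_lower (h : AddsCube U U' c) (i : Fin 3) : U.HasSquare ⟨c, i⟩ :=
  ⟨h.sub_mem i, h.notMem⟩

theorem AddsCube.hasSquare_upper (h : AddsCube U U' c) (i : Fin 3) :
    U'.HasSquare ⟨c + unit i, i⟩ :=
  ⟨(h.mem_iff _).2 (Or.inr (by simp)), fun h' => ((h.mem_iff _).1 h').elim
    (notMem_add_unit h.notMem i) (by simp)⟩

theorem AddsCube.lowerVertex_mem (h : AddsCube U U' c) (u : LocVertex) :
    lowerVertex c u ∈ vertices U := by
  obtain ⟨j, a, b⟩ := u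
  refine ⟨h.hasSquare_lower _, ?_⟩
  cases b
  · exact (isSide_iff (a := a) rfl).2 (Or.inl rfl)
  · exact (isSide_iff (a := a) rfl).2 (Or.inr rfl)

theorem AddsCube.upperVertex_mem (h : AddsCube U U' c) (u : LocVertex) :
    upperVertex c u ∈ vertices U' := by
  obtain ⟨j, a, b⟩ := u
  refine ⟨h.hasSquare_upper _, ?_⟩
  cases b
  · exact (isSide_iff' (a := a) rfl).2 (Or.inr rfl)
  · exact (isSide_iff' (a := a) rfl).2 (Or.inl rfl)

theorem AddsCube.outerVertex_mem (h : AddsCube U U' c) (j : Fin 3) (a : Bool) :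
    outerVertex U c j a ∈ vertices U ∩ vertices U' := by
  have h0 := sgn_ne j a
  have key : U.HasSquare (outerVertex U c j a).1 ∧ (outerVertex U c j a).1.base ≠ c ∧
      (outerVertex U c j a).2.IsSide (outerVertex U c j a).1 := by
    simp only [outerVertex]
    split_ifs with h1
    · exact ⟨⟨h1, notMem_add_unit h.notMem _⟩, by simp, (isSide_iff (a := a) rfl).2 (Or.inl rfl)⟩
    · refine ⟨⟨?_, h1⟩, ?_, (isSide_iff' (a := a) rfl).2 (Or.inr ?_)⟩
      · have : c + unit (j + sgn a) - unit (j - sgn a) - unit (j + sgn a) =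
            c - unit (j - sgn a) := by abel
        exact this ▸ h.sub_mem _
      · intro e
        have : unit (j + sgn a) = unit (j - sgn a) := by
          rw [sub_eq_iff_eq_add] at e
          exact add_left_cancel e
        exact h0.2.2.symm (unit_injective this)
      · simp [hexEdge]
  exact ⟨⟨key.1, key.2.2⟩, h.hasSquare key.1 key.2.1, key.2.2⟩

theorem AddsCube.eq_outerVertex (h : AddsCube U U' c) {p : Vertex}
    (hp : p ∈ vertices U ∩ vertices U') {j : Fin 3} {a : Bool} (he : p.2 = hexEdge c j a) :
    p = outerVertex U c j a := by
  obtain ⟨⟨h1, h2⟩, h3, -⟩ := hp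
  obtain ⟨⟨d, i⟩, e⟩ := p
  subst he
  have h0 : j ≠ i := h2.1
  refine Prod.ext ?_ rfl
  simp only [outerVertex]
  rcases eq_sub_sgn_or a h0 with rfl | rfl
  · rcases (isSide_iff (a := a) rfl).1 h2 with e | e
    · obtain rfl : c + unit (j + sgn a) = d := e
      rw [if_pos h1.1]
    · obtain rfl : c = d := add_right_cancel e
      exact (h.not_hasSquare' _ h3).elim
  · rcases (isSide_iff' (a := a) rfl).1 h2 with e | e
    · obtain rfl : c + unit (j + sgn a) = d := e
      exact (h.not_hasSquare _ h1).elim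
    · obtain rfl : c + unit (j + sgn a) - unit (j - sgn a) = d := by
        rw [sub_eq_iff_eq_add]; exact e
      rw [if_neg h1.2]

theorem AddsCube.vertices_eq (h : AddsCube U U' c) :
    vertices U = (vertices U ∩ vertices U') ∪ Set.range (lowerVertex c) := by
  ext p
  constructor
  · rintro ⟨h1, h2⟩
    by_cases hc : p.1.base = c
    · right
      obtain ⟨a, ha⟩ := exists_sub_sgn h2.1
      obtain ⟨⟨d, i⟩, ⟨d', j⟩⟩ := p
      obtain rfl : i = j - sgn a := ha
      obtain rfl : d = c := hc
      rcases (isSide_iff (a := a) rfl).1 h2 with e | e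
      · exact ⟨(j, a, false), Prod.ext rfl (LatticeEdge.ext e.symm rfl)⟩
      · exact ⟨(j, a, true), Prod.ext rfl (LatticeEdge.ext e.symm rfl)⟩
    · exact Or.inl ⟨⟨h1, h2⟩, h.hasSquare h1 hc, h2⟩
  · rintro (h1 | ⟨u, rfl⟩)
    exacts [h1.1, h.lowerVertex_mem u]

theorem AddsCube.vertices_eq' (h : AddsCube U U' c) :
    vertices U' = (vertices U ∩ vertices U') ∪ Set.range (upperVertex c) := by
  ext p
  constructor
  · rintro ⟨h1, h2⟩
    rcases h.hasSquare_or h1 with h3 | h3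
    · exact Or.inl ⟨⟨h3, h2⟩, h1, h2⟩
    · right
      obtain ⟨a, ha⟩ := exists_add_sgn h2.1
      obtain ⟨⟨d, i⟩, ⟨d', j⟩⟩ := p
      obtain rfl : i = j + sgn a := ha
      obtain rfl : d = c + unit (j + sgn a) := h3
      rcases (isSide_iff' (a := a) rfl).1 h2 with e | e
      · exact ⟨(j, a, true), Prod.ext rfl (LatticeEdge.ext e.symm rfl)⟩
      · exact ⟨(j, a, false), Prod.ext rfl (LatticeEdge.ext e.symm rfl)⟩
  · rintro (h1 | ⟨u, rfl⟩)
    exacts [h1.2, h.upperVertex_mem u]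

end DoubleDimer

namespace DoubleDimer

variable {U U' : SteppedSolid} {c : Pt}

/-! ### The cube move as a pair of regions -/

theorem add_unit_eq_iff {i j : Fin 3} : c + unit i = c + unit j ↔ i = j := by
  rw [add_right_inj]; exact unit_injective.eq_iff

theorem lowerVertex_injective (c : Pt) : Function.Injective (lowerVertex c) := by
  rintro ⟨j, a, b⟩ ⟨j', a', b'⟩ h
  simp only [lowerVertex, hexEdge, Prod.mk.injEq, LatticeSquare.mk.injEq] at h
  obtain ⟨⟨-, h1⟩, h2⟩ := h
  have hj : j = j' := by cases b <;> cases b' <;> exact congrArg LatticeEdge.dir h2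
  subst hj
  have ha : a = a' := by revert h1; clear h2; revert j a a'; decide
  subst ha
  have hb : b = b' := by
    cases b <;> cases b' <;> simp [LatticeEdge.mk.injEq] at h2 ⊢
  rw [hb]

theorem upperVertex_injective (c : Pt) : Function.Injective (upperVertex c) := by
  rintro ⟨j, a, b⟩ ⟨j', a', b'⟩ h
  simp only [upperVertex, hexEdge, Prod.mk.injEq, LatticeSquare.mk.injEq] at h
  obtain ⟨⟨-, h1⟩, h2⟩ := h
  have hj : j = j' := by cases b <;> cases b' <;> exact congrArg LatticeEdge.dir h2
  subst hj
  have ha : a = a' := by revert h1; clear h2; revert j a a'; decide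
  subst ha
  have hb : b = b' := by
    cases b <;> cases b' <;> simp [LatticeEdge.mk.injEq] at h2 ⊢
  rw [hb]

theorem AddsCube.lowerVertex_notMem (h : AddsCube U U' c) (u : LocVertex) :
    lowerVertex c u ∉ vertices U' := fun h' => h.not_hasSquare' _ h'.1

theorem AddsCube.upperVertex_notMem (h : AddsCube U U' c) (u : LocVertex) :
    upperVertex c u ∉ vertices U := fun h' => h.not_hasSquare _ h'.1

/-- The left side is adjacency in the associated graph expressed through normals, directions and
sides; the right side is the shape required by `Site`. -/
theorem lower_combinatorics (j j' : Fin 3) (a a' b b' : Bool) :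
    ((j - sgn a = j' - sgn a' ∧ j ≠ j') ∨ (j - sgn a ≠ j' - sgn a' ∧ j = j' ∧
      ((b = false ∧ b' = false) ∨ (b = true ∧ b' = true ∧ a = a')))) ↔
    (a' = !a ∧ j' = j + sgn a) ∨ (b = false ∧ b' = false ∧ a' = !a ∧ j' = j) := by
  revert j j' a a' b b'; decide

theorem upper_combinatorics (j j' : Fin 3) (a a' b b' : Bool) :
    ((j + sgn a = j' + sgn a' ∧ j ≠ j') ∨ (j + sgn a ≠ j' + sgn a' ∧ j = j' ∧
      ((b = false ∧ b' = false) ∨ (b = true ∧ b' = true ∧ a = a')))) ↔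
    (a' = !a ∧ j' = j - sgn a) ∨ (b = false ∧ b' = false ∧ a' = !a ∧ j' = j) := by
  revert j j' a a' b b'; decide

theorem lowerVertex_edge_eq_iff (c : Pt) (j j' : Fin 3) (a a' b b' : Bool) :
    (lowerVertex c (j, a, b)).2 = (lowerVertex c (j', a', b')).2 ↔ j = j' ∧
      ((b = false ∧ b' = false) ∨ (b = true ∧ b' = true ∧ a = a')) := by
  have ha : ∀ j a a', j + sgn a = j + sgn a' ↔ a = a' := by decide
  cases b <;> cases b' <;> simp only [lowerVertex, hexEdge, cond_true, cond_false,
    LatticeEdge.mk.injEq, add_unit_eq_iff]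
  · simp
  · simp
  · simp
  · constructor
    · rintro ⟨h, rfl⟩
      exact ⟨rfl, Or.inr ⟨trivial, trivial, (ha _ _ _).1 h⟩⟩
    · rintro ⟨rfl, h⟩
      have : a = a' := by simpa using h
      exact ⟨by rw [this], rfl⟩

theorem upperVertex_edge_eq_iff (c : Pt) (j j' : Fin 3) (a a' b b' : Bool) :
    (upperVertex c (j, a, b)).2 = (upperVertex c (j', a', b')).2 ↔ j = j' ∧
      ((b = false ∧ b' = false) ∨ (b = true ∧ b' = true ∧ a = a')) := by
  have ha : ∀ j a a', j + sgn a = j + sgn a' ↔ a = a' := by decide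
  have h2 : ∀ (i k l : Fin 3), c + unit i + unit k ≠ c + unit l := by
    intro i k l e
    have := congrArg (fun x : Pt => ∑ k, x k) e
    simp only [sum_add_unit] at this
    omega
  have h3 : ∀ j a a', c + unit (j + sgn a) + unit (j - sgn a) =
      c + unit (j + sgn a') + unit (j - sgn a') := by
    intro j a a'
    cases a <;> cases a' <;> simp only [sgn, if_true, if_false, Bool.false_eq_true,
      sub_neg_eq_add, ← sub_eq_add_neg]
    · rw [add_right_comm]
    · rw [add_right_comm]
  cases b <;> cases b' <;> simp only [upperVertex, hexEdge, cond_true, cond_false,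
    LatticeEdge.mk.injEq, add_unit_eq_iff]
  · constructor
    · rintro ⟨-, rfl⟩
      simp
    · rintro ⟨rfl, -⟩
      exact ⟨h3 _ _ _, rfl⟩
  · simp [h2]
  · simp [fun i k l => (h2 i k l).symm]
  · constructor
    · rintro ⟨h, rfl⟩
      exact ⟨rfl, Or.inr ⟨trivial, trivial, (ha _ _ _).1 h⟩⟩
    · rintro ⟨rfl, h⟩
      have : a = a' := by simpa using h
      exact ⟨by rw [this], rfl⟩

theorem dir_lowerVertex (c : Pt) (u : LocVertex) : (lowerVertex c u).2.dir = u.1 := by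
  obtain ⟨j, a, b⟩ := u; cases b <;> rfl

theorem dir_upperVertex (c : Pt) (u : LocVertex) : (upperVertex c u).2.dir = u.1 := by
  obtain ⟨j, a, b⟩ := u; cases b <;> rfl

theorem AddsCube.adj_lowerVertex (h : AddsCube U U' c) (j j' : Fin 3) (a a' b b' : Bool) :
    (assocGraph U).Adj (lowerVertex c (j, a, b)) (lowerVertex c (j', a', b')) ↔
      (a' = !a ∧ j' = j + sgn a) ∨ (b = false ∧ b' = false ∧ a' = !a ∧ j' = j) := by
  have h1 : (lowerVertex c (j, a, b)).1 = (lowerVertex c (j', a', b')).1 ↔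
      j - sgn a = j' - sgn a' := by
    simp only [lowerVertex, LatticeSquare.mk.injEq, true_and]
  rw [adj_iff, and_iff_right (h.lowerVertex_mem _), and_iff_right (h.lowerVertex_mem _),
    lowerVertex_edge_eq_iff, dir_lowerVertex, dir_lowerVertex, ← lower_combinatorics, ne_eq,
    ne_eq, h1]

theorem AddsCube.adj_upperVertex (h : AddsCube U U' c) (j j' : Fin 3) (a a' b b' : Bool) :
    (assocGraph U').Adj (upperVertex c (j, a, b)) (upperVertex c (j', a', b')) ↔
      (a' = !a ∧ j' = j - sgn a) ∨ (b = false ∧ b' = false ∧ a' = !a ∧ j' = j) := by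
  have h1 : (upperVertex c (j, a, b)).1 = (upperVertex c (j', a', b')).1 ↔
      j + sgn a = j' + sgn a' := by
    simp only [upperVertex, LatticeSquare.mk.injEq, add_unit_eq_iff, and_self]
  rw [adj_iff, and_iff_right (h.upperVertex_mem _), and_iff_right (h.upperVertex_mem _),
    upperVertex_edge_eq_iff, dir_upperVertex, dir_upperVertex, ← upper_combinatorics, ne_eq,
    ne_eq, h1]

theorem AddsCube.adj_lowerVertex_outer (h : AddsCube U U' c) (j : Fin 3) (a b : Bool) {q : Vertex}
    (hq : q ∈ vertices U ∩ vertices U') :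
    (assocGraph U).Adj (lowerVertex c (j, a, b)) q ↔ b = true ∧ q = outerVertex U c j a := by
  have hne : (lowerVertex c (j, a, b)).1 ≠ q.1 := fun e =>
    h.not_hasSquare' (j - sgn a) (by have := hq.2.1; rw [← e] at this; exact this)
  constructor
  · intro e
    obtain ⟨-, -, ⟨e1, -⟩ | ⟨-, e1⟩⟩ := adj_iff.1 e
    · exact (hne e1).elim
    · cases b
      -- An edge that starts at `c` lies only in squares based at `c`, which have disappeared from
      -- `U'`, or in squares based one step below `c`, where the cube belongs to `U`.
      · exfalso
        obtain ⟨h1, h2⟩ := hq.1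
        obtain ⟨⟨d, i⟩, e'⟩ := q
        obtain rfl : (⟨c, j⟩ : LatticeEdge) = e' := e1
        obtain ⟨a', ha⟩ := exists_sub_sgn h2.1
        obtain rfl : i = j - sgn a' := ha
        rcases (isSide_iff (a := a') rfl).1 h2 with e2 | e2
        · obtain rfl : c = d := e2
          exact h.not_hasSquare' _ hq.2.1
        · refine h1.2 ?_
          have : d = c - unit (j + sgn a') := eq_sub_of_add_eq e2.symm
          exact this ▸ h.sub_mem _
      · exact ⟨rfl, h.eq_outerVertex hq e1.symm⟩
  · rintro ⟨rfl, rfl⟩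
    exact adj_iff.2 ⟨h.lowerVertex_mem _, hq.1, Or.inr ⟨hne, rfl⟩⟩

theorem AddsCube.adj_upperVertex_outer (h : AddsCube U U' c) (j : Fin 3) (a b : Bool) {q : Vertex}
    (hq : q ∈ vertices U ∩ vertices U') :
    (assocGraph U').Adj (upperVertex c (j, a, b)) q ↔ b = true ∧ q = outerVertex U c j a := by
  have hne : (upperVertex c (j, a, b)).1 ≠ q.1 := fun e =>
    h.not_hasSquare (j + sgn a) (by have := hq.1.1; rw [← e] at this; exact this)
  constructor
  · intro e
    obtain ⟨-, -, ⟨e1, -⟩ | ⟨-, e1⟩⟩ := adj_iff.1 e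
    · exact (hne e1).elim
    · cases b
      · exfalso
        obtain ⟨h1, h2⟩ := hq.1
        obtain ⟨⟨d, i⟩, e'⟩ := q
        obtain rfl : (⟨c + unit (j + sgn a) + unit (j - sgn a), j⟩ : LatticeEdge) = e' := e1
        have key : ∀ k l : Fin 3, c + unit k + unit l - unit l ∉ U := by
          intro k l
          rw [add_sub_cancel_right]
          exact notMem_add_unit h.notMem k
        have key2 : ∀ k l : Fin 3, c + unit k + unit l - unit k - unit l ∉ U := by
          intro k l
          rw [add_right_comm, add_sub_cancel_right, add_sub_cancel_right]
          exact h.notMem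
        have hi : i = j - sgn a ∨ i = j + sgn a := eq_sub_sgn_or a h2.1
        rcases hi with rfl | rfl
        · rcases (isSide_iff (a := a) rfl).1 h2 with e2 | e2
          · exact key (j + sgn a) (j - sgn a) (by have := h1.1; rwa [← e2] at this)
          · exact key2 (j + sgn a) (j - sgn a) (by
              have := h1.1; rwa [show d = _ from eq_sub_of_add_eq e2.symm] at this)
        · rcases (isSide_iff' (a := a) rfl).1 h2 with e2 | e2
          · exact key (j - sgn a) (j + sgn a) (by
              have := h1.1; rw [← e2] at this; rwa [add_right_comm])
          · exact key2 (j - sgn a) (j + sgn a) (by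
              have := h1.1
              rw [show d = _ from eq_sub_of_add_eq e2.symm] at this; rwa [add_right_comm])
      · exact ⟨rfl, h.eq_outerVertex hq e1.symm⟩
  · rintro ⟨rfl, rfl⟩
    exact adj_iff.2 ⟨h.upperVertex_mem _, hq.2, Or.inr ⟨hne, rfl⟩⟩

theorem AddsCube.site (h : AddsCube U U' c) : Site (assocGraph U) (vertices U)
    (vertices U ∩ vertices U') 1 (lowerVertex c) (outerVertex U c) := by
  have key : ∀ j a b q, (assocGraph U).Adj (lowerVertex c (j, a, b)) q ↔
      (∃ b', q = lowerVertex c (j + sgn a, !a, b')) ∨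
        (b = false ∧ q = lowerVertex c (j, !a, false)) ∨ (b = true ∧ q = outerVertex U c j a) := by
    intro j a b q
    constructor
    · intro e
      have hq := e.symm.1
      rw [h.vertices_eq] at hq
      rcases hq with hq | ⟨⟨j', a', b'⟩, rfl⟩
      · exact Or.inr (Or.inr ((h.adj_lowerVertex_outer j a b hq).1 e))
      · rcases (h.adj_lowerVertex j j' a a' b b').1 e with ⟨rfl, rfl⟩ | ⟨rfl, rfl, rfl, rfl⟩
        · exact Or.inl ⟨b', rfl⟩
        · exact Or.inr (Or.inl ⟨rfl, rfl⟩)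
    · rintro (⟨b', rfl⟩ | ⟨rfl, rfl⟩ | ⟨rfl, rfl⟩)
      · exact (h.adj_lowerVertex ..).2 (Or.inl ⟨rfl, rfl⟩)
      · exact (h.adj_lowerVertex ..).2 (Or.inr ⟨rfl, rfl, rfl, rfl⟩)
      · exact (h.adj_lowerVertex_outer j a true (h.outerVertex_mem j a)).2 ⟨rfl, rfl⟩
  exact ⟨by decide, lowerVertex_injective c, fun u hu => h.lowerVertex_notMem u hu.2,
    h.vertices_eq, h.outerVertex_mem, fun _ _ => assocGraph_mem, fun j b q => key j true b q,
    fun j b q => by rw [sub_eq_add_neg]; exact key j false b q⟩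

theorem AddsCube.site' (h : AddsCube U U' c) : Site (assocGraph U') (vertices U')
    (vertices U ∩ vertices U') (-1) (upperVertex c) (outerVertex U c) := by
  have key : ∀ j a b q, (assocGraph U').Adj (upperVertex c (j, a, b)) q ↔
      (∃ b', q = upperVertex c (j - sgn a, !a, b')) ∨
        (b = false ∧ q = upperVertex c (j, !a, false)) ∨ (b = true ∧ q = outerVertex U c j a) := by
    intro j a b q
    constructor
    · intro e
      have hq := e.symm.1
      rw [h.vertices_eq'] at hq
      rcases hq with hq | ⟨⟨j', a', b'⟩, rfl⟩
      · exact Or.inr (Or.inr ((h.adj_upperVertex_outer j a b hq).1 e))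
      · rcases (h.adj_upperVertex j j' a a' b b').1 e with ⟨rfl, rfl⟩ | ⟨rfl, rfl, rfl, rfl⟩
        · exact Or.inl ⟨b', rfl⟩
        · exact Or.inr (Or.inl ⟨rfl, rfl⟩)
    · rintro (⟨b', rfl⟩ | ⟨rfl, rfl⟩ | ⟨rfl, rfl⟩)
      · exact (h.adj_upperVertex ..).2 (Or.inl ⟨rfl, rfl⟩)
      · exact (h.adj_upperVertex ..).2 (Or.inr ⟨rfl, rfl, rfl, rfl⟩)
      · exact (h.adj_upperVertex_outer j a true (h.outerVertex_mem j a)).2 ⟨rfl, rfl⟩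
  exact ⟨by decide, upperVertex_injective c, fun u hu => h.upperVertex_notMem u hu.1,
    h.vertices_eq', h.outerVertex_mem, fun _ _ => assocGraph_mem,
    fun j b q => by rw [← sub_eq_add_neg]; exact key j true b q, fun j b q => key j false b q⟩

theorem AddsCube.sitePair (h : AddsCube U U' c) :
    SitePair (assocGraph U) (assocGraph U') (vertices U) (vertices U')
      (vertices U ∩ vertices U') 1 (-1) (lowerVertex c) (upperVertex c) (outerVertex U c) :=
  ⟨h.site, h.site', rfl, h.lowerVertex_notMem, h.upperVertex_notMem, fun p hp q hq => by
    rw [adj_iff, adj_iff]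
    simp only [hp.1, hp.2, hq.1, hq.2, true_and]⟩

end DoubleDimer

namespace DoubleDimer

/-! ### Weighted counts of taut configurations -/

/-- The two sides of the square `F` in direction `j`: the upper one if `b`, and otherwise the one
through `F.base`. -/
def LatticeSquare.side (F : LatticeSquare) (j : Fin 3) (b : Bool) : LatticeEdge :=
  ⟨bif b then F.base + unit (-F.normal - j) else F.base, j⟩

theorem LatticeSquare.side_isSide (F : LatticeSquare) {j : Fin 3} (h : j ≠ F.normal) (b : Bool) :
    (F.side j b).IsSide F := by
  have key : ∀ i j : Fin 3, j ≠ i → -i - j ≠ i ∧ -i - j ≠ j := by decide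
  refine ⟨h, ?_⟩
  cases b
  · exact Or.inl rfl
  · exact Or.inr ⟨_, (key _ _ h).1, (key _ _ h).2, rfl⟩

/-- The weight of the edges of `m` in the square `F`. -/
noncomputable def weightAt (m : SimpleGraph Vertex) (F : LatticeSquare) : ℝ :=
  squareWeight fun b b' => mult m (F, F.side (F.normal + 1) b) (F, F.side (F.normal + 2) b')

/-- The squares that carry a weight: those above the boundary of `U₋ₙ`, on every other level. -/
def IsHeavy (n : ℕ) (F : LatticeSquare) : Prop :=
  -(n : ℤ) - 2 < ∑ k, F.base k ∧ Odd (∑ k, F.base k + n)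

def heavySquares (n : ℕ) (U : SteppedSolid) : Set LatticeSquare :=
  {F | U.HasSquare F ∧ IsHeavy n F}

/-- The base coordinates of a square on such a surface are nonpositive, and heaviness bounds their
sum from below. -/
theorem heavySquares_finite (n : ℕ) {U : SteppedSolid} (hU : U ≤ orthantSolid) :
    (heavySquares n U).Finite := by
  have : ((Set.Icc (fun _ => -(n : ℤ) - 2) 0 : Set Pt) ×ˢ (Set.univ : Set (Fin 3))).Finite :=
    (Set.finite_Icc _ _).prod Set.finite_univ
  refine (this.image fun p => LatticeSquare.mk p.1 p.2).subset ?_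
  rintro ⟨c, i⟩ ⟨⟨h1, -⟩, h2, -⟩
  have h3 : ∀ k, c k ≤ 0 := fun k => by
    have : c k - unit i k + 1 ≤ 0 := hU h1 k
    have : unit i k ≤ 1 := by
      rw [unit, Pi.single_apply]; split_ifs <;> simp
    omega
  refine ⟨(c, i), ⟨⟨fun k => ?_, h3⟩, trivial⟩, rfl⟩
  have h0 := h3 0
  have h1 := h3 1
  have h2' := h3 2
  simp only [Fin.sum_univ_three] at h2
  fin_cases k <;> simp <;> omega

noncomputable def weight (n : ℕ) (U : SteppedSolid) (m : SimpleGraph Vertex) : ℝ :=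
  ∏ᶠ F ∈ heavySquares n U, weightAt m F

/-- The weighted count of taut configurations on `Γ(U)` is defined, with value `z`. -/
def HasCount (n : ℕ) (U : SteppedSolid) (z : ℝ) : Prop :=
  (∀ m, IsTaut U m → (loops m).Finite) ∧ ∃ hfin : {m | IsTaut U m}.Finite,
    ∑ m ∈ hfin.toFinset, (2 : ℝ) ^ (loops m).ncard * weight n U m = z

/-- Seen from the upper corner of a cube, the two directions change roles and lower sides become
upper ones. The weight is symmetric under this. -/
theorem squareWeight_comm (q : Bool → Bool → ℕ) :
    squareWeight (fun b b' => q (!b') (!b)) = squareWeight q := by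
  simp only [squareWeight_eq, Bool.not_true, Bool.not_false]
  ring

variable {U U' : SteppedSolid} {c : Pt} {G : SimpleGraph Vertex} {S : Set Vertex}
  {m : SimpleGraph Vertex}

theorem squareWeight_lower (m : SimpleGraph Vertex) (c : Pt) (j : Fin 3) :
    squareWeight (quadState 1 (lowerVertex c) m (j + 1)) = weightAt m ⟨c, j⟩ := by
  have h1 : ∀ j : Fin 3, j + 1 - sgn true = j ∧ j + 1 + 1 - sgn false = j ∧
      j + 1 + 1 = j + 2 ∧ j + 1 + sgn true = -j - (j + 1) ∧ j + 2 + sgn false = -j - (j + 2) := by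
    decide
  obtain ⟨h1, h2, h3, h4, h5⟩ := h1 j
  refine congrArg squareWeight (funext₂ fun b b' => ?_)
  simp only [quadState, lowerVertex, LatticeSquare.side, hexEdge]
  rw [h1, h2, h3, h4, h5]
  cases b <;> cases b' <;> rfl

theorem squareWeight_upper (hm : IsConfig G S m) (c : Pt) (j : Fin 3) :
    squareWeight (quadState (-1) (upperVertex c) m (j + 2)) = weightAt m ⟨c + unit j, j⟩ := by
  have h1 : ∀ j : Fin 3, j + 2 + sgn true = j ∧ j + 2 - sgn true = j + 1 ∧
      j + 2 + -1 = j + 1 ∧ j + 1 + sgn false = j ∧ j + 1 - sgn false = j + 2 ∧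
      -j - (j + 2) = j + 1 ∧ -j - (j + 1) = j + 2 := by decide
  obtain ⟨h1, h2, h3, h4, h5, h6, h7⟩ := h1 j
  rw [weightAt, ← squareWeight_comm]
  refine congrArg squareWeight (funext₂ fun b b' => ?_)
  simp only [quadState, upperVertex, LatticeSquare.side, hexEdge]
  rw [h1, h2, h3, h4, h5, h6, h7, hm.1.symm]
  cases b <;> cases b' <;> rfl

theorem regionWeight_lower (m : SimpleGraph Vertex) (c : Pt) (heavy : Prop) [Decidable heavy] :
    regionWeight heavy (quadState 1 (lowerVertex c) m) =
      if heavy then ∏ j, weightAt m ⟨c, j⟩ else 1 := by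
  rw [regionWeight, ← Equiv.prod_comp (Equiv.addRight (1 : Fin 3))]
  simp only [Equiv.coe_addRight, squareWeight_lower]

theorem regionWeight_upper (hm : IsConfig G S m) (c : Pt) (heavy : Prop) [Decidable heavy] :
    regionWeight heavy (quadState (-1) (upperVertex c) m) =
      if heavy then ∏ j, weightAt m ⟨c + unit j, j⟩ else 1 := by
  rw [regionWeight, ← Equiv.prod_comp (Equiv.addRight (2 : Fin 3))]
  simp only [Equiv.coe_addRight, squareWeight_upper hm]

/-- Splitting three squares off a product over squares. -/
theorem finprod_union_range {s t : Set LatticeSquare} {f : LatticeSquare → ℝ}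
    {g : Fin 3 → LatticeSquare} (hg : Function.Injective g) (hs : s.Finite) {heavy : Prop}
    [Decidable heavy] (hd : ∀ j, g j ∉ s) (h : ∀ F, F ∈ t ↔ F ∈ s ∨ (heavy ∧ ∃ j, g j = F)) :
    ∏ᶠ F ∈ t, f F = (∏ᶠ F ∈ s, f F) * if heavy then ∏ j, f (g j) else 1 := by
  split_ifs with hh
  · have e : t = s ∪ Set.range g := by ext F; simp [h, hh]
    rw [e, finprod_mem_union (Set.disjoint_right.2 (by rintro _ ⟨j, rfl⟩; exact hd j)) hs
      (Set.finite_range g), finprod_mem_range hg,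
      finprod_eq_prod_of_fintype fun j => f (g j)]
  · have e : t = s := by ext F; simp [h, hh]
    rw [e, mul_one]

/-- The three lower squares have level `∑ c` and the three upper squares level `∑ c + 1`, so exactly
one of the two triples is heavy and `SitePair.transfer` applies. The weights of the common squares
depend only on the outside. -/
theorem AddsCube.hasCount (h : AddsCube U U' c) (hU : U' ≤ orthantSolid) {n : ℕ}
    (hc : -(n : ℤ) - 2 ≤ ∑ k, c k) {z : ℝ} (hz : HasCount n U' z) : HasCount n U z := by
  classical
  set C : Set LatticeSquare := {F | U.HasSquare F ∧ U'.HasSquare F ∧ IsHeavy n F} with hC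
  have hCfin : C.Finite := (heavySquares_finite n hU).subset fun F hF => hF.2
  have ht : ∀ {U : SteppedSolid}, {m | IsTaut U m} =
      {m | IsConfig (assocGraph U) (vertices U) m ∧ SameEnds m initialConfig} := fun {U} => by
    ext m
    simp only [Set.mem_ofPred_eq, isTaut_iff, isDoubleDimer_iff]
  have ht' : ∀ {U : SteppedSolid} {m}, IsTaut U m ↔
      IsConfig (assocGraph U) (vertices U) m ∧ SameEnds m initialConfig := fun {U m} => by
    rw [isTaut_iff, isDoubleDimer_iff]
  obtain ⟨hl, hfin, rfl⟩ := hz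
  have hheavy : Odd (∑ k, c k + n + 1) ↔ ¬Odd (∑ k, c k + n) := by
    rw [Int.odd_add, Int.not_odd_iff_even]; simp
  have hw : ∀ m m', (∀ p ∈ vertices U ∩ vertices U', ∀ q ∈ vertices U ∩ vertices U',
      mult m p q = mult m' p q) → ∏ᶠ F ∈ C, weightAt m F = ∏ᶠ F ∈ C, weightAt m' F := by
    intro m m' hm
    refine finprod_mem_congr rfl fun F hF => ?_
    have key : ∀ i : Fin 3, i + 1 ≠ i ∧ i + 2 ≠ i := by decide
    refine congrArg squareWeight (funext₂ fun b b' => hm _ ?_ _ ?_)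
    · exact ⟨⟨hF.1, F.side_isSide (key _).1 _⟩, hF.2.1, F.side_isSide (key _).1 _⟩
    · exact ⟨⟨hF.1, F.side_isSide (key _).2 _⟩, hF.2.1, F.side_isSide (key _).2 _⟩
  have e1 : ∀ m, weight n U m = (∏ᶠ F ∈ C, weightAt m F) *
      regionWeight (Odd (∑ k, c k + n)) (quadState 1 (lowerVertex c) m) := fun m => by
    rw [regionWeight_lower, weight]
    refine finprod_union_range (g := fun j => ⟨c, j⟩) (fun i j e => by simpa using e) hCfin
      (fun j hj => h.not_hasSquare' j hj.2.1) fun F => ⟨fun hF => ?_, ?_⟩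
    · by_cases hb : F.base = c
      · exact Or.inr ⟨by rw [← hb]; exact hF.2.2, F.normal, LatticeSquare.ext hb.symm rfl⟩
      · exact Or.inl ⟨hF.1, h.hasSquare hF.1 hb, hF.2⟩
    · rintro (hF | ⟨hF, j, rfl⟩)
      · exact ⟨hF.1, hF.2.2⟩
      -- The strict bound in `IsHeavy` costs nothing at the lowest admissible level `-n - 2`, which
      -- has the light parity.
      · refine ⟨h.hasSquare_lower j, lt_of_le_of_ne hc fun e => ?_, hF⟩
        rw [← e] at hF
        exact absurd hF (by rw [Int.not_odd_iff_even]; exact ⟨-1, by ring⟩)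
  have e2 : ∀ m, IsConfig (assocGraph U') (vertices U') m →
      weight n U' m = (∏ᶠ F ∈ C, weightAt m F) *
      regionWeight (Odd (∑ k, c k + n + 1)) (quadState (-1) (upperVertex c) m) := fun m hm => by
    have hs : ∀ j, ∑ k, (c + unit j) k + (n : ℤ) = ∑ k, c k + n + 1 := fun j => by
      rw [sum_add_unit]; ring
    rw [regionWeight_upper hm, weight]
    refine finprod_union_range (g := fun j => ⟨c + unit j, j⟩)
      (fun i j e => congrArg LatticeSquare.normal e) hCfin
      (fun j hj => h.not_hasSquare j hj.1) fun F => ⟨fun hF => ?_, ?_⟩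
    · rcases h.hasSquare_or hF.1 with hb | hb
      · exact Or.inl ⟨hb, hF⟩
      · exact Or.inr ⟨by rw [← hs F.normal, ← hb]; exact hF.2.2, F.normal,
          LatticeSquare.ext hb.symm rfl⟩
    · rintro (hF | ⟨hF, j, rfl⟩)
      · exact hF.2
      · refine ⟨h.hasSquare_upper j, ?_, by rw [hs]; exact hF⟩
        change _ < ∑ k, (c + unit j) k
        rw [sum_add_unit]
        omega
  obtain ⟨hfin', hl', hsum⟩ := h.sitePair.transfer (m₀ := initialConfig) hheavy
    (fun m => ∏ᶠ F ∈ C, weightAt m F) hw (ht ▸ hfin) fun m' h1 h2 => hl m' (ht'.2 ⟨h1, h2⟩)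
  refine ⟨fun m hm => hl' m (ht'.1 hm).1 (ht'.1 hm).2, ht ▸ hfin', ?_⟩
  have f1 : (ht (U := U) ▸ hfin' : {m | IsTaut U m}.Finite).toFinset = hfin'.toFinset := by
    ext m; simp [ht']
  have f2 : hfin.toFinset = (ht (U := U') ▸ hfin : Set.Finite _).toFinset := by
    ext m; simp [ht']
  rw [f1, f2]
  refine (Finset.sum_congr rfl fun m _ => by rw [e1]; congr!).trans (hsum.trans
    (Finset.sum_congr rfl fun m hm => ?_))
  rw [Set.Finite.mem_toFinset] at hm
  rw [e2 m hm.1]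
  congr!

end DoubleDimer

namespace DoubleDimer

/-! ### The graph of the orthant -/

theorem sgn_true : sgn true = 1 := rfl

theorem sgn_false : sgn false = 2 := rfl

theorem hasSquare_orthant {x : Pt} {i : Fin 3} : orthantSolid.HasSquare ⟨x, i⟩ ↔
    x i = 0 ∧ ∀ s, x (i + sgn s) ≤ -1 := by
  have h1 : ∀ c : Pt, c ∈ orthantSolid ↔ ∀ l, c l + 1 ≤ 0 := fun c => Iff.rfl
  rw [SteppedSolid.HasSquare, h1, h1]
  fin_cases i <;> simp [Fin.forall_fin_succ, sgn_true, sgn_false, Pi.single_apply] <;> omega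

theorem hasSquare_orthant_sub {x : Pt} {i : Fin 3} (h : orthantSolid.HasSquare ⟨x, i⟩) (s : Bool) :
    orthantSolid.HasSquare ⟨x - unit (i + sgn s), i⟩ := by
  rw [hasSquare_orthant] at *
  revert h
  fin_cases i <;> cases s <;> simp [sgn_true, sgn_false, Pi.single_apply] <;> omega

theorem hasSquare_orthant_add {x : Pt} {i : Fin 3} (h : orthantSolid.HasSquare ⟨x, i⟩) {s : Bool}
    (hx : x (i + sgn s) ≠ -1) : orthantSolid.HasSquare ⟨x + unit (i + sgn s), i⟩ := by
  rw [hasSquare_orthant] at *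
  revert h hx
  fin_cases i <;> cases s <;> simp [sgn_true, sgn_false, Pi.single_apply] <;> omega

theorem hasSquare_orthant_cross {x : Pt} {i : Fin 3} (h : orthantSolid.HasSquare ⟨x, i⟩) {s : Bool}
    (hx : x (i + sgn s) = -1) :
    orthantSolid.HasSquare ⟨x + unit (i + sgn s) - unit i, i + sgn s⟩ := by
  rw [hasSquare_orthant] at *
  revert h hx
  fin_cases i <;> cases s <;> simp [sgn_true, sgn_false, Pi.single_apply] <;> omega

/-- The vertex at the lower side of a square in direction `i + sgn s`. -/
def lo (x : Pt) (i : Fin 3) (s : Bool) : Vertex := (⟨x, i⟩, ⟨x, i + sgn s⟩)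

/-- The vertex at the upper side of a square in direction `i + sgn s`. -/
def up (x : Pt) (i : Fin 3) (s : Bool) : Vertex :=
  (⟨x, i⟩, ⟨x + unit (i + sgn (!s)), i + sgn s⟩)

theorem lo_mem {x : Pt} {i : Fin 3} (h : orthantSolid.HasSquare ⟨x, i⟩) (s : Bool) :
    lo x i s ∈ vertices orthantSolid := by
  refine ⟨h, ?_, Or.inl rfl⟩
  have : ∀ i s, i + sgn s ≠ i := by decide
  exact this i s

theorem up_mem {x : Pt} {i : Fin 3} (h : orthantSolid.HasSquare ⟨x, i⟩) (s : Bool) :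
    up x i s ∈ vertices orthantSolid := by
  have : ∀ i s, i + sgn s ≠ i := by decide
  have h2 : ∀ i s, i + sgn (!s) ≠ i + sgn s := by decide
  exact ⟨h, this i s, Or.inr ⟨i + sgn (!s), this i _, h2 i s, rfl⟩⟩

theorem eq_lo_or_up {p : Vertex} (h : p ∈ vertices orthantSolid) :
    ∃ x i s, orthantSolid.HasSquare ⟨x, i⟩ ∧ (p = lo x i s ∨ p = up x i s) := by
  obtain ⟨⟨x, i⟩, ⟨y, j⟩⟩ := p
  obtain ⟨h1, h2, h3⟩ := h
  have key : ∀ i j : Fin 3, j ≠ i → ∃ s, j = i + sgn s := by decide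
  obtain ⟨s, hs⟩ := key i j h2
  subst hs
  refine ⟨x, i, s, h1, ?_⟩
  rcases h3 with h3 | ⟨k, hk1, hk2, h3⟩
  · exact Or.inl (Prod.ext rfl (LatticeEdge.ext h3 rfl))
  · have key : ∀ (i : Fin 3) s k, k ≠ i → k ≠ i + sgn s → k = i + sgn (!s) := by decide
    obtain rfl := key i s k hk1 hk2
    exact Or.inr (Prod.ext rfl (LatticeEdge.ext h3 rfl))

theorem lo_inj {x y : Pt} {i j : Fin 3} {s t : Bool} :
    lo x i s = lo y j t ↔ x = y ∧ i = j ∧ s = t := by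
  have : ∀ (i : Fin 3) s t, i + sgn s = i + sgn t → s = t := by decide
  constructor
  · intro h
    simp only [lo, Prod.mk.injEq, LatticeSquare.mk.injEq, LatticeEdge.mk.injEq] at h
    obtain ⟨⟨rfl, rfl⟩, -, h⟩ := h
    exact ⟨rfl, rfl, this _ _ _ h⟩
  · rintro ⟨rfl, rfl, rfl⟩; rfl

theorem up_inj {x y : Pt} {i j : Fin 3} {s t : Bool} :
    up x i s = up y j t ↔ x = y ∧ i = j ∧ s = t := by
  have : ∀ (i : Fin 3) s t, i + sgn s = i + sgn t → s = t := by decide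
  constructor
  · intro h
    simp only [up, Prod.mk.injEq, LatticeSquare.mk.injEq, LatticeEdge.mk.injEq] at h
    obtain ⟨⟨rfl, rfl⟩, -, h⟩ := h
    exact ⟨rfl, rfl, this _ _ _ h⟩
  · rintro ⟨rfl, rfl, rfl⟩; rfl

theorem lo_ne_up {x y : Pt} {i j : Fin 3} {s t : Bool} : lo x i s ≠ up y j t := by
  intro h
  simp only [lo, up, Prod.mk.injEq, LatticeSquare.mk.injEq, LatticeEdge.mk.injEq] at h
  obtain ⟨⟨rfl, rfl⟩, h, -⟩ := h
  simp at h

theorem dir_eq {i j : Fin 3} {s t : Bool} (h : i + sgn s = j + sgn t) :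
    (i = j ∧ s = t) ∨ (j = i + sgn (!s) ∧ t = !s ∧ i = i + sgn (!s) + sgn s) := by
  revert i j s t; decide

/-- The two endpoints of a leg. -/
def IsLeg (p q : Vertex) : Prop :=
  p ∈ vertices orthantSolid ∧ q ∈ vertices orthantSolid ∧ p.1 ≠ q.1 ∧ p.2 = q.2

theorem IsLeg.symm {p q : Vertex} (h : IsLeg p q) : IsLeg q p :=
  ⟨h.2.1, h.1, h.2.2.1.symm, h.2.2.2.symm⟩

theorem isLeg_lo {x : Pt} {i : Fin 3} {s : Bool} (h : orthantSolid.HasSquare ⟨x, i⟩) :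
    IsLeg (lo x i s) (up (x - unit (i + sgn (!s))) i s) := by
  refine ⟨lo_mem h s, up_mem (hasSquare_orthant_sub h _) s, ?_, ?_⟩
  · simp [lo, up, eq_sub_iff_add_eq]
  · simp [lo, up]

theorem isLeg_up_up {x : Pt} {i : Fin 3} {s : Bool} (h : orthantSolid.HasSquare ⟨x, i⟩)
    (hx : x (i + sgn (!s)) = -1) :
    IsLeg (up x i s) (up (x + unit (i + sgn (!s)) - unit i) (i + sgn (!s)) (!s)) := by
  have key : ∀ (i : Fin 3) s, i + sgn (!s) ≠ i ∧ i + sgn (!s) + sgn (!!s) = i ∧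
    i + sgn (!s) + sgn (!s) = i + sgn s := by decide
  obtain ⟨h1, h2, h3⟩ := key i s
  refine ⟨up_mem h s, up_mem (hasSquare_orthant_cross h hx) _, fun e => ?_, ?_⟩
  · exact h1 (congrArg LatticeSquare.normal e).symm
  · simp only [up]
    rw [h2, h3, sub_add_cancel]

theorem isLeg_up_lo {x : Pt} {i : Fin 3} {s : Bool} (h : orthantSolid.HasSquare ⟨x, i⟩)
    (hx : x (i + sgn (!s)) ≠ -1) : IsLeg (up x i s) (lo (x + unit (i + sgn (!s))) i s) := by
  have := isLeg_lo (s := s) (hasSquare_orthant_add h hx)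
  rw [add_sub_cancel_right] at this
  exact this.symm

theorem IsLeg.eq_of_lo {x : Pt} {i : Fin 3} {s : Bool} {q : Vertex} (h : IsLeg (lo x i s) q) :
    q = up (x - unit (i + sgn (!s))) i s := by
  obtain ⟨hx, hq, hne, he⟩ := h
  obtain ⟨y, j, t, hy, rfl | rfl⟩ := eq_lo_or_up hq
  · obtain ⟨h1, h2⟩ := LatticeEdge.ext_iff.1 he
    obtain rfl : x = y := h1
    rcases dir_eq h2 with ⟨rfl, rfl⟩ | ⟨rfl, rfl, h3⟩
    · exact (hne rfl).elim
    · have h4 := (hasSquare_orthant.1 hx.1).1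
      have h5 := (hasSquare_orthant.1 hy).2 s
      rw [← h3] at h5
      omega
  · obtain ⟨h1, h2⟩ := LatticeEdge.ext_iff.1 he
    change x = y + unit (j + sgn (!t)) at h1
    rcases dir_eq h2 with ⟨rfl, rfl⟩ | ⟨rfl, rfl, h3⟩
    · rw [h1, add_sub_cancel_right]
    · have h4 := (hasSquare_orthant.1 hx.1).2 (!s)
      have h5 := (hasSquare_orthant.1 hy).1
      rw [Bool.not_not, ← h3] at h1
      have h6 : ∀ i s, i + sgn (!s) ≠ i := by decide
      rw [h1, Pi.add_apply, h5, unit, Pi.single_eq_of_ne (h6 i s)] at h4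
      simp at h4

theorem IsLeg.eq_of_up {x : Pt} {i : Fin 3} {s : Bool} {q : Vertex} (h : IsLeg (up x i s) q) :
    (x (i + sgn (!s)) ≠ -1 ∧ q = lo (x + unit (i + sgn (!s))) i s) ∨
      (x (i + sgn (!s)) = -1 ∧
        q = up (x + unit (i + sgn (!s)) - unit i) (i + sgn (!s)) (!s)) := by
  obtain ⟨y, j, t, hy, rfl | rfl⟩ := eq_lo_or_up h.2.1
  · obtain ⟨rfl, rfl, rfl⟩ := up_inj.1 h.symm.eq_of_lo
    refine Or.inl ⟨?_, by rw [sub_add_cancel]⟩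
    have := (hasSquare_orthant.1 hy).2 (!s)
    simp only [Pi.sub_apply, unit, Pi.single_eq_same]
    omega
  · obtain ⟨hx, hq, hne, he⟩ := h
    obtain ⟨h1, h2⟩ := LatticeEdge.ext_iff.1 he
    change x + unit (i + sgn (!s)) = y + unit (j + sgn (!t)) at h1
    rcases dir_eq h2 with ⟨rfl, rfl⟩ | ⟨rfl, rfl, h3⟩
    · exact (hne (congrArg (LatticeSquare.mk · i) (add_right_cancel h1))).elim
    · right
      rw [Bool.not_not, ← h3] at h1
      have h5 := (hasSquare_orthant.1 hy).1
      have h6 : ∀ i s, i + sgn (!s) ≠ i := by decide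
      have h7 := congrFun h1 (i + sgn (!s))
      rw [Pi.add_apply, Pi.add_apply, h5, unit, unit, Pi.single_eq_of_ne (h6 i s),
        Pi.single_eq_same] at h7
      exact ⟨by omega, by rw [h1, add_sub_cancel_right]⟩

/-- The leg at a vertex is unique. -/
theorem IsLeg.unique {p q r : Vertex} (h : IsLeg p q) (h' : IsLeg p r) : q = r := by
  obtain ⟨x, i, s, hx, rfl | rfl⟩ := eq_lo_or_up h.1
  · rw [h.eq_of_lo, h'.eq_of_lo]
  · rcases h.eq_of_up with ⟨h1, h2⟩ | ⟨h1, h2⟩ <;> rcases h'.eq_of_up with ⟨h3, h4⟩ | ⟨h3, h4⟩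
    · rw [h2, h4]
    · exact (h1 h3).elim
    · exact (h3 h1).elim
    · rw [h2, h4]

/-- Every leg has an upper end. -/
theorem IsLeg.exists_up {p q : Vertex} (h : IsLeg p q) : ∃ x i s,
    orthantSolid.HasSquare ⟨x, i⟩ ∧ (p = up x i s ∨ q = up x i s) := by
  obtain ⟨x, i, s, hx, rfl | rfl⟩ := eq_lo_or_up h.1
  · exact ⟨_, i, s, hasSquare_orthant_sub hx _, Or.inr h.eq_of_lo⟩
  · exact ⟨x, i, s, hx, Or.inl rfl⟩

theorem exists_isLeg {p : Vertex} (h : p ∈ vertices orthantSolid) : ∃ q, IsLeg p q := by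
  obtain ⟨x, i, s, hx, rfl | rfl⟩ := eq_lo_or_up h
  · exact ⟨_, isLeg_lo hx⟩
  · by_cases hk : x (i + sgn (!s)) = -1
    · exact ⟨_, isLeg_up_up hx hk⟩
    · exact ⟨_, isLeg_up_lo hx hk⟩

theorem adj_orthant {p q : Vertex} : (assocGraph orthantSolid).Adj p q ↔ IsLeg p q ∨
    (∃ x i s, orthantSolid.HasSquare ⟨x, i⟩ ∧ (p = lo x i s ∨ p = up x i s) ∧
      (q = lo x i (!s) ∨ q = up x i (!s))) := by
  constructor
  · intro h
    obtain ⟨h1, h2, ⟨h3, h4⟩ | ⟨h3, h4⟩⟩ := adj_iff.1 h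
    · right
      obtain ⟨x, i, s, hx, hp⟩ := eq_lo_or_up h1
      obtain ⟨y, j, t, hy, hq⟩ := eq_lo_or_up h2
      have h5 : p.1 = ⟨x, i⟩ ∧ p.2.dir = i + sgn s := by rcases hp with rfl | rfl <;> exact ⟨rfl, rfl⟩
      have h6 : q.1 = ⟨y, j⟩ ∧ q.2.dir = j + sgn t := by rcases hq with rfl | rfl <;> exact ⟨rfl, rfl⟩
      rw [h5.1, h6.1, LatticeSquare.mk.injEq] at h3
      obtain ⟨rfl, rfl⟩ := h3
      rw [h5.2, h6.2] at h4
      obtain rfl : t = !s := by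
        cases s <;> cases t <;> simp at h4 ⊢
      exact ⟨x, i, s, hx, hp, hq⟩
    · exact Or.inl ⟨h1, h2, h3, h4⟩
  · rintro (h | ⟨x, i, s, hx, hp, hq⟩)
    · exact adj_iff.2 ⟨h.1, h.2.1, Or.inr h.2.2⟩
    · have key : ∀ (i : Fin 3) s, i + sgn s ≠ i + sgn (!s) := by decide
      refine adj_iff.2 ⟨?_, ?_, Or.inl ?_⟩
      · rcases hp with rfl | rfl
        exacts [lo_mem hx s, up_mem hx s]
      · rcases hq with rfl | rfl
        exacts [lo_mem hx _, up_mem hx _]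
      · rcases hp with rfl | rfl <;> rcases hq with rfl | rfl <;> exact ⟨rfl, key i s⟩

theorem initialConfig_adj {p q : Vertex} : initialConfig.Adj p q ↔ IsLeg p q ∨
    (∃ x i s, orthantSolid.HasSquare ⟨x, i⟩ ∧ ((p = lo x i s ∧ q = up x i (!s)) ∨
      (p = up x i s ∧ q = lo x i (!s)))) := by
  have hu : ∀ x i s, (up x i s).2.base ≠ (up x i s).1.base := fun x i s => by simp [up]
  have hl : ∀ x i s, (lo x i s).2.base = (lo x i s).1.base := fun x i s => rfl
  change (assocGraph orthantSolid).Adj p q ∧ _ ↔ _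
  rw [adj_orthant]
  constructor
  · rintro ⟨h | ⟨x, i, s, hx, hp, hq⟩, h2⟩
    · exact Or.inl h
    · refine Or.inr ⟨x, i, s, hx, ?_⟩
      rcases hp with rfl | rfl <;> rcases hq with rfl | rfl
      · exact ((h2 rfl).1 (hl ..) (hl ..)).elim
      · exact Or.inl ⟨rfl, rfl⟩
      · exact Or.inr ⟨rfl, rfl⟩
      · exact (hu _ _ _ ((h2 rfl).2 (hu _ _ _))).elim
  · rintro (h | ⟨x, i, s, hx, ⟨rfl, rfl⟩ | ⟨rfl, rfl⟩⟩)
    · exact ⟨Or.inl h, fun e => (h.2.2.1 e).elim⟩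
    · exact ⟨Or.inr ⟨x, i, s, hx, Or.inl rfl, Or.inr rfl⟩,
        fun _ => iff_of_true (hl ..) (hu _ _ _)⟩
    · exact ⟨Or.inr ⟨x, i, s, hx, Or.inr rfl, Or.inl rfl⟩,
        fun _ => iff_of_false (hu _ _ _) (not_not.2 (hl ..))⟩

end DoubleDimer

namespace DoubleDimer

/-! ### Paths of the initial configuration -/

/-- An invariant of the paths of the initial configuration. -/
def edgeLabel (e : LatticeEdge) : Pt := fun l =>
  min 0 ((2 • e.base + unit e.dir) l -
    min ((2 • e.base + unit e.dir) (l + 1)) ((2 • e.base + unit e.dir) (l + 2)))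

/-- The label is computed from the doubled midpoint of the edge. In the plane `x i = 0` its entry at
`i` is zero, and the other two are the minima of zero and plus or minus the difference of the
coordinates in the plane. Passing through a square along the path shifts both coordinates by the
same amount. -/
theorem edgeLabel_up {x : Pt} {i : Fin 3} (h : orthantSolid.HasSquare ⟨x, i⟩) (s : Bool) :
    edgeLabel (up x i s).2 = edgeLabel (lo x i (!s)).2 := by
  rw [hasSquare_orthant] at h
  funext l
  revert h
  fin_cases i <;> cases s <;> fin_cases l <;>
    simp [sgn_true, sgn_false, edgeLabel, up, lo] <;> omega

theorem edgeLabel_eq {p q : Vertex} (h : initialConfig.Adj p q) :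
    edgeLabel p.2 = edgeLabel q.2 := by
  rcases initialConfig_adj.1 h with h | ⟨x, i, s, hx, ⟨rfl, rfl⟩ | ⟨rfl, rfl⟩⟩
  · rw [h.2.2.2]
  · rw [edgeLabel_up hx, Bool.not_not]
  · rw [edgeLabel_up hx]

theorem edgeLabel_eq_of_reachable {p q : Vertex} (h : initialConfig.Reachable p q) :
    edgeLabel p.2 = edgeLabel q.2 := by
  obtain ⟨W⟩ := h
  induction W with
  | nil => rfl
  | cons h _ ih => exact (edgeLabel_eq h).trans ih

/-- Since `min 0 d - min 0 (-d) = d`, the label recovers the diagonal of the plane on which the path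
lies. -/
theorem edgeLabel_up_sub {x : Pt} {i : Fin 3} (h : orthantSolid.HasSquare ⟨x, i⟩) (s : Bool) :
    edgeLabel (up x i s).2 (i + 1) - edgeLabel (up x i s).2 (i + 2) =
      2 * x (i + 1) - 2 * x (i + 2) + if s then -1 else 1 := by
  rw [hasSquare_orthant] at h
  revert h
  fin_cases i <;> cases s <;>
    simp [sgn_true, sgn_false, edgeLabel, up] <;> omega

theorem initialConfig_reachable_half {x : Pt} {i : Fin 3} (h : orthantSolid.HasSquare ⟨x, i⟩)
    (s : Bool) : initialConfig.Reachable (up x i s) (up (x - unit (i + sgn s)) i (!s)) := by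
  have h1 : initialConfig.Adj (up x i s) (lo x i (!s)) :=
    initialConfig_adj.2 (Or.inr ⟨x, i, s, h, Or.inr ⟨rfl, rfl⟩⟩)
  have h2 := isLeg_lo (s := !s) h
  rw [Bool.not_not] at h2
  exact h1.reachable.trans (initialConfig_adj.2 (Or.inl h2)).reachable

theorem exists_reachable_down {x : Pt} {i : Fin 3} (h : orthantSolid.HasSquare ⟨x, i⟩) (s : Bool)
    (n : ℕ) : ∃ y t, orthantSolid.HasSquare ⟨y, i⟩ ∧
      initialConfig.Reachable (up x i s) (up y i t) ∧ y ≤ x ∧ ∑ k, y k = ∑ k, x k - n := by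
  induction n with
  | zero => exact ⟨x, s, h, SimpleGraph.Reachable.refl _, le_rfl, by simp⟩
  | succ n ih =>
    obtain ⟨y, t, h1, h2, h3, h4⟩ := ih
    refine ⟨y - unit (i + sgn t), !t, hasSquare_orthant_sub h1 t,
      h2.trans (initialConfig_reachable_half h1 t), le_trans (by simp) h3, ?_⟩
    have := sum_add_unit (y - unit (i + sgn t)) (i + sgn t)
    rw [sub_add_cancel] at this
    push_cast
    omega

theorem infinite_down {x : Pt} {i : Fin 3} (h : orthantSolid.HasSquare ⟨x, i⟩) (s : Bool) :
    {q | initialConfig.Reachable (up x i s) q ∧ q.1.normal = i ∧ q.1.base ≤ x}.Infinite := by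
  intro hfin
  obtain ⟨b, hb⟩ := (hfin.image fun q => ∑ k, q.1.base k).bddBelow
  obtain ⟨y, t, -, h2, h3, h4⟩ := exists_reachable_down h s (∑ k, x k - b + 1).toNat
  have := hb ⟨up y i t, ⟨h2, rfl, h3⟩, rfl⟩
  change b ≤ ∑ k, y k at this
  omega

/-- Towards the origin each step raises the coordinate sum of the base by one, while this sum is at
most `-2`; so an axis is reached, and there the leg enters another plane. -/
theorem exists_reachable_cross (n : ℕ) {x : Pt} {i : Fin 3}
    (h : orthantSolid.HasSquare ⟨x, i⟩) (s : Bool) (hn : -n ≤ ∑ k, x k) :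
    ∃ y j t, j ≠ i ∧ orthantSolid.HasSquare ⟨y, j⟩ ∧
      initialConfig.Reachable (up x i s) (up y j t) := by
  induction n generalizing x s with
  | zero =>
    exfalso
    have h' := hasSquare_orthant.1 h
    have h0 := h'.2 true
    have h1 := h'.2 false
    have key : ∑ k, x k = x i + x (i + 1) + x (i + 2) := by
      rw [Fin.sum_univ_three]
      fin_cases i <;> simp <;> ring
    simp only [sgn_true, sgn_false] at h0 h1
    push_cast at hn
    omega
  | succ n ih =>
    by_cases hk : x (i + sgn (!s)) = -1
    · have key : ∀ i s, i + sgn (!s) ≠ i := by decide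
      exact ⟨_, _, _, key i s, hasSquare_orthant_cross h hk,
        (initialConfig_adj.2 (Or.inl (isLeg_up_up h hk))).reachable⟩
    · have hs := hasSquare_orthant_add h hk
      obtain ⟨y, j, t, h1, h2, h3⟩ := ih hs (!s) (by rw [sum_add_unit]; push_cast at hn; omega)
      refine ⟨y, j, t, h1, h2, ((initialConfig_adj.2 (Or.inl (isLeg_up_lo h hk))).reachable.trans
        ?_).trans h3⟩
      exact (initialConfig_adj.2 (Or.inr ⟨_, i, s, hs, Or.inl ⟨rfl, rfl⟩⟩)).reachable

theorem infinite_cross {x : Pt} {i : Fin 3} (h : orthantSolid.HasSquare ⟨x, i⟩) (s : Bool) :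
    {q | initialConfig.Reachable (up x i s) q ∧ q.1.normal ≠ i}.Infinite := by
  obtain ⟨y, j, t, h1, h2, h3⟩ := exists_reachable_cross (-∑ k, x k).toNat h s (by omega)
  exact (infinite_down h2 t).mono fun q hq => ⟨h3.trans hq.1, by rw [hq.2.1]; exact h1⟩

/-! ### Gates -/

/-- The part of a coordinate plane outside of the rectangle with corner `w`. -/
def planeRegion (i : Fin 3) (w : Pt) : Set Vertex :=
  {p | p.1.normal = i ∧ ∃ s, p.1.base (i + sgn s) < w (i + sgn s)}

/-- The inner ends of the legs that leave `planeRegion i w`. -/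
def gates (i : Fin 3) (w : Pt) : Set Vertex :=
  {p | p ∈ planeRegion i w ∧ ∃ q, IsLeg p q ∧ q ∉ planeRegion i w}

variable {i : Fin 3} {w : Pt} {m : SimpleGraph Vertex}

/-- A leg at a lower side leads further away from the origin in the same plane and stays in the
region. Hence a gate is at an upper side and leads into the rectangle or across an axis. -/
theorem eq_up_of_mem_gates (hw : w ≤ 0) {p : Vertex} (hp : p ∈ gates i w) :
    ∃ x s, orthantSolid.HasSquare ⟨x, i⟩ ∧ p = up x i s ∧
      ((w (i + sgn s) ≤ x (i + sgn s) ∧ x (i + sgn (!s)) + 1 = w (i + sgn (!s))) ∨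
        (x (i + sgn s) < w (i + sgn s) ∧ x (i + sgn (!s)) = -1)) := by
  obtain ⟨⟨h1, t, h2⟩, q, hq, h3⟩ := hp
  obtain ⟨x, j, s, hx, h⟩ := eq_lo_or_up hq.1
  obtain rfl : j = i := by rcases h with rfl | rfl <;> exact h1
  rcases h with rfl | rfl
  · refine (h3 ?_).elim
    rw [hq.eq_of_lo]
    exact ⟨rfl, t, ((sub_le_self x (by simp)) (j + sgn t)).trans_lt h2⟩
  · refine ⟨x, s, hx, rfl, ?_⟩
    have h2' : x (j + sgn s) < w (j + sgn s) ∨ x (j + sgn (!s)) < w (j + sgn (!s)) := by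
      by_cases hs : t = s
      · subst hs; exact Or.inl h2
      · obtain rfl : t = !s := by cases s <;> cases t <;> simp at hs ⊢
        exact Or.inr h2
    have h4 := hw (j + sgn (!s))
    change w _ ≤ 0 at h4
    rcases hq.eq_of_up with ⟨hk, rfl⟩ | ⟨hk, rfl⟩
    · have h5 : ¬ (x + unit (j + sgn (!s))) (j + sgn s) < w (j + sgn s) := fun h => h3 ⟨rfl, s, h⟩
      have h6 : ¬ (x + unit (j + sgn (!s))) (j + sgn (!s)) < w (j + sgn (!s)) :=
        fun h => h3 ⟨rfl, !s, h⟩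
      have key : ∀ (i : Fin 3) s, i + sgn s ≠ i + sgn (!s) := by decide
      rw [Pi.add_apply, unit, Pi.single_eq_of_ne (key j s)] at h5
      rw [Pi.add_apply, unit, Pi.single_eq_same] at h6
      omega
    · omega

/-- The label determines the diagonal, and a diagonal going towards the origin leaves the region
only once. -/
theorem gates_label_injective (hw : w ≤ 0) {p q : Vertex} (hp : p ∈ gates i w)
    (hq : q ∈ gates i w) (h : edgeLabel p.2 = edgeLabel q.2) : p = q := by
  obtain ⟨x, s, hx, rfl, h1⟩ := eq_up_of_mem_gates hw hp
  obtain ⟨y, t, hy, rfl, h2⟩ := eq_up_of_mem_gates hw hq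
  have e1 := edgeLabel_up_sub hx s
  have e2 := edgeLabel_up_sub hy t
  rw [h, e2] at e1
  have f := (hasSquare_orthant.1 hx).2 true
  have f1 := (hasSquare_orthant.1 hx).2 false
  have f2 := (hasSquare_orthant.1 hy).2 true
  have f3 := (hasSquare_orthant.1 hy).2 false
  have f4 : w (i + 1) ≤ 0 := hw (i + 1)
  have f5 : w (i + 2) ≤ 0 := hw (i + 2)
  have key : s = t ∧ x (i + 1) = y (i + 1) ∧ x (i + 2) = y (i + 2) := by
    cases s <;> cases t <;> simp [sgn_true, sgn_false] at * <;> omega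
  have key2 : ∀ l i : Fin 3, l = i ∨ l = i + 1 ∨ l = i + 2 := by decide
  obtain ⟨rfl, h3, h4⟩ := key
  refine up_inj.2 ⟨funext fun l => ?_, rfl, rfl⟩
  rcases key2 l i with rfl | rfl | rfl
  · rw [(hasSquare_orthant.1 hx).1, (hasSquare_orthant.1 hy).1]
  · exact h3
  · exact h4

/-- Injectivity keeps moved points among the moved points, where finiteness gives surjectivity. -/
theorem surjective_of_finite_ne {α : Type*} {f : α → α} (hf : Function.Injective f)
    (h : {a | f a ≠ a}.Finite) : Function.Surjective f := by
  intro a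
  by_cases ha : f a = a
  · exact ⟨a, ha⟩
  · have hm : Set.MapsTo f {a | f a ≠ a} {a | f a ≠ a} := fun b hb e => hb (hf e)
    obtain ⟨b, -, hb⟩ := ((h.injOn_iff_bijOn_of_mapsTo hm).1 hf.injOn).surjOn ha
    exact ⟨b, hb⟩

theorem infinite_gate_in (hw : w ≤ 0) {p : Vertex} (hp : p ∈ gates i w) :
    {q | initialConfig.Reachable p q ∧ q ∈ planeRegion i w}.Infinite := by
  obtain ⟨⟨-, t, h⟩, -⟩ := id hp
  obtain ⟨x, s, hx, rfl, -⟩ := eq_up_of_mem_gates hw hp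
  exact (infinite_down hx s).mono fun q hq => ⟨hq.1, hq.2.1, t, (hq.2.2 _).trans_lt h⟩

theorem infinite_gate_out (hw : w ≤ 0) {p : Vertex} (hp : p ∈ gates i w) :
    {q | initialConfig.Reachable p q ∧ q ∉ planeRegion i w}.Infinite := by
  obtain ⟨x, s, hx, rfl, -⟩ := eq_up_of_mem_gates hw hp
  exact (infinite_cross hx s).mono fun q hq => ⟨hq.1, fun h => hq.2 h.1⟩

theorem IsConfig.adj_graph {G : SimpleGraph Vertex} {S : Set Vertex} (h : IsConfig G S m)
    {p q : Vertex} (hpq : m.Adj p q) : G.Adj p q := h.1.adj p q ((h.adj_iff p q).1 hpq)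

theorem exists_gate_of_reachable (hm : IsConfig (assocGraph orthantSolid) (vertices orthantSolid) m)
    {p q : Vertex} (h : m.Reachable p q) (hp : p ∈ planeRegion i w) (hq : q ∉ planeRegion i w) :
    ∃ a ∈ gates i w, m.Reachable p a ∧ ∃ b, IsLeg a b ∧ m.Adj a b := by
  classical
  obtain ⟨W⟩ := h
  obtain ⟨d, hd, h1, h2⟩ := W.exists_boundary_dart (planeRegion i w) hp hq
  have hr : m.Reachable p d.fst := ⟨W.takeUntil _ (W.dart_fst_mem_support_of_mem_darts hd)⟩
  rcases adj_orthant.1 (hm.adj_graph d.adj) with h3 | ⟨x, j, s, -, h3, h4⟩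
  · exact ⟨d.fst, ⟨h1, _, h3, h2⟩, hr, _, h3, d.adj⟩
  · have : d.fst.1 = d.snd.1 := by
      rcases h3 with h3 | h3 <;> rcases h4 with h4 | h4 <;> rw [h3, h4] <;> rfl
    exact (h2 (by rw [planeRegion, Set.mem_ofPred_eq, ← this]; exact h1)).elim

/-- In a configuration with the ends of the initial one, every gate is used, by different infinite
paths. -/
theorem gates_used (hm : IsConfig (assocGraph orthantSolid) (vertices orthantSolid) m)
    (he : SameEnds m initialConfig) (hw : w ≤ 0) {p : Vertex} (hp : p ∈ gates i w) :
    (∃ q, IsLeg p q ∧ m.Adj p q) ∧ (m.connectedComponentMk p).supp.Infinite ∧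
      ∀ q ∈ gates i w, m.Reachable p q → p = q := by
  obtain ⟨K, hK, hagree, φ, hφ⟩ := he
  -- `C p` is the path of `m` that agrees off `K` with the initial path through the gate `p`.
  have hC : ∀ p : gates i w, ∃ C : InfinitePath m, ∀ q, q ∉ K →
      (q ∈ C.1.supp ↔ initialConfig.Reachable p q) := fun p => by
    refine ⟨φ.symm ⟨initialConfig.connectedComponentMk p,
      (infinite_gate_in hw p.2).mono fun q hq => ?_⟩, fun q hq => ?_⟩
    · exact (SimpleGraph.ConnectedComponent.sound hq.1).symm
    · have := congrArg (q ∈ ·) (hφ (φ.symm ⟨initialConfig.connectedComponentMk p,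
        (infinite_gate_in hw p.2).mono fun q hq =>
          (SimpleGraph.ConnectedComponent.sound hq.1).symm⟩))
      simp only [Set.mem_sdiff, hq, not_false_eq_true, and_true, Equiv.apply_symm_apply,
        eq_iff_iff] at this
      rw [this, SimpleGraph.ConnectedComponent.mem_supp_iff, SimpleGraph.ConnectedComponent.eq]
      exact ⟨fun h => h.symm, fun h => h.symm⟩
  choose C hC using hC
  -- The path `C p` has vertices off `K` on both sides of the region's boundary, so it crosses at
  -- some gate. If `p` is off `K`, then `p` itself can be taken.
  have hf : ∀ p : gates i w, ∃ a : gates i w, a.1 ∈ (C p).1.supp ∧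
      (∃ b, IsLeg a b ∧ m.Adj a b) ∧ (p.1 ∉ K → a = p) := fun p => by
    by_cases hpK : p.1 ∈ K
    · obtain ⟨a, ha, haK⟩ := ((infinite_gate_in hw p.2).sdiff hK).nonempty
      obtain ⟨b, hb, hbK⟩ := ((infinite_gate_out hw p.2).sdiff hK).nonempty
      have h1 := (hC p a haK).2 ha.1
      have h2 := (hC p b hbK).2 hb.1
      have hr : m.Reachable a b := SimpleGraph.ConnectedComponent.exact (h1.trans h2.symm)
      obtain ⟨c, hc, h3, h4⟩ := exists_gate_of_reachable hm hr ha.2 hb.2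
      exact ⟨⟨c, hc⟩, (SimpleGraph.ConnectedComponent.sound h3.symm).trans h1, h4,
        fun h => (h hpK).elim⟩
    · obtain ⟨-, b, hb, -⟩ := id p.2
      exact ⟨p, (hC p p hpK).2 (SimpleGraph.Reachable.refl _),
        ⟨b, hb, (hagree _ _ hpK).2 (initialConfig_adj.2 (Or.inl hb))⟩, fun _ => rfl⟩
  choose f hf using hf
  have hCinj : Function.Injective C := fun p q h => by
    obtain ⟨a, ha, haK⟩ := ((C p).2.sdiff hK).nonempty
    have h1 := (hC p a haK).1 ha
    have h2 := (hC q a haK).1 (h ▸ ha)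
    exact Subtype.ext (gates_label_injective hw p.2 q.2
      (edgeLabel_eq_of_reachable (h1.trans h2.symm)))
  have hfC : ∀ p q, m.Reachable (f p).1 (f q).1 → p = q := fun p q h => by
    refine hCinj (Subtype.ext ?_)
    have h1 := (hf p).1
    have h2 := (hf q).1
    rw [SimpleGraph.ConnectedComponent.mem_supp_iff] at h1 h2
    rw [← h1, ← h2]
    exact SimpleGraph.ConnectedComponent.sound h
  -- The map `f` is injective because distinct gates have distinct paths, and it moves only gates in
  -- the finite set `K`.
  have hsurj : Function.Surjective f := by
    refine surjective_of_finite_ne (fun p q h => hfC p q (h ▸ SimpleGraph.Reachable.refl _)) ?_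
    refine (hK.preimage (f := Subtype.val) Subtype.val_injective.injOn).subset fun p hp => ?_
    by_contra h
    exact hp ((hf p).2.2 h)
  obtain ⟨a, ha⟩ := hsurj ⟨p, hp⟩
  have h1 := hf a
  rw [ha] at h1
  refine ⟨h1.2.1, ?_, fun q hq h => ?_⟩
  · have := h1.1
    rw [SimpleGraph.ConnectedComponent.mem_supp_iff] at this
    rw [this]
    exact (C a).2
  · obtain ⟨b, hb⟩ := hsurj ⟨q, hq⟩
    have : a = b := hfC a b (by rw [ha, hb]; exact h)
    subst this
    exact congrArg Subtype.val (ha.symm.trans hb)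

end DoubleDimer

namespace DoubleDimer

/-! ### Uniqueness of the taut configuration on the orthant -/

variable {m : SimpleGraph Vertex}

/-- The rectangle is chosen so that its corner lies just across the side in question; thus every leg
is a gate for a suitable rectangle. -/
theorem up_mem_gates {x : Pt} {i : Fin 3} (h : orthantSolid.HasSquare ⟨x, i⟩) (s : Bool) :
    up x i s ∈ gates i (x + unit (i + sgn (!s))) := by
  refine ⟨⟨rfl, !s, ?_⟩, ?_⟩
  · rw [Pi.add_apply, unit, Pi.single_eq_same]
    exact lt_add_one (x _)
  · by_cases hk : x (i + sgn (!s)) = -1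
    · refine ⟨_, isLeg_up_up h hk, fun h' => ?_⟩
      have key : ∀ i s, i + sgn (!s) ≠ i := by decide
      exact key i s h'.1
    · exact ⟨_, isLeg_up_lo h hk, fun ⟨_, t, h'⟩ => lt_irrefl _ h'⟩

theorem add_unit_nonpos {x : Pt} {i : Fin 3} (h : orthantSolid.HasSquare ⟨x, i⟩) (s : Bool) :
    x + unit (i + sgn s) ≤ 0 := by
  rw [hasSquare_orthant] at h
  intro l
  revert h
  fin_cases i <;> cases s <;> fin_cases l <;> simp [sgn_true, sgn_false] <;> omega

/-- Without another neighbour the edge would be doubled, and its component would have only two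
vertices. -/
theorem exists_adj_ne_of_infinite {G : SimpleGraph Vertex} {S : Set Vertex} (hm : IsConfig G S m)
    {p q : Vertex} (h : m.Adj p q) (hi : (m.connectedComponentMk p).supp.Infinite) :
    ∃ r, r ≠ q ∧ m.Adj p r := by
  by_contra hr
  have h1 : mult m p q = 2 := by rw [mult, if_pos h, if_neg hr]
  have h2 : ∀ r, m.Adj q r → r = p := by
    rw [hm.1.symm, mult, if_pos h.symm] at h1
    by_contra! h3
    obtain ⟨r, h3, h4⟩ := h3
    rw [if_pos ⟨r, h4, h3⟩] at h1
    omega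
  refine hi ((Set.toFinite {p, q}).subset fun z hz => ?_)
  have hz' : m.Reachable p z := (SimpleGraph.ConnectedComponent.exact hz).symm
  rw [SimpleGraph.reachable_iff_reflTransGen] at hz'
  induction hz' with
  | refl => exact Or.inl rfl
  | tail h3 h4 ih =>
    rcases ih ((SimpleGraph.ConnectedComponent.sound
      ((SimpleGraph.reachable_iff_reflTransGen _ _).2 h3)).symm) with rfl | h5
    · by_contra h6
      exact hr ⟨_, fun e => h6 (Or.inr e), h4⟩
    · obtain rfl := h5
      exact Or.inl (h2 _ h4)

theorem infinite_of_isLeg (hm : IsConfig (assocGraph orthantSolid) (vertices orthantSolid) m)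
    (he : SameEnds m initialConfig) {p q : Vertex} (h : IsLeg p q) :
    m.Adj p q ∧ (m.connectedComponentMk p).supp.Infinite := by
  have key : ∀ {x i s q}, orthantSolid.HasSquare ⟨x, i⟩ → IsLeg (up x i s) q →
      m.Adj (up x i s) q ∧ (m.connectedComponentMk (up x i s)).supp.Infinite := by
    intro x i s q hx h
    obtain ⟨⟨r, h1, h2⟩, h3, -⟩ := gates_used hm he (add_unit_nonpos hx _) (up_mem_gates hx s)
    exact ⟨h1.unique h ▸ h2, h3⟩
  obtain ⟨x, i, s, hx, rfl | rfl⟩ := h.exists_up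
  · exact key hx h
  · have := key hx h.symm
    exact ⟨this.1.symm, SimpleGraph.ConnectedComponent.sound this.1.reachable ▸ this.2⟩

theorem exists_adj_not_isLeg (hm : IsConfig (assocGraph orthantSolid) (vertices orthantSolid) m)
    (he : SameEnds m initialConfig) {p : Vertex} (h : p ∈ vertices orthantSolid) :
    ∃ r, ¬IsLeg p r ∧ m.Adj p r := by
  obtain ⟨q, hq⟩ := exists_isLeg h
  obtain ⟨h1, h2⟩ := infinite_of_isLeg hm he hq
  obtain ⟨r, h3, h4⟩ := exists_adj_ne_of_infinite hm h1 h2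
  exact ⟨r, fun h5 => h3 (h5.unique hq), h4⟩

theorem adj_eq_of_not_isLeg (hm : IsConfig (assocGraph orthantSolid) (vertices orthantSolid) m)
    (he : SameEnds m initialConfig) {p r r' : Vertex}
    (h1 : m.Adj p r) (h2 : m.Adj p r') (h3 : ¬IsLeg p r) (h4 : ¬IsLeg p r') : r = r' := by
  have hp : p ∈ vertices orthantSolid := (hm.adj_graph h1).1
  obtain ⟨q, hq⟩ := exists_isLeg hp
  have h5 := (infinite_of_isLeg hm he hq).1
  obtain ⟨a, b, hab, -⟩ := hm.1.two_ne_zero hp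
  simp only [← hm.adj_iff] at hab
  have h6 : r ≠ q := fun e => h3 (e ▸ hq)
  have h7 : r' ≠ q := fun e => h4 (e ▸ hq)
  have h8 := (hab _).1 h1
  have h9 := (hab _).1 h2
  have h10 := (hab _).1 h5
  rcases h8 with rfl | rfl <;> rcases h9 with rfl | rfl <;> rcases h10 with rfl | rfl <;>
    first | rfl | contradiction

theorem not_isLeg_of_eq {p q : Vertex} (h : p.1 = q.1) : ¬IsLeg p q := fun h' => h'.2.2.1 h

/-- The legs at both lower sides come from different gates of the rectangle with corner `x`. The
edge would put these gates on one path, contrary to `gates_used`. -/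
theorem not_adj_lo_lo (hm : IsConfig (assocGraph orthantSolid) (vertices orthantSolid) m)
    (he : SameEnds m initialConfig) {x : Pt} {i : Fin 3} (hx : orthantSolid.HasSquare ⟨x, i⟩)
    (s : Bool) : ¬m.Adj (lo x i s) (lo x i (!s)) := by
  intro h
  have h1 := (infinite_of_isLeg hm he (isLeg_lo (s := s) hx)).1
  have h2 := (infinite_of_isLeg hm he (isLeg_lo (s := !s) hx)).1
  have key : ∀ s, up (x - unit (i + sgn (!s))) i s ∈ gates i x := fun s => by
    have := up_mem_gates (hasSquare_orthant_sub hx (!s)) s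
    rwa [sub_add_cancel] at this
  have hw : x ≤ 0 := le_trans (le_add_unit x _) (add_unit_nonpos hx s)
  have h3 := (gates_used hm he hw (key s)).2.2 _ (key (!s))
    (h1.symm.reachable.trans (h.reachable.trans h2.reachable))
  simpa using (up_inj.1 h3).2.2

/-- A lower vertex of the square also needs one edge of the quadrilateral. The other lower vertex is
excluded by `not_adj_lo_lo`, and the adjacent upper vertex already has its only such edge. -/
theorem not_adj_up_up (hm : IsConfig (assocGraph orthantSolid) (vertices orthantSolid) m)
    (he : SameEnds m initialConfig) {x : Pt} {i : Fin 3} (hx : orthantSolid.HasSquare ⟨x, i⟩)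
    (s : Bool) : ¬m.Adj (up x i s) (up x i (!s)) := by
  intro h
  obtain ⟨r, h1, h2⟩ := exists_adj_not_isLeg hm he (lo_mem hx s)
  rcases adj_orthant.1 (hm.adj_graph h2) with h3 | ⟨y, j, t, -, h3 | h3, h4⟩
  · exact h1 h3
  · obtain ⟨rfl, rfl, rfl⟩ := lo_inj.1 h3
    rcases h4 with rfl | rfl
    · exact not_adj_lo_lo hm he hx _ h2
    · exact lo_ne_up (adj_eq_of_not_isLeg hm he h2.symm h.symm (not_isLeg_of_eq rfl)
        (not_isLeg_of_eq rfl))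
  · exact lo_ne_up h3

theorem eq_initialConfig (hm : IsConfig (assocGraph orthantSolid) (vertices orthantSolid) m)
    (he : SameEnds m initialConfig) : m = initialConfig := by
  have hle : ∀ p q, m.Adj p q → initialConfig.Adj p q := by
    intro p q h
    rw [initialConfig_adj]
    rcases adj_orthant.1 (hm.adj_graph h) with h1 | ⟨x, i, s, hx, rfl | rfl, rfl | rfl⟩
    · exact Or.inl h1
    · exact (not_adj_lo_lo hm he hx _ h).elim
    · exact Or.inr ⟨x, i, s, hx, Or.inl ⟨rfl, rfl⟩⟩
    · exact Or.inr ⟨x, i, s, hx, Or.inr ⟨rfl, rfl⟩⟩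
    · exact (not_adj_up_up hm he hx _ h).elim
  ext p q
  refine ⟨hle p q, fun h => ?_⟩
  rcases initialConfig_adj.1 h with h1 | ⟨x, i, s, hx, h1⟩
  · exact (infinite_of_isLeg hm he h1).1
  · have hp : p ∈ vertices orthantSolid := by
      rcases h1 with ⟨rfl, -⟩ | ⟨rfl, -⟩
      exacts [lo_mem hx _, up_mem hx _]
    obtain ⟨r, h2, h3⟩ := exists_adj_not_isLeg hm he hp
    rcases initialConfig_adj.1 (hle _ _ h3) with h4 | ⟨y, j, t, -, h4⟩
    · exact (h2 h4).elim
    · convert h3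
      rcases h1 with ⟨rfl, rfl⟩ | ⟨rfl, rfl⟩ <;> rcases h4 with ⟨h4, rfl⟩ | ⟨h4, rfl⟩
      · obtain ⟨rfl, rfl, rfl⟩ := lo_inj.1 h4; rfl
      · exact (lo_ne_up h4).elim
      · exact (lo_ne_up h4.symm).elim
      · obtain ⟨rfl, rfl, rfl⟩ := up_inj.1 h4; rfl

theorem exists_initialConfig_adj_iff {p : Vertex} (h : p ∈ vertices orthantSolid) :
    ∃ q r, q ≠ r ∧ ∀ z, initialConfig.Adj p z ↔ z = q ∨ z = r := by
  obtain ⟨q, hq⟩ := exists_isLeg h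
  obtain ⟨x, i, s, hx, rfl | rfl⟩ := eq_lo_or_up h
  · refine ⟨q, up x i (!s), fun e => not_isLeg_of_eq (by rw [e]; rfl) hq, fun z => ⟨fun hz => ?_, ?_⟩⟩
    · rcases initialConfig_adj.1 hz with h1 | ⟨y, j, t, -, ⟨h1, rfl⟩ | ⟨h1, rfl⟩⟩
      · exact Or.inl (h1.unique hq)
      · obtain ⟨rfl, rfl, rfl⟩ := lo_inj.1 h1; exact Or.inr rfl
      · exact (lo_ne_up h1).elim
    · rintro (rfl | rfl)
      · exact initialConfig_adj.2 (Or.inl hq)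
      · exact initialConfig_adj.2 (Or.inr ⟨x, i, s, hx, Or.inl ⟨rfl, rfl⟩⟩)
  · refine ⟨q, lo x i (!s), fun e => not_isLeg_of_eq (by rw [e]; rfl) hq, fun z => ⟨fun hz => ?_, ?_⟩⟩
    · rcases initialConfig_adj.1 hz with h1 | ⟨y, j, t, -, ⟨h1, rfl⟩ | ⟨h1, rfl⟩⟩
      · exact Or.inl (h1.unique hq)
      · exact (lo_ne_up h1.symm).elim
      · obtain ⟨rfl, rfl, rfl⟩ := up_inj.1 h1; exact Or.inr rfl
    · rintro (rfl | rfl)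
      · exact initialConfig_adj.2 (Or.inl hq)
      · exact initialConfig_adj.2 (Or.inr ⟨x, i, s, hx, Or.inr ⟨rfl, rfl⟩⟩)

open Classical in
theorem isMult_initialConfig : IsMult (assocGraph orthantSolid) (vertices orthantSolid)
    fun p q => if initialConfig.Adj p q then 1 else 0 where
  symm p q := by simp only [SimpleGraph.adj_comm]
  adj p q h := by
    have : initialConfig.Adj p q := by by_contra h'; exact h (if_neg h')
    exact this.1
  two p hp := by
    obtain ⟨a, b, hab, h⟩ := exists_initialConfig_adj_iff hp
    refine ⟨a, b, fun q => ?_⟩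
    simp only [h, Set.indicator_apply, Set.mem_singleton_iff, Pi.one_apply]
    by_cases h1 : q = a
    · subst h1; simp [hab]
    · simp [h1]

open Classical in
theorem supports_initialConfig :
    Supports initialConfig fun p q => if initialConfig.Adj p q then 1 else 0 := fun p q => by simp

open Classical in
theorem mult_initialConfig (p q : Vertex) :
    mult initialConfig p q = if initialConfig.Adj p q then 1 else 0 := by
  rw [isMult_initialConfig.mult_eq (fun _ _ => assocGraph_mem) supports_initialConfig]

theorem isConfig_initialConfig :
    IsConfig (assocGraph orthantSolid) (vertices orthantSolid) initialConfig :=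
  isMult_initialConfig.isConfig (fun _ _ => assocGraph_mem) supports_initialConfig

theorem isTaut_orthant_iff : IsTaut orthantSolid m ↔ m = initialConfig := by
  rw [isTaut_iff, isDoubleDimer_iff]
  refine ⟨fun h => eq_initialConfig h.1 h.2, ?_⟩
  rintro rfl
  exact ⟨isConfig_initialConfig, SameEnds.refl _⟩

theorem loops_initialConfig : loops initialConfig = ∅ := by
  rw [Set.eq_empty_iff_forall_notMem]
  rintro C ⟨hC, h2⟩
  obtain ⟨p, hp⟩ := C.nonempty_supp
  obtain ⟨q, hq⟩ := exists_adj_of_one_lt_ncard (by omega) hp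
  obtain ⟨r, hr⟩ := exists_isLeg hq.1.1
  have := (infinite_of_isLeg isConfig_initialConfig (SameEnds.refl _) hr).2
  rw [SimpleGraph.ConnectedComponent.mem_supp_iff] at hp
  rw [hp] at this
  exact this hC

/-! ### The count on the orthant -/

/-- Exactly the two middle edges occur, each once, and `(√14 / 3) ^ 2 = 14 / 9`. -/
theorem weightAt_initialConfig {F : LatticeSquare} (hF : orthantSolid.HasSquare F) :
    weightAt initialConfig F = heavyConst * (14 / 9) := by
  classical
  obtain ⟨x, i⟩ := F
  have h1 : ∀ i : Fin 3, i + 1 = i + sgn true ∧ i + 2 = i + sgn false ∧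
      -i - (i + sgn true) = i + sgn false ∧ -i - (i + sgn false) = i + sgn true := by decide
  obtain ⟨h1, h2, h3, h4⟩ := h1 i
  have key : ∀ b b', mult initialConfig
      (⟨x, i⟩, LatticeSquare.side ⟨x, i⟩ (i + 1) b) (⟨x, i⟩, LatticeSquare.side ⟨x, i⟩ (i + 2) b') =
      if b = b' then 0 else 1 := by
    intro b b'
    have e1 : ((⟨x, i⟩, LatticeSquare.side ⟨x, i⟩ (i + 1) b) : Vertex) =
        bif b then up x i true else lo x i true := by
      cases b
      · rfl
      · simp only [LatticeSquare.side, up, h1, h3, cond_true, Bool.not_true]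
    have e2 : ((⟨x, i⟩, LatticeSquare.side ⟨x, i⟩ (i + 2) b') : Vertex) =
        bif b' then up x i false else lo x i false := by
      cases b'
      · rfl
      · simp only [LatticeSquare.side, up, h2, h4, cond_true, Bool.not_false]
    rw [e1, e2, mult_initialConfig]
    have h0 := fun b b' => not_isLeg_of_eq (p := bif b then up x i true else lo x i true)
      (q := bif b' then up x i false else lo x i false) (by cases b <;> cases b' <;> rfl)
    cases b <;> cases b'
    · rw [if_neg, if_pos rfl]
      intro h
      rcases initialConfig_adj.1 h with h | ⟨y, j, t, -, ⟨h, h'⟩ | ⟨h, h'⟩⟩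
      exacts [h0 false false h, lo_ne_up h', lo_ne_up h]
    · rw [if_pos, if_neg (by simp)]
      exact initialConfig_adj.2 (Or.inr ⟨x, i, true, hF, Or.inl ⟨rfl, rfl⟩⟩)
    · rw [if_pos, if_neg (by simp)]
      exact initialConfig_adj.2 (Or.inr ⟨x, i, true, hF, Or.inr ⟨rfl, rfl⟩⟩)
    · rw [if_neg, if_pos rfl]
      intro h
      rcases initialConfig_adj.1 h with h | ⟨y, j, t, -, ⟨h, h'⟩ | ⟨h, h'⟩⟩
      exacts [h0 true true h, lo_ne_up h.symm, lo_ne_up h'.symm]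
  rw [weightAt, squareWeight_eq]
  simp only [key, if_true, Bool.false_eq_true, Bool.true_eq_false, if_false]
  norm_num

/-- The number of heavy squares in each coordinate plane. -/
def heavyCount (n : ℕ) : ℕ := ∑ s ∈ Finset.range n, if Odd (s + n) then s + 1 else 0

/-- Of the two new terms, `s = n` has the wrong parity and `s = n + 1` contributes `n + 2`. -/
theorem heavyCount_add_two (n : ℕ) : heavyCount (n + 2) = heavyCount n + (n + 2) := by
  rw [heavyCount, Finset.sum_range_succ, Finset.sum_range_succ, heavyCount]
  have h1 : ¬Odd (n + (n + 2)) := by rw [Nat.not_odd_iff_even]; exact ⟨n + 1, by ring⟩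
  have h2 : Odd (n + 1 + (n + 2)) := ⟨n + 1, by ring⟩
  rw [if_neg h1, if_pos h2, add_zero]
  congr 1
  refine Finset.sum_congr rfl fun s _ => ?_
  have h : Odd (s + (n + 2)) ↔ Odd (s + n) := by rw [← add_assoc, Nat.odd_add]; simp
  simp only [h]

theorem four_mul_heavyCount : ∀ n : ℕ,
    4 * heavyCount n = n * (n + 2) + if Odd n then 1 else 0
  | 0 => by simp [heavyCount]
  | 1 => by simp [heavyCount]
  | n + 2 => by
    have h : Odd (n + 2) ↔ Odd n := by rw [Nat.odd_add]; simp
    rw [heavyCount_add_two, mul_add, four_mul_heavyCount n]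
    simp only [h]
    ring

/-- The squares of the boundary of the orthant, in coordinates. -/
def orthantSquare (q : Fin 3 × ℕ × ℕ) : LatticeSquare :=
  ⟨fun l => if l = q.1 + 1 then -(q.2.1 + 1 : ℤ) else if l = q.1 + 2 then -(q.2.2 + 1 : ℤ) else 0,
    q.1⟩

theorem orthantSquare_base (q : Fin 3 × ℕ × ℕ) :
    (orthantSquare q).base q.1 = 0 ∧ (orthantSquare q).base (q.1 + 1) = -(q.2.1 + 1 : ℤ) ∧
      (orthantSquare q).base (q.1 + 2) = -(q.2.2 + 1 : ℤ) := by
  have key : ∀ i : Fin 3, i ≠ i + 1 ∧ i ≠ i + 2 ∧ i + 2 ≠ i + 1 := by decide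
  obtain ⟨h1, h2, h3⟩ := key q.1
  simp [orthantSquare, h1, h2]

theorem sum_base (x : Pt) (i : Fin 3) : ∑ k, x k = x i + x (i + 1) + x (i + 2) := by
  rw [Fin.sum_univ_three]
  fin_cases i <;> simp <;> ring

/-- The square with parameters `a` and `b` has level `-(a + b + 2)`, so heaviness means that `a + b
< n` and that `a + b + n` is odd. -/
theorem heavySquares_orthant (n : ℕ) : heavySquares n orthantSolid = orthantSquare ''
    ((Finset.univ ×ˢ ((Finset.range n).filter fun s => Odd (s + n)).biUnion
      Finset.HasAntidiagonal.antidiagonal : Finset (Fin 3 × ℕ × ℕ)) : Set (Fin 3 × ℕ × ℕ)) := by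
  ext F
  simp only [Set.mem_image, Finset.mem_coe, Finset.mem_product, Finset.mem_univ, true_and,
    Finset.mem_biUnion, Finset.mem_filter, Finset.mem_range, Finset.HasAntidiagonal.mem_antidiagonal]
  constructor
  · rintro ⟨h, h1, h2⟩
    obtain ⟨x, i⟩ := F
    rw [hasSquare_orthant] at h
    have h3 : x (i + 1) ≤ -1 := h.2 true
    have h4 : x (i + 2) ≤ -1 := h.2 false
    simp only [sum_base x i, h.1] at h1 h2
    obtain ⟨a, ha⟩ := Int.eq_ofNat_of_zero_le (show 0 ≤ -1 - x (i + 1) by omega)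
    obtain ⟨b, hb⟩ := Int.eq_ofNat_of_zero_le (show 0 ≤ -1 - x (i + 2) by omega)
    refine ⟨(i, a, b), ⟨a + b, ⟨by omega, ?_⟩, rfl⟩, LatticeSquare.ext (funext fun l => ?_) rfl⟩
    · rw [Int.odd_iff] at h2
      rw [Nat.odd_iff]
      omega
    · have key2 : ∀ l i : Fin 3, l = i ∨ l = i + 1 ∨ l = i + 2 := by decide
      obtain ⟨e1, e2, e3⟩ := orthantSquare_base (i, a, b)
      rcases key2 l i with rfl | rfl | rfl
      · exact e1.trans h.1.symm
      · exact e2.trans (by simp only; omega)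
      · exact e3.trans (by simp only; omega)
  · rintro ⟨q, ⟨s, ⟨h1, h2⟩, h3⟩, rfl⟩
    obtain ⟨e1, e2, e3⟩ := orthantSquare_base q
    refine ⟨hasSquare_orthant.2 ⟨e1, fun t => ?_⟩, ?_, ?_⟩
    · cases t
      · exact e3.trans_le (by omega)
      · exact e2.trans_le (by omega)
    · rw [sum_base _ q.1, e1, e2, e3]; omega
    · rw [sum_base _ q.1, e1, e2, e3, Int.odd_iff]
      rw [Nat.odd_iff] at h2
      omega

theorem orthantSquare_injective : Function.Injective orthantSquare := by
  intro q q' h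
  have h0 : q.1 = q'.1 := congrArg LatticeSquare.normal h
  obtain ⟨-, e2, e3⟩ := orthantSquare_base q
  obtain ⟨-, f2, f3⟩ := orthantSquare_base q'
  rw [h, h0] at e2 e3
  exact Prod.ext h0 (Prod.ext (by omega) (by omega))

theorem ncard_heavySquares_orthant (n : ℕ) :
    (heavySquares n orthantSolid).ncard = 3 * heavyCount n := by
  rw [heavySquares_orthant, Set.ncard_image_of_injective _ orthantSquare_injective,
    Set.ncard_coe_finset, Finset.card_product, Finset.card_univ, Fintype.card_fin,
    Finset.card_biUnion, heavyCount, Finset.sum_filter]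
  · simp
  · intro s _ t _ hst
    rw [Function.onFun, Finset.disjoint_left]
    intro q h1 h2
    rw [Finset.HasAntidiagonal.mem_antidiagonal] at h1 h2
    exact hst (h1.symm.trans h2)

theorem hasCount_orthant (n : ℕ) : HasCount n orthantSolid (14 ^ heavyCount n) := by
  have hset : {m | IsTaut orthantSolid m} = {initialConfig} := by
    ext m; exact isTaut_orthant_iff
  refine ⟨fun m hm => ?_, hset ▸ Set.finite_singleton _, ?_⟩
  · rw [isTaut_orthant_iff.1 hm, loops_initialConfig]; exact Set.finite_empty
  · have : (hset ▸ Set.finite_singleton _ : {m | IsTaut orthantSolid m}.Finite).toFinset =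
        {initialConfig} := by
      ext m; simp [isTaut_orthant_iff]
    rw [this, Finset.sum_singleton, loops_initialConfig, Set.ncard_empty, pow_zero, one_mul, weight,
      finprod_mem_congr rfl fun F hF => weightAt_initialConfig hF.1,
      finprod_mem_eq_finite_toFinset_prod _ (heavySquares_finite n le_rfl), Finset.prod_const,
      ← Set.ncard_eq_toFinset_card _ (heavySquares_finite n le_rfl), ncard_heavySquares_orthant,
      pow_mul, mul_pow, heavyConst_pow]
    -- Three heavy squares contribute `729 / 196 * (14 / 9) ^ 3 = 14`.
    norm_num

/-! ### Truncation of the orthant -/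

theorem orthant_sdiff_truncated_finite (n : ℕ) :
    {c | c ∈ orthantSolid ∧ c ∉ truncatedSolid n}.Finite := by
  refine (Set.finite_Icc (fun _ => -(n : ℤ) - 3) (fun _ => (0 : ℤ))).subset ?_
  rintro c ⟨h1, h2⟩
  have h3 : ∀ k, c k + 1 ≤ 0 := h1
  have h4 : -(n : ℤ) < ∑ k, (c k + 1) := by
    by_contra h; exact h2 ⟨h1, not_lt.1 h⟩
  rw [Fin.sum_univ_three] at h4
  have h5 := h3 0
  have h6 := h3 1
  have h7 := h3 2
  constructor <;> intro k <;> fin_cases k <;> simp <;> omega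

/-- The induction is on the number of missing cubes: each step fills one of them and applies
`AddsCube.hasCount` to come back. -/
theorem hasCount_of_le {n : ℕ} {z : ℝ} (hz : HasCount n orthantSolid z) (k : ℕ) :
    ∀ U : SteppedSolid, truncatedSolid n ≤ U → U ≤ orthantSolid →
      {c | c ∈ orthantSolid ∧ c ∉ U}.ncard = k → HasCount n U z := by
  induction k with
  | zero =>
    intro U h1 h2 h3
    have hfin : {c | c ∈ orthantSolid ∧ c ∉ U}.Finite :=
      (orthant_sdiff_truncated_finite n).subset fun c hc => ⟨hc.1, fun h => hc.2 (h1 h)⟩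
    rw [Set.ncard_eq_zero hfin, Set.eq_empty_iff_forall_notMem] at h3
    have : U = orthantSolid := le_antisymm h2 fun c hc => by
      by_contra h; exact h3 c ⟨hc, h⟩
    rwa [this]
  | succ k ih =>
    intro U h1 h2 h3
    have hfin : {c | c ∈ orthantSolid ∧ c ∉ U}.Finite :=
      (orthant_sdiff_truncated_finite n).subset fun c hc => ⟨hc.1, fun h => hc.2 (h1 h)⟩
    -- By minimality, everything strictly below `c` already lies in `U`, so adding this single cube
    -- gives a lower set again.
    obtain ⟨c, hc⟩ := hfin.exists_minimal (Set.nonempty_of_ncard_ne_zero (by omega))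
    have hlt : ∀ x ≤ c, x ≠ c → x ∈ U := fun x hx hne => by
      by_contra h
      exact hne (le_antisymm hx (hc.2 ⟨orthantSolid.lower hx hc.1.1, h⟩ hx))
    have hmem : ∀ x, x ∈ U ⊔ LowerSet.Iic c ↔ x ∈ U ∨ x = c := fun x => by
      rw [LowerSet.mem_sup_iff, LowerSet.mem_Iic_iff]
      constructor
      · rintro (h | h)
        · exact Or.inl h
        · by_cases e : x = c
          exacts [Or.inr e, Or.inl (hlt x h e)]
      · exact Or.imp id le_of_eq
    have hle : U ⊔ LowerSet.Iic c ≤ orthantSolid := fun x hx => by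
      rcases (hmem x).1 hx with h | rfl
      exacts [h2 h, hc.1.1]
    have hadd : AddsCube U (U ⊔ LowerSet.Iic c) c :=
      ⟨hc.1.2, fun i => hlt _ (by simp) (by simp), hmem⟩
    refine hadd.hasCount hle ?_ (ih _ (h1.trans le_sup_left) hle ?_)
    -- A cube of the orthant with coordinate sum below `-n - 2` belongs to the truncated solid and
    -- cannot be missing.
    · by_contra h
      refine hc.1.2 (h1 ⟨hc.1.1, ?_⟩)
      rw [Fin.sum_univ_three] at *
      omega
    · have : {x | x ∈ orthantSolid ∧ x ∉ U ⊔ LowerSet.Iic c} =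
          {x | x ∈ orthantSolid ∧ x ∉ U} \ {c} := by
        ext x
        rw [Set.mem_sdiff, Set.mem_ofPred_eq, Set.mem_ofPred_eq, hmem, Set.mem_singleton_iff]
        tauto
      rw [this, Set.ncard_sdiff_singleton_of_mem hc.1, h3]
      rfl

/-- All squares of this surface have level at most `-n - 2`, which is below the heavy range. -/
theorem weight_truncatedSolid (n : ℕ) (m : SimpleGraph Vertex) :
    weight n (truncatedSolid n) m = 1 := by
  have : heavySquares n (truncatedSolid n) = ∅ := by
    rw [Set.eq_empty_iff_forall_notMem]
    rintro ⟨c, i⟩ ⟨⟨⟨-, h1⟩, -⟩, h2, -⟩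
    have h3 := sum_add_unit (c - unit i) i
    rw [sub_add_cancel] at h3
    rw [Finset.sum_add_distrib] at h1
    change ∑ k, (c - unit i) k + _ ≤ _ at h1
    change _ < ∑ k, c k at h2
    simp only [Finset.sum_const, Finset.card_univ, Fintype.card_fin, nsmul_eq_mul] at h1
    push_cast at h1
    omega
  rw [weight, this, finprod_mem_empty]

end DoubleDimer

/-! ### The final formula -/

theorem mainTheorem4 (n : ℕ) :
    (∀ m : SimpleGraph DoubleDimer.Vertex,
      DoubleDimer.IsTaut (DoubleDimer.truncatedSolid n) m → (DoubleDimer.loops m).Finite) ∧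
    ∃ hfin : {m : SimpleGraph DoubleDimer.Vertex |
        DoubleDimer.IsTaut (DoubleDimer.truncatedSolid n) m}.Finite,
      ∑ m ∈ hfin.toFinset, (2 : ℝ) ^ (DoubleDimer.loops m).ncard =
        (14 : ℝ) ^ ((n : ℝ) / 2 * ((n : ℝ) / 2 + 1) + 1 / 4 * (if Odd n then (1 : ℝ) else 0)) := by
  obtain ⟨h1, hfin, h2⟩ := DoubleDimer.hasCount_of_le (DoubleDimer.hasCount_orthant n) _ _ le_rfl
    (fun c hc => hc.1) rfl
  refine ⟨h1, hfin, ?_⟩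
  simp only [DoubleDimer.weight_truncatedSolid, mul_one] at h2
  rw [h2, ← Real.rpow_natCast]
  congr 1
  have := congrArg (Nat.cast : ℕ → ℝ) (DoubleDimer.four_mul_heavyCount n)
  push_cast at this
  linarith
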